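/- Let $X$ be the line $\mathbb{R}$ or the circle $\mathbb{R}/\mathbb{Z}$. Use the Fourier transforms $\hat f(\xi)=\frac1{\sqrt{2\pi}}\int_{\mathbb{R}}e^{-ix\xi}f(x)\,dx$ for $\xi\in\mathbb{R}$ on the line (extended to $L^2$) and $\hat f(\xi)=\int_0^1e^{-ix\xi}f(x)\,dx$ for $\xi\in2\pi\mathbb{Z}$ on the circle; norms in $\xi$ are taken with respect to Lebesgue measure on $\mathbb{R}$, respectively counting measure on $2\pi\mathbb{Z}$. Let $\widehat{Hf}(\xi)=-i\,\mathrm{sgn}(\xi)\hat f(\xi)$ be the Hilbert transform (with $\mathrm{sgn}(0)=0$), let $\|f\|_{H^s}=\|(1+\xi^2)^{s/2}\hat f(\xi)\|_{L^2_\xi}$, and for $1\le r\le\infty$ let $$\|f\|_{B^{s,2}_r}=\Big(\|\hat f\|_{L^2(|\xi|\le1)}^r+\sum_{N\in\{1,2,4,8,\dots\}}N^{rs}\,\|\hat f\|_{L^2(N\le|\xi|<2N)}^r\Big)^{1/r},$$ with the usual modification (a supremum) if $r=\infty$. Let $-\frac12<s<0$. (a) For every $1\le r\le\infty$ there is a constant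 $C=C(s,r)$ such that for every real-valued, global in time solution $q\in C^0_tH^3_x\cap C^1_tH^1_x$, $t\in\mathbb{R}$, of the Benjamin–Ono equation $\partial_tq=-Hq''+2qq'$ on $X$ (with no assumption on the mean of $q$ when $X$ is the circle), the norms $\|q(t)\|_{B^{s,2}_r}$ are finite and $$\Big(1+\|q(0)\|_{B^{s,2}_r}^{\frac2{1+2s}}\Big)^{s}\sup_{t\in\mathbb{R}}\|q(t)\|_{B^{s,2}_r}\le C\,\|q(0)\|_{B^{s,2}_r},$$ $$\|q(0)\|_{B^{s,2}_r}\le C\Big(1+\|q(0)\|_{B^{s,2}_r}^{\frac2{1+2s}}\Big)^{-s}\inf_{t\in\mathbb{R}}\|q(t)\|_{B^{s,2}_r}.$$ (b) For every $\varepsilon>0$ there is a constant $C=C(s,\varepsilon)$ such that for every such solution $q$ the norms $\|q(t)\|_{H^s}$ are finite and $$\Big(1+\|q(0)\|_{H^s}^{\frac2{1+2s}}\Big)^{s-\varepsilon}\sup_{t\in\mathbb{R}}\|q(t)\|_{H^s}\le C\,\|q(0)\|_{H^s},$$ $$\|q(0)\|_{H^s}\le C\Big(1+\|q(0)\|_{H^s}^{\frac2{1+2s}}\Big)^{-s+\varepsilon}\inf_{t\in\mathbb{R}}\|q(t)\|_{H^s}.$$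 -/

import Mathlib

open MeasureTheory Filter Topology
open scoped ENNReal NNReal FourierTransform

noncomputable section

namespace BenjaminOno

/-- The complexification `L²(X; ℝ) → L²(X; ℂ)`. -/
def complexify {X : Type*} [MeasurableSpace X] {μ : Measure X} (f : Lp ℝ 2 μ) : Lp ℂ 2 μ :=
  Complex.ofRealCLM.compLp f

/-! ### Fourier transforms

Both transforms use the angular frequency `ξ` and the character `exp (-i x ξ)`. -/

/-- The `L²` Fourier transform on the line,
`f̂(ξ) = (2π)^(-1/2) ∫ exp(-i x ξ) f(x) dx`. Mathlib's `𝓕` has the kernel `exp(-2π i x ξ)`, whence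
the rescaling. -/
def lineHat (f : Lp ℝ 2 (volume : Measure ℝ)) (ξ : ℝ) : ℂ :=
  ((Real.sqrt (2 * Real.pi))⁻¹ : ℝ) *
    (𝓕 (complexify f) : Lp ℂ 2 (volume : Measure ℝ)) (ξ / (2 * Real.pi))

/-- The Fourier coefficient on the circle `ℝ/ℤ` at the frequency `ξ = 2 π n`,
`f̂(2πn) = ∫₀¹ exp(-2π i n x) f(x) dx`. -/
def circleHat (f : Lp ℝ 2 (AddCircle.haarAddCircle : Measure UnitAddCircle)) (n : ℤ) : ℂ :=
  fourierCoeff (complexify f) n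

/-- The frequency carried by the index `n` of a Fourier coefficient on `ℝ/ℤ`. -/
def circleFreq (n : ℤ) : ℝ := 2 * Real.pi * n

section Generic

/-! ### Norms on the Fourier side

`F : Ξ → ℂ` is a function of an index `x : Ξ` that carries the frequency `ω x`, and `m` is the
measure on `Ξ`. On the line, `Ξ = ℝ`, `m` is Lebesgue measure and `ω` is the identity. On the
circle, `Ξ = ℤ`, `m` is the counting measure and `ω n = 2 π n`. -/

variable {Ξ : Type*} [MeasurableSpace Ξ] (m : Measure Ξ) (ω : Ξ → ℝ)

/-- `(∫ (1 + ξ²)^s |F|²)^(1/2)`, possibly infinite. -/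
def sobolevNorm (s : ℝ) (F : Ξ → ℂ) : ℝ≥0∞ :=
  (∫⁻ x, ENNReal.ofReal ((1 + ω x ^ 2) ^ s) * ‖F x‖ₑ ^ 2 ∂m) ^ (1 / 2 : ℝ)

/-- The `L²` norm of `F` over the low frequencies `|ξ| ≤ 1`. -/
def lowPart (F : Ξ → ℂ) : ℝ≥0∞ :=
  eLpNorm F 2 (m.restrict {x | |ω x| ≤ 1})

/-- The `L²` norm of `F` over the dyadic shell `N ≤ |ξ| < 2N`, where `N = 2^n`. -/
def shellPart (F : Ξ → ℂ) (n : ℕ) : ℝ≥0∞ :=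
  eLpNorm F 2 (m.restrict {x | 2 ^ n ≤ |ω x| ∧ |ω x| < 2 ^ (n + 1)})

/-- The Besov norm `B^{s,2}_r`: the `ℓ^r` norm of the low-frequency part together with the numbers
`N^s ‖F‖_{L²(N ≤ |ξ| < 2N)}`, `N = 1, 2, 4, 8, …` (a supremum if `r = ∞`). -/
def besovNorm (s : ℝ) (r : ℝ≥0∞) (F : Ξ → ℂ) : ℝ≥0∞ :=
  if r = ∞ then
    max (lowPart m ω F) (⨆ n : ℕ, ENNReal.ofReal (((2 : ℝ) ^ n) ^ s) * shellPart m ω F n)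
  else
    (lowPart m ω F ^ r.toReal +
      ∑' n : ℕ, (ENNReal.ofReal (((2 : ℝ) ^ n) ^ s) * shellPart m ω F n) ^ r.toReal) ^ (1 / r.toReal)

/-! ### Classical solutions -/

variable {X : Type*} [MeasurableSpace X] {μ : Measure X} (hat : Lp ℝ 2 μ → Ξ → ℂ)

/-- `g` is obtained from `f` by the Fourier multiplier with symbol `σ`. -/
def IsMultiplier (σ : ℝ → ℂ) (f g : Lp ℝ 2 μ) : Prop :=
  ∀ᵐ x ∂m, hat g x = σ (ω x) * hat f x

/-- `g` is the spatial derivative of `f`, that is, `ĝ(ξ) = i ξ f̂(ξ)`. -/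
def IsDeriv (f g : Lp ℝ 2 μ) : Prop :=
  IsMultiplier m ω hat (fun ξ => Complex.I * ξ) f g

/-- `g` is the Hilbert transform of `f`, that is, `ĝ(ξ) = -i sgn(ξ) f̂(ξ)`. -/
def IsHilbert (f g : Lp ℝ 2 μ) : Prop :=
  IsMultiplier m ω hat (fun ξ => -Complex.I * (Real.sign ξ : ℝ)) f g

/-- `q` is a real-valued, global in time solution of `∂ₜ q = - H q'' + 2 q q'` that belongs to
`C⁰ₜ H³ₓ ∩ C¹ₜ H¹ₓ`. -/
structure IsClassicalSolution (q : ℝ → Lp ℝ 2 μ) : Prop where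
  /-- `q(t) ∈ H³`. -/
  mem_H3 : ∀ t, sobolevNorm m ω 3 (hat (q t)) < ∞
  /-- `t ↦ q(t)` is continuous into `H³`. -/
  continuous_H3 : ∀ t₀, Tendsto (fun t => sobolevNorm m ω 3 (hat (q t - q t₀))) (𝓝 t₀) (𝓝 0)
  /-- `t ↦ q(t)` has a continuous derivative `v` into `H¹`, and the equation holds. -/
  exists_deriv : ∃ v : ℝ → Lp ℝ 2 μ,
    (∀ t, sobolevNorm m ω 1 (hat (v t)) < ∞) ∧
    (∀ t₀, Tendsto (fun t => sobolevNorm m ω 1 (hat (v t - v t₀))) (𝓝 t₀) (𝓝 0)) ∧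
    (∀ t, Tendsto (fun h : ℝ => sobolevNorm m ω 1 (hat (h⁻¹ • (q (t + h) - q t) - v t)))
      (𝓝[≠] 0) (𝓝 0)) ∧
    (∀ t, ∃ qx qxx Hqxx : Lp ℝ 2 μ,
      IsDeriv m ω hat (q t) qx ∧ IsDeriv m ω hat qx qxx ∧ IsHilbert m ω hat qxx Hqxx ∧
      ∀ᵐ x ∂μ, v t x = -Hqxx x + 2 * q t x * qx x)

end Generic

/-! ### The line and the circle -/

/-- Classical solutions of the Benjamin–Ono equation on `ℝ`. -/
def IsClassicalSolutionLine (q : ℝ → Lp ℝ 2 (volume : Measure ℝ)) : Prop :=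
  IsClassicalSolution volume id lineHat q

/-- Classical solutions of the Benjamin–Ono equation on `ℝ/ℤ`. -/
def IsClassicalSolutionCircle
    (q : ℝ → Lp ℝ 2 (AddCircle.haarAddCircle : Measure UnitAddCircle)) : Prop :=
  IsClassicalSolution Measure.count circleFreq circleHat q

/-- The `H^s(ℝ)` norm. -/
def sobolevLine (s : ℝ) (f : Lp ℝ 2 (volume : Measure ℝ)) : ℝ≥0∞ :=
  sobolevNorm volume id s (lineHat f)

/-- The `H^s(ℝ/ℤ)` norm. -/
def sobolevCircle (s : ℝ) (f : Lp ℝ 2 (AddCircle.haarAddCircle : Measure UnitAddCircle)) : ℝ≥0∞ :=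
  sobolevNorm Measure.count circleFreq s (circleHat f)

/-- The `B^{s,2}_r(ℝ)` norm. -/
def besovLine (s : ℝ) (r : ℝ≥0∞) (f : Lp ℝ 2 (volume : Measure ℝ)) : ℝ≥0∞ :=
  besovNorm volume id s r (lineHat f)

/-- The `B^{s,2}_r(ℝ/ℤ)` norm. -/
def besovCircle (s : ℝ) (r : ℝ≥0∞)
    (f : Lp ℝ 2 (AddCircle.haarAddCircle : Measure UnitAddCircle)) : ℝ≥0∞ :=
  besovNorm Measure.count circleFreq s r (circleHat f)

/-- The two-sided a priori bound with constant `C` and exponents `a` and `b` for the values `n t` of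
a norm along a solution: every `n t` is finite, and
`(1 + n(0)^a)^(-b) sup_t n(t) ≤ C n(0)` and `n(0) ≤ C (1 + n(0)^a)^b inf_t n(t)`. -/
def TwoSidedBound (C : ℝ≥0) (a b : ℝ) (n : ℝ → ℝ≥0∞) : Prop :=
  (∀ t, n t < ∞) ∧
  (1 + n 0 ^ a) ^ (-b) * (⨆ t, n t) ≤ C * n 0 ∧
  n 0 ≤ C * ((1 + n 0 ^ a) ^ b * ⨅ t, n t)

end BenjaminOno

end

/-! The Benjamin–Ono equation has the Lax operator `L = D - T` on the nonnegative frequencies, where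
`D` multiplies by the frequency and `T` is the Toeplitz operator with symbol `q`. With `S` the
Toeplitz operator of `|D| q`, the Toeplitz operator of `∂ₜ q` is `-i [L, S - T²]` (`boRhs_sub`).
Hence `β(κ) = ⟨q₊, (L + κ)⁻¹ q₊⟩` does not change in time (`im_lax_identity`,
`conservation_identity`, `hasDerivAt_generatingFunction`). To work with bounded operators, put `R₀ =
(D + κ)⁻¹`, `A = R₀^(1/2) T R₀^(1/2)` and `u = R₀^(1/2) q₊`; then `β(κ) = ⟨u, (1 - A)⁻¹ u⟩`.

If `‖A‖ ≤ 1/2`, then `β(κ)` is comparable to `‖u‖²`, and since `q` is real also to `E(κ) = ∫ |q̂|² /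
(|ξ| + κ)`. So `E(2^j)` keeps its size for every `j` beyond a scale `J` at which `A` is small
(`energy_le_of_generatingFunction_eq`). The Hilbert–Schmidt norm of `A` satisfies `‖A‖² ≲ κ^(-δ) ∫
|q̂|² (|ξ| + κ)^(-(1-δ))` (`lintegral_resKernel_le`), and dyadic summation bounds this by energies
at higher scales (`lintegral_rpow_le_supEnergy`). With `2δ = 1 + 2s`, smallness amounts to a bound
of `sup_{j ≥ J} 2^((1+2s) j) E(2^j)` by a small multiple of `2^((1+2s) J)`; a continuity argument
carries it from time zero to all times (`exists_energy_le`).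

For `-1/2 < s < 0` the `ℓ^r` norm of `2^((s+1/2) j) E(2^j)^(1/2)` is controlled by the Besov norm,
and controls it in turn. Only `j ≥ J` is available, and recovering the lower frequencies from the
scale `J` costs `2^(-sJ)` (`exists_lrNorm_energySeq_le`, `exists_lrNorm_besovSeq_le`). Smallness at
time zero permits `2^J ~ 1 + ‖q(0)‖^(2/(1+2s))` (`exists_scale`), which turns this cost into the
stated factor. The constants do not depend on `r`, and the case `r = 2` gives `H^s` without any loss
in the exponent.

The argument runs on an abstract group of frequencies. The line and the circle enter only through
`IsFrequency` and `IsFourier`. -/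

noncomputable section

namespace BenjaminOno

set_option linter.unusedSectionVars false

section KernelOperators

/-! ### Integral operators on `L²` -/

variable {Y : Type*} [MeasurableSpace Y] {ν : Measure Y}

theorem sq_eLpNorm_two {E : Type*} [NormedAddCommGroup E] (f : Y → E) (ν : Measure Y) :
    eLpNorm f 2 ν ^ 2 = ∫⁻ x, ‖f x‖ₑ ^ 2 ∂ν := by
  have h := eLpNorm_nnreal_pow_eq_lintegral (μ := ν) (f := f) (p := 2) (by norm_num)
  simpa using h

theorem memLp_two_iff {E : Type*} [NormedAddCommGroup E] {f : Y → E} :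
    MemLp f 2 ν ↔ AEStronglyMeasurable f ν ∧ ∫⁻ x, ‖f x‖ₑ ^ 2 ∂ν < ∞ := by
  rw [MemLp, ← sq_eLpNorm_two]
  simp [lt_top_iff_ne_top]

theorem sq_lintegral_mul_le {f g : Y → ℝ≥0∞} (hf : AEMeasurable f ν) (hg : AEMeasurable g ν) :
    (∫⁻ x, f x * g x ∂ν) ^ 2 ≤ (∫⁻ x, f x ^ 2 ∂ν) * ∫⁻ x, g x ^ 2 ∂ν := by
  have h := ENNReal.lintegral_mul_le_Lp_mul_Lq ν Real.HolderConjugate.two_two hf hg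
  have h2 : ∀ a : ℝ≥0∞, (a ^ (1 / 2 : ℝ)) ^ 2 = a := fun a => by
    rw [← ENNReal.rpow_natCast, ← ENNReal.rpow_mul]; norm_num
  calc (∫⁻ x, f x * g x ∂ν) ^ 2 ≤ _ := pow_le_pow_left' h 2
    _ = _ := by
      rw [mul_pow, h2, h2]
      norm_num

theorem sq_lintegral_mul_le_weighted {f g : Y → ℝ≥0∞} (hf : AEMeasurable f ν)
    (hg : AEMeasurable g ν) :
    (∫⁻ x, f x * g x ∂ν) ^ 2 ≤ (∫⁻ x, f x ∂ν) * ∫⁻ x, f x * g x ^ 2 ∂ν := by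
  have h2 : ∀ a : ℝ≥0∞, (a ^ (1 / 2 : ℝ)) ^ 2 = a := fun a => by
    rw [← ENNReal.rpow_natCast, ← ENNReal.rpow_mul]; norm_num
  have h := sq_lintegral_mul_le (ν := ν) (f := fun x => f x ^ (1 / 2 : ℝ))
    (g := fun x => f x ^ (1 / 2 : ℝ) * g x) (hf.pow_const _) ((hf.pow_const _).mul hg)
  simp only [mul_pow, h2, ← mul_assoc, ← sq] at h
  exact h

/-- `K` is the kernel of an integral operator that is absolutely bounded on `L²` by `M`. -/
structure IsBddKernel (ν : Measure Y) (K : Y → Y → ℂ) (M : ℝ≥0) : Prop where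
  aesm : AEStronglyMeasurable (Function.uncurry K) (ν.prod ν)
  bound : ∀ g : Y → ℝ≥0∞, AEMeasurable g ν →
    ∫⁻ x, (∫⁻ y, ‖K x y‖ₑ * g y ∂ν) ^ 2 ∂ν ≤ (M : ℝ≥0∞) ^ 2 * ∫⁻ y, g y ^ 2 ∂ν

variable {K : Y → Y → ℂ} {M : ℝ≥0}

theorem IsBddKernel.of_hilbertSchmidt [SFinite ν]
    (hK : AEStronglyMeasurable (Function.uncurry K) (ν.prod ν))
    (hM : ∫⁻ x, ∫⁻ y, ‖K x y‖ₑ ^ 2 ∂ν ∂ν ≤ (M : ℝ≥0∞) ^ 2) : IsBddKernel ν K M := by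
  refine ⟨hK, fun g hg => ?_⟩
  have hm : AEMeasurable (fun x => ∫⁻ y, ‖K x y‖ₑ ^ 2 ∂ν) ν :=
    AEMeasurable.lintegral_prod_right' (f := fun z : Y × Y => ‖K z.1 z.2‖ₑ ^ 2)
      (hK.enorm.pow_const 2)
  calc ∫⁻ x, (∫⁻ y, ‖K x y‖ₑ * g y ∂ν) ^ 2 ∂ν
      ≤ ∫⁻ x, (∫⁻ y, ‖K x y‖ₑ ^ 2 ∂ν) * ∫⁻ y, g y ^ 2 ∂ν ∂ν := by
        refine lintegral_mono_ae ?_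
        filter_upwards [hK.prodMk_left] with x hx
        exact sq_lintegral_mul_le hx.enorm hg
    _ = (∫⁻ x, ∫⁻ y, ‖K x y‖ₑ ^ 2 ∂ν ∂ν) * ∫⁻ y, g y ^ 2 ∂ν := lintegral_mul_const'' _ hm
    _ ≤ _ := by gcongr

/-- Cauchy–Schwarz with weight `|K|` in each row, Tonelli, then the column bound. This serves
convolution kernels with integrable symbol; the weighted Toeplitz kernels use the Hilbert–Schmidt
criterion. -/
theorem IsBddKernel.of_schur [SFinite ν]
    (hK : AEStronglyMeasurable (Function.uncurry K) (ν.prod ν))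
    (h1 : ∀ x, ∫⁻ y, ‖K x y‖ₑ ∂ν ≤ M) (h2 : ∀ y, ∫⁻ x, ‖K x y‖ₑ ∂ν ≤ M) :
    IsBddKernel ν K M := by
  refine ⟨hK, fun g hg => ?_⟩
  have hm : AEMeasurable (Function.uncurry fun x y => ‖K x y‖ₑ * g y ^ 2) (ν.prod ν) :=
    hK.enorm.mul (hg.comp_snd.pow_const 2)
  calc ∫⁻ x, (∫⁻ y, ‖K x y‖ₑ * g y ∂ν) ^ 2 ∂ν
      ≤ ∫⁻ x, M * ∫⁻ y, ‖K x y‖ₑ * g y ^ 2 ∂ν ∂ν := by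
        refine lintegral_mono_ae ?_
        filter_upwards [hK.prodMk_left] with x hx
        refine (sq_lintegral_mul_le_weighted hx.enorm hg).trans ?_
        exact mul_le_mul_left (h1 x) _
    _ = M * ∫⁻ x, ∫⁻ y, ‖K x y‖ₑ * g y ^ 2 ∂ν ∂ν := lintegral_const_mul' _ _ (by simp)
    _ = M * ∫⁻ y, ∫⁻ x, ‖K x y‖ₑ * g y ^ 2 ∂ν ∂ν := by rw [lintegral_lintegral_swap hm]
    _ ≤ M * ∫⁻ y, M * g y ^ 2 ∂ν := by
        gcongr M * ?_
        refine lintegral_mono_ae ?_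
        filter_upwards [hK.prod_swap.prodMk_left] with y hy
        have hy' : AEMeasurable (fun x => ‖K x y‖ₑ) ν := hy.enorm
        rw [lintegral_mul_const'' _ hy']
        gcongr
        exact h2 y
    _ = _ := by
        rw [lintegral_const_mul' _ _ (by simp), ← mul_assoc, sq]

theorem IsBddKernel.ae_integrable [SFinite ν] (hK : IsBddKernel ν K M) {g : Y → ℂ}
    (hg : MemLp g 2 ν) : ∀ᵐ x ∂ν, Integrable (fun y => K x y * g y) ν := by
  have hm : AEStronglyMeasurable (fun z : Y × Y => K z.1 z.2 * g z.2) (ν.prod ν) :=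
    hK.aesm.mul hg.1.comp_snd
  have h := hK.bound (fun y => ‖g y‖ₑ) hg.1.enorm
  have h' : ∫⁻ x, (∫⁻ y, ‖K x y‖ₑ * ‖g y‖ₑ ∂ν) ^ 2 ∂ν ≠ ∞ :=
    (h.trans_lt (ENNReal.mul_lt_top (by simp) (memLp_two_iff.1 hg).2)).ne
  have hm' : AEMeasurable (fun x => (∫⁻ y, ‖K x y‖ₑ * ‖g y‖ₑ ∂ν) ^ 2) ν :=
    (AEMeasurable.lintegral_prod_right' (f := fun z : Y × Y => ‖K z.1 z.2‖ₑ * ‖g z.2‖ₑ)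
      (hK.aesm.enorm.mul hg.1.comp_snd.enorm)).pow_const 2
  filter_upwards [ae_lt_top' hm' h', hm.prodMk_left] with x hx hx'
  refine ⟨hx', ?_⟩
  simp only [HasFiniteIntegral, enorm_mul]
  by_contra hc
  simp [not_lt_top_iff.1 hc] at hx

theorem IsBddKernel.lintegral_le [SFinite ν] (hK : IsBddKernel ν K M) {g : Y → ℂ}
    (hg : MemLp g 2 ν) :
    ∫⁻ x, ‖∫ y, K x y * g y ∂ν‖ₑ ^ 2 ∂ν ≤ (M : ℝ≥0∞) ^ 2 * ∫⁻ y, ‖g y‖ₑ ^ 2 ∂ν := by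
  refine le_trans (lintegral_mono fun x => ?_) (hK.bound (fun y => ‖g y‖ₑ) hg.1.enorm)
  gcongr
  refine (enorm_integral_le_lintegral_enorm _).trans ?_
  simp [enorm_mul]

theorem IsBddKernel.memLp [SFinite ν] (hK : IsBddKernel ν K M) {g : Y → ℂ}
    (hg : MemLp g 2 ν) : MemLp (fun x => ∫ y, K x y * g y ∂ν) 2 ν :=
  memLp_two_iff.2 ⟨AEStronglyMeasurable.integral_prod_right'
      (f := fun z : Y × Y => K z.1 z.2 * g z.2) (hK.aesm.mul hg.1.comp_snd),
    (hK.lintegral_le hg).trans_lt (ENNReal.mul_lt_top (by simp) (memLp_two_iff.1 hg).2)⟩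

/-- The bounded operator on `L²` with the kernel `K`. -/
def kernelOp [SFinite ν] (K : Y → Y → ℂ) {M : ℝ≥0} (hK : IsBddKernel ν K M) :
    Lp ℂ 2 ν →L[ℂ] Lp ℂ 2 ν :=
  LinearMap.mkContinuous
    { toFun := fun g => (hK.memLp (Lp.memLp g)).toLp _
      map_add' := fun f g => by
        ext1
        filter_upwards [MemLp.coeFn_toLp (hK.memLp (Lp.memLp (f + g))),
          Lp.coeFn_add ((hK.memLp (Lp.memLp f)).toLp _) ((hK.memLp (Lp.memLp g)).toLp _),
          MemLp.coeFn_toLp (hK.memLp (Lp.memLp f)), MemLp.coeFn_toLp (hK.memLp (Lp.memLp g)),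
          hK.ae_integrable (Lp.memLp f), hK.ae_integrable (Lp.memLp g)] with x h1 h2 h3 h4 h5 h6
        rw [h1, h2, Pi.add_apply, h3, h4, ← integral_add h5 h6]
        refine integral_congr_ae ?_
        filter_upwards [Lp.coeFn_add f g] with y hy
        rw [hy, Pi.add_apply, mul_add]
      map_smul' := fun c g => by
        ext1
        filter_upwards [MemLp.coeFn_toLp (hK.memLp (Lp.memLp (c • g))),
          Lp.coeFn_smul c ((hK.memLp (Lp.memLp g)).toLp _),
          MemLp.coeFn_toLp (hK.memLp (Lp.memLp g))] with x h1 h2 h3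
        simp only [RingHom.id_apply]
        rw [h1, h2, Pi.smul_apply, h3, smul_eq_mul, ← integral_const_mul]
        refine integral_congr_ae ?_
        filter_upwards [Lp.coeFn_smul c g] with y hy
        rw [hy, Pi.smul_apply, smul_eq_mul]
        ring }
    M (fun g => by
      have h := hK.lintegral_le (Lp.memLp g)
      rw [← sq_eLpNorm_two, ← sq_eLpNorm_two, ← mul_pow] at h
      have h' := (ENNReal.pow_le_pow_left_iff two_ne_zero).1 h
      simp only [LinearMap.coe_mk, AddHom.coe_mk]
      rw [Lp.norm_toLp, Lp.norm_def]
      have := ENNReal.toReal_mono (ENNReal.mul_ne_top (by simp) (Lp.eLpNorm_ne_top g)) h'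
      simpa using this)

theorem kernelOp_coeFn [SFinite ν] (hK : IsBddKernel ν K M) (g : Lp ℂ 2 ν) :
    kernelOp K hK g =ᵐ[ν] fun x => ∫ y, K x y * g y ∂ν :=
  MemLp.coeFn_toLp (hK.memLp (Lp.memLp g))

theorem norm_kernelOp_le [SFinite ν] (hK : IsBddKernel ν K M) : ‖kernelOp K hK‖ ≤ M :=
  LinearMap.mkContinuous_norm_le _ M.2 _

theorem inner_eq_integral (f g : Lp ℂ 2 ν) :
    inner ℂ f g = ∫ x, (starRingEnd ℂ) (f x) * g x ∂ν := by
  rw [L2.inner_def]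
  simp [RCLike.inner_apply, mul_comm]

/-- Absolute boundedness, not mere boundedness, is what allows Fubini in the pairing; the symmetry
of operators with Hermitian kernels rests on it. -/
theorem IsBddKernel.integrable_prod [SFinite ν] (hK : IsBddKernel ν K M) {f g : Y → ℂ}
    (hf : MemLp f 2 ν) (hg : MemLp g 2 ν) :
    Integrable (fun z : Y × Y => (starRingEnd ℂ) (f z.1) * (K z.1 z.2 * g z.2)) (ν.prod ν) := by
  have hm : AEStronglyMeasurable (fun z : Y × Y => K z.1 z.2 * g z.2) (ν.prod ν) :=
    hK.aesm.mul hg.1.comp_snd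
  have hf' : AEStronglyMeasurable (fun x => (starRingEnd ℂ) (f x)) ν :=
    Complex.continuous_conj.comp_aestronglyMeasurable hf.1
  refine ⟨hf'.comp_fst.mul hm, ?_⟩
  rw [HasFiniteIntegral, lintegral_prod
    (fun z : Y × Y => ‖(starRingEnd ℂ) (f z.1) * (K z.1 z.2 * g z.2)‖ₑ)
    (hf'.comp_fst.mul hm).enorm]
  have hm' : AEMeasurable (fun x => ∫⁻ y, ‖K x y‖ₑ * ‖g y‖ₑ ∂ν) ν :=
    AEMeasurable.lintegral_prod_right' (f := fun z : Y × Y => ‖K z.1 z.2‖ₑ * ‖g z.2‖ₑ)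
      (hK.aesm.enorm.mul hg.1.comp_snd.enorm)
  have h1 : ∫⁻ x, ∫⁻ y, ‖(starRingEnd ℂ) (f x) * (K x y * g y)‖ₑ ∂ν ∂ν
      = ∫⁻ x, ‖f x‖ₑ * ∫⁻ y, ‖K x y‖ₑ * ‖g y‖ₑ ∂ν ∂ν := by
    refine lintegral_congr fun x => ?_
    simp only [enorm_mul, RCLike.enorm_conj]
    rw [lintegral_const_mul' _ _ (by simp)]
  rw [h1]
  have h2 := sq_lintegral_mul_le hf.1.enorm hm'
  have h3 : (∫⁻ x, ‖f x‖ₑ * ∫⁻ y, ‖K x y‖ₑ * ‖g y‖ₑ ∂ν ∂ν) ^ 2 < ∞ := by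
    refine h2.trans_lt (ENNReal.mul_lt_top (memLp_two_iff.1 hf).2 ?_)
    exact (hK.bound _ hg.1.enorm).trans_lt
      (ENNReal.mul_lt_top (by simp) (memLp_two_iff.1 hg).2)
  by_contra hc
  simp [not_lt_top_iff.1 hc] at h3

theorem kernelOp_symm [SFinite ν] (hK : IsBddKernel ν K M)
    (hs : ∀ᵐ z ∂(ν.prod ν), K z.2 z.1 = (starRingEnd ℂ) (K z.1 z.2)) (f g : Lp ℂ 2 ν) :
    inner ℂ (kernelOp K hK f) g = inner ℂ f (kernelOp K hK g) := by
  have e1 : inner ℂ f (kernelOp K hK g)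
      = ∫ x, ∫ y, (starRingEnd ℂ) (f x) * (K x y * g y) ∂ν ∂ν := by
    rw [inner_eq_integral]
    refine integral_congr_ae ?_
    filter_upwards [kernelOp_coeFn hK g] with x hx
    rw [hx, integral_const_mul]
  have e2 : inner ℂ g (kernelOp K hK f)
      = ∫ x, ∫ y, (starRingEnd ℂ) (g x) * (K x y * f y) ∂ν ∂ν := by
    rw [inner_eq_integral]
    refine integral_congr_ae ?_
    filter_upwards [kernelOp_coeFn hK f] with x hx
    rw [hx, integral_const_mul]
  rw [← inner_conj_symm, e2, e1]
  rw [integral_integral_swap (hK.integrable_prod (Lp.memLp g) (Lp.memLp f)), ← integral_conj]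
  have hs' : ∀ᵐ y ∂ν, ∀ᵐ x ∂ν, K x y = (starRingEnd ℂ) (K y x) := Measure.ae_ae_of_ae_prod hs
  refine integral_congr_ae ?_
  filter_upwards [hs'] with y hy
  rw [← integral_conj]
  refine integral_congr_ae ?_
  filter_upwards [hy] with x hx
  rw [hx]
  simp only [map_mul, Complex.conj_conj]
  ring

end KernelOperators

/-- The algebraic identity behind the conservation law, with `T` and `S` the Toeplitz operators of
`q` and `|D| q`. -/
theorem im_lax_identity {H : Type*} [NormedAddCommGroup H] [InnerProductSpace ℂ H]
    {T S : H →L[ℂ] H} (hT : ∀ f g, inner ℂ (T f) g = inner ℂ f (T g))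
    (hS : ∀ f g, inner ℂ (S f) g = inner ℂ f (S g)) {κ : ℝ} {m m₁ p p₁ : H}
    (heq : m₁ + (κ : ℂ) • m = p + T m) (hm : inner ℂ m₁ m = inner ℂ m m₁)
    (hp : inner ℂ p₁ p = inner ℂ p p₁) (hmp : inner ℂ m₁ p = inner ℂ m p₁) :
    2 * (-inner ℂ m₁ p₁ + inner ℂ m₁ (T p) - inner ℂ m (S p) + inner ℂ m (T p₁) : ℂ).im
      + (-inner ℂ m₁ (S m) + inner ℂ m (S m₁) + inner ℂ m₁ (T (T m)) - inner ℂ m (T (T m₁))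
        - inner ℂ m (S (T m)) + inner ℂ m (T (S m)) : ℂ).im = 0 := by
  have sym : ∀ {a b : H}, inner ℂ a b = inner ℂ b a → (inner ℂ b a : ℂ).im = 0 := by
    intro a b h
    rw [← Complex.conj_eq_iff_im, inner_conj_symm, h]
  have hm₁ : m₁ = p + T m - (κ : ℂ) • m := by rw [← heq]; abel
  have r1 := sym hp
  have r2 := sym hm
  have r3 := sym (hT p p)
  have r4 := sym (hT m m)
  have r5 : ∀ a : H, (inner ℂ a a : ℂ).im = 0 := fun a => sym rfl
  -- By `heq`, `p` is a combination of vectors whose pairing with `m` is real.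
  have e1 : (inner ℂ m p : ℂ).im = 0 := by
    have : p = m₁ + (κ : ℂ) • m - T m := by rw [heq]; abel
    rw [this, inner_sub_right, inner_add_right, inner_smul_right]
    simp only [Complex.add_im, Complex.sub_im, Complex.mul_im, Complex.ofReal_im, r2, r4, r5]
    ring
  -- `D` is moved from `p` to `m`; then `m₁ = p + T m - κ m` removes it.
  have e2 : (inner ℂ m p₁ : ℂ).im = (inner ℂ m (T p) : ℂ).im := by
    rw [← hmp, hm₁, inner_sub_left, inner_add_left, inner_smul_left, hT]
    simp only [Complex.add_im, Complex.sub_im, Complex.mul_im, Complex.conj_ofReal,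
      Complex.ofReal_im, e1, r5]
    ring
  have c1 : (inner ℂ p (S m) : ℂ).im = -(inner ℂ m (S p) : ℂ).im := by
    rw [← hS, ← inner_conj_symm, Complex.conj_im]
  have c2 : (inner ℂ p (T (T m)) : ℂ).im = -(inner ℂ m (T (T p)) : ℂ).im := by
    rw [← hT, ← hT, ← inner_conj_symm, Complex.conj_im]
  simp only [hm₁, map_add, map_sub, map_smul, inner_add_left, inner_sub_left, inner_add_right,
    inner_sub_right, inner_smul_left, inner_smul_right, hT, Complex.conj_ofReal]
  simp only [Complex.add_im, Complex.sub_im, Complex.neg_im, Complex.mul_im, Complex.ofReal_re,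
    Complex.ofReal_im, zero_mul, add_zero, r1, r3, e2, c1, c2]
  ring

theorem abs_max_zero_le (a : ℝ) : |max a 0| ≤ |a| := by
  rw [abs_of_nonneg (le_max_right a 0)]
  exact max_le (le_abs_self a) (abs_nonneg a)

theorem integral_sub_add {Y : Type*} [MeasurableSpace Y] {ν : Measure Y} {f g h : Y → ℂ}
    (hf : Integrable f ν) (hg : Integrable g ν) (hh : Integrable h ν) :
    ∫ x, f x - g x + h x ∂ν = (∫ x, f x ∂ν) - (∫ x, g x ∂ν) + ∫ x, h x ∂ν := by
  rw [integral_add (f := fun x => f x - g x) (hf.sub hg) hh, integral_sub hf hg]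

/-! ### Toeplitz operators on the nonnegative frequencies and the Lax commutator -/

section Frequencies

variable {G : Type*} [AddCommGroup G] [MeasurableSpace G] [MeasurableAdd₂ G] [MeasurableNeg G]
  {μ : Measure G} [SFinite μ] [μ.IsAddLeftInvariant] [μ.IsNegInvariant] {ω : G → ℝ}

/-- The measure `μ` restricted to the nonnegative frequencies. -/
abbrev posMeasure (μ : Measure G) (ω : G → ℝ) : Measure G := μ.restrict {x | 0 ≤ ω x}

/-- `ω` is a measurable additive frequency, and its resolvent kernels have the usual bounds. -/
structure IsFrequency (μ : Measure G) (ω : G → ℝ) : Prop where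
  measurable : Measurable ω
  map_add : ∀ x y, ω (x + y) = ω x + ω y
  resolvent_bound : ∀ δ : ℝ, 0 < δ → ∃ C : ℝ≥0, ∀ κ : ℝ, 1 ≤ κ →
    ∫⁻ x, ENNReal.ofReal ((ω x + κ) ^ (-(1 + δ))) ∂(posMeasure μ ω)
      ≤ C * ENNReal.ofReal (κ ^ (-δ))

theorem IsFrequency.map_zero (hω : IsFrequency μ ω) : ω 0 = 0 := by
  have := hω.map_add 0 0
  simpa using this

theorem IsFrequency.map_neg (hω : IsFrequency μ ω) (x : G) : ω (-x) = -ω x := by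
  have := hω.map_add x (-x)
  rw [add_neg_cancel, hω.map_zero] at this
  linarith

theorem IsFrequency.map_sub (hω : IsFrequency μ ω) (x y : G) : ω (x - y) = ω x - ω y := by
  rw [sub_eq_add_neg, hω.map_add, hω.map_neg, sub_eq_add_neg]

theorem IsFrequency.measurableSet (hω : IsFrequency μ ω) : MeasurableSet {x | 0 ≤ ω x} :=
  measurableSet_le measurable_const hω.measurable

theorem aestronglyMeasurable_sub {a : G → ℂ} (ha : AEStronglyMeasurable a μ) :
    AEStronglyMeasurable (Function.uncurry fun x y => a (x - y))
      ((posMeasure μ ω).prod (posMeasure μ ω)) :=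
  (ha.comp_quasiMeasurePreserving (quasiMeasurePreserving_sub_of_right_invariant μ μ)).mono_ac
    (Measure.restrict_le_self.absolutelyContinuous.prod
      Measure.restrict_le_self.absolutelyContinuous)

theorem isBddKernel_sub {a : G → ℂ} (ha : Integrable a μ) :
    IsBddKernel (posMeasure μ ω) (fun x y => a (x - y)) (∫⁻ x, ‖a x‖ₑ ∂μ).toNNReal := by
  have hc : ((∫⁻ x, ‖a x‖ₑ ∂μ).toNNReal : ℝ≥0∞) = ∫⁻ x, ‖a x‖ₑ ∂μ :=
    ENNReal.coe_toNNReal ha.2.ne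
  refine IsBddKernel.of_schur (aestronglyMeasurable_sub ha.1) (fun x => ?_) fun y => ?_
  · rw [hc]
    refine (setLIntegral_le_lintegral _ _).trans ?_
    rw [lintegral_sub_left_eq_self (fun z => ‖a z‖ₑ)]
  · rw [hc]
    refine (setLIntegral_le_lintegral _ _).trans ?_
    rw [lintegral_sub_right_eq_self (fun z => ‖a z‖ₑ)]

theorem memLp_sub_left {a : G → ℂ} (ha : MemLp a 2 μ) (x : G) : MemLp (fun z => a (x - z)) 2 μ :=
  ha.comp_measurePreserving (Measure.measurePreserving_sub_left μ x)

theorem memLp_sub_right {a : G → ℂ} (ha : MemLp a 2 μ) (y : G) : MemLp (fun z => a (z - y)) 2 μ :=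
  ha.comp_measurePreserving (measurePreserving_sub_right μ y)

theorem integrable_sub_mul {a : G → ℂ} (ha : MemLp a 2 μ) {h : G → ℂ}
    (hh : MemLp h 2 (posMeasure μ ω)) (x : G) :
    Integrable (fun y => a (x - y) * h y) (posMeasure μ ω) :=
  ((memLp_sub_left ha x).restrict _).integrable_mul hh

theorem integrable_sub_mul_sub {a b : G → ℂ} (ha : MemLp a 2 μ) (hb : MemLp b 2 μ) (x y : G) :
    Integrable (fun z => a (x - z) * b (z - y)) μ :=
  (memLp_sub_left ha x).integrable_mul (memLp_sub_right hb y)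

/-- The Toeplitz operator with symbol `a`, on the Fourier side. -/
def toeplitz (μ : Measure G) (ω : G → ℝ) (a h : G → ℂ) (x : G) : ℂ :=
  ∫ y, a (x - y) * h y ∂(posMeasure μ ω)

theorem toeplitz_congr (a : G → ℂ) {h h' : G → ℂ} (hh : h =ᵐ[posMeasure μ ω] h') :
    toeplitz μ ω a h = toeplitz μ ω a h' := by
  ext x
  refine integral_congr_ae ?_
  filter_upwards [hh] with y hy
  rw [hy]

theorem memLp_toeplitz {a h : G → ℂ} (ha : Integrable a μ) (hh : MemLp h 2 (posMeasure μ ω)) :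
    MemLp (toeplitz μ ω a h) 2 (posMeasure μ ω) :=
  (isBddKernel_sub ha).memLp hh

theorem integrable_toeplitz_toeplitz {a b h : G → ℂ} (ha : MemLp a 2 μ) (hb : Integrable b μ)
    (hh : MemLp h 2 (posMeasure μ ω)) (x : G) :
    Integrable (fun z : G × G => a (x - z.1) * (b (z.1 - z.2) * h z.2))
      ((posMeasure μ ω).prod (posMeasure μ ω)) := by
  have := (isBddKernel_sub hb).integrable_prod (((memLp_sub_left ha x).restrict _).star) hh
  simpa using this

/-- Fubini: a product of Toeplitz operators has as kernel the convolution cut off to the nonnegative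
frequencies. -/
theorem toeplitz_toeplitz {a b h : G → ℂ} (ha : MemLp a 2 μ) (hb : Integrable b μ)
    (hh : MemLp h 2 (posMeasure μ ω)) (x : G) :
    Integrable (fun y => (∫ z, a (x - z) * b (z - y) ∂(posMeasure μ ω)) * h y) (posMeasure μ ω) ∧
    ∫ y, (∫ z, a (x - z) * b (z - y) ∂(posMeasure μ ω)) * h y ∂(posMeasure μ ω)
      = toeplitz μ ω a (toeplitz μ ω b h) x := by
  have hI := integrable_toeplitz_toeplitz (ω := ω) ha hb hh x
  have e : ∀ y, (∫ z, a (x - z) * b (z - y) ∂(posMeasure μ ω)) * h y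
      = ∫ z, a (x - z) * (b (z - y) * h y) ∂(posMeasure μ ω) := fun y => by
    rw [← integral_mul_const]
    simp only [mul_assoc]
  simp only [e]
  refine ⟨hI.integral_prod_right, ?_⟩
  rw [integral_integral_swap (f := fun y z => a (x - z) * (b (z - y) * h y)) hI.swap]
  refine integral_congr_ae (Eventually.of_forall fun z => ?_)
  simp only [toeplitz]
  rw [integral_const_mul]

/-- `F` is the Fourier transform of a real-valued function with enough regularity. -/
structure IsRegular (μ : Measure G) (ω : G → ℝ) (F : G → ℂ) : Prop where
  symm : ∀ᵐ x ∂μ, F (-x) = (starRingEnd ℂ) (F x)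
  memLp : MemLp F 2 μ
  memLp_one : MemLp (fun x => ω x * F x) 2 μ
  integrable : Integrable F μ
  integrable_one : Integrable (fun x => ω x * F x) μ

/-- The symbol of `|D| q`. -/
def absSymbol (ω : G → ℝ) (F : G → ℂ) (x : G) : ℂ := (|ω x| : ℝ) * F x

/-- The right-hand side of the Benjamin–Ono equation on the Fourier side. -/
def boRhs (μ : Measure G) (ω : G → ℝ) (F : G → ℂ) (x : G) : ℂ :=
  -Complex.I * (ω x * (|ω x| : ℝ) * F x) + 2 * Complex.I * ∫ z, F (x - z) * (ω z * F z) ∂μ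

variable {F : G → ℂ}

theorem IsRegular.memLp_abs (hF : IsRegular μ ω F) (hω : IsFrequency μ ω) :
    MemLp (absSymbol ω F) 2 μ := by
  refine hF.memLp_one.of_le ?_ (Eventually.of_forall fun x => ?_)
  · exact (Complex.measurable_ofReal.comp
      (hω.measurable.abs)).aestronglyMeasurable.mul hF.memLp.1
  · simp [absSymbol]

theorem IsRegular.integrable_abs (hF : IsRegular μ ω F) (hω : IsFrequency μ ω) :
    Integrable (absSymbol ω F) μ := by
  refine hF.integrable_one.mono (hF.memLp_abs hω).1 (Eventually.of_forall fun x => ?_)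
  simp [absSymbol]

/-- The Lax equation at the level of kernels: `i (-[D, S] + [D, T²] - [S, T])`. The nonlinearity is
a convolution over all frequencies, while `T²` and `[S, T]` only see nonnegative ones. They match
because `ω x - ω y - |ω x - ω z| + |ω z - ω y|` equals `2 (ω z - ω y)₊ - 2 (ω z - ω x)₊`, which
vanishes for `ω z < 0` when `ω x` and `ω y` are nonnegative. -/
theorem boRhs_sub (hω : IsFrequency μ ω) (hF : IsRegular μ ω F) {x y : G} (hx : 0 ≤ ω x)
    (hy : 0 ≤ ω y) :
    boRhs μ ω F (x - y) =
      -Complex.I * ((ω x - ω y) * absSymbol ω F (x - y)) + Complex.I *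
        ((ω x - ω y) * (∫ z, F (x - z) * F (z - y) ∂(posMeasure μ ω))
          - (∫ z, absSymbol ω F (x - z) * F (z - y) ∂(posMeasure μ ω))
          + ∫ z, F (x - z) * absSymbol ω F (z - y) ∂(posMeasure μ ω)) := by
  set Φ : G → ℂ := fun z => F (x - z) * F (z - y) with hΦ
  have iΦ : Integrable Φ μ := integrable_sub_mul_sub hF.memLp hF.memLp x y
  have i1 : Integrable (fun z => absSymbol ω F (x - z) * F (z - y)) μ :=
    integrable_sub_mul_sub (hF.memLp_abs hω) hF.memLp x y
  have i2 : Integrable (fun z => F (x - z) * absSymbol ω F (z - y)) μ :=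
    integrable_sub_mul_sub hF.memLp (hF.memLp_abs hω) x y
  have mω : Measurable ω := hω.measurable
  have i3 : ∀ w : G, (w = x ∨ w = y) →
      Integrable (fun z => ((max (ω z - ω w) 0 : ℝ) : ℂ) * Φ z) μ := by
    rintro w (rfl | rfl)
    · refine i1.mono ((Complex.measurable_ofReal.comp
        ((mω.sub_const _).max measurable_const)).aestronglyMeasurable.mul iΦ.1)
        (Eventually.of_forall fun z => ?_)
      simp only [hΦ, absSymbol, norm_mul, hω.map_sub, Complex.norm_real, Real.norm_eq_abs, abs_abs]
      rw [mul_assoc, abs_sub_comm]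
      exact mul_le_mul_of_nonneg_right (abs_max_zero_le _) (by positivity)
    · refine i2.mono ((Complex.measurable_ofReal.comp
        ((mω.sub_const _).max measurable_const)).aestronglyMeasurable.mul iΦ.1)
        (Eventually.of_forall fun z => ?_)
      simp only [hΦ, absSymbol, norm_mul, hω.map_sub, Complex.norm_real, Real.norm_eq_abs, abs_abs]
      rw [mul_left_comm]
      exact mul_le_mul_of_nonneg_left
        (mul_le_mul_of_nonneg_right (abs_max_zero_le _) (norm_nonneg _)) (norm_nonneg _)
  have i4 : Integrable (fun z => ((max (ω y - ω z) 0 : ℝ) : ℂ) * Φ z) μ := by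
    refine i2.mono ((Complex.measurable_ofReal.comp
        ((mω.const_sub _).max measurable_const)).aestronglyMeasurable.mul iΦ.1)
        (Eventually.of_forall fun z => ?_)
    simp only [hΦ, absSymbol, norm_mul, hω.map_sub, Complex.norm_real, Real.norm_eq_abs, abs_abs]
    rw [mul_left_comm, abs_sub_comm (ω z)]
    exact mul_le_mul_of_nonneg_left
      (mul_le_mul_of_nonneg_right (abs_max_zero_le _) (norm_nonneg _)) (norm_nonneg _)
  have key1 : ((ω x - ω y : ℂ) * (∫ z, F (x - z) * F (z - y) ∂(posMeasure μ ω))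
          - (∫ z, absSymbol ω F (x - z) * F (z - y) ∂(posMeasure μ ω))
          + ∫ z, F (x - z) * absSymbol ω F (z - y) ∂(posMeasure μ ω))
      = ∫ z, 2 * (((max (ω z - ω y) 0 : ℝ) : ℂ) * Φ z)
          - 2 * (((max (ω z - ω x) 0 : ℝ) : ℂ) * Φ z) ∂μ := by
    have hsplit : ∫ z, ((ω x - ω y : ℂ) * Φ z - absSymbol ω F (x - z) * F (z - y))
          + F (x - z) * absSymbol ω F (z - y) ∂(posMeasure μ ω)
        = (ω x - ω y : ℂ) * (∫ z, Φ z ∂(posMeasure μ ω))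
          - (∫ z, absSymbol ω F (x - z) * F (z - y) ∂(posMeasure μ ω))
          + ∫ z, F (x - z) * absSymbol ω F (z - y) ∂(posMeasure μ ω) := by
      rw [integral_sub_add (iΦ.restrict.const_mul _) i1.restrict i2.restrict, integral_const_mul]
    rw [hsplit.symm, ← setIntegral_eq_integral_of_forall_compl_eq_zero (μ := μ)
      (f := fun z => 2 * (((max (ω z - ω y) 0 : ℝ) : ℂ) * Φ z)
          - 2 * (((max (ω z - ω x) 0 : ℝ) : ℂ) * Φ z)) (s := {z | 0 ≤ ω z})]
    · refine setIntegral_congr_fun hω.measurableSet fun z _ => ?_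
      simp only [hΦ, absSymbol, hω.map_sub]
      have h : (ω x - ω y - |ω x - ω z| + |ω z - ω y| : ℝ)
          = 2 * max (ω z - ω y) 0 - 2 * max (ω z - ω x) 0 := by
        rcases le_total (ω z) (ω x) with h1 | h1 <;> rcases le_total (ω z) (ω y) with h2 | h2
        · rw [abs_of_nonneg (by linarith), abs_of_nonpos (by linarith),
            max_eq_right (by linarith), max_eq_right (by linarith)]; ring
        · rw [abs_of_nonneg (by linarith), abs_of_nonneg (by linarith),
            max_eq_left (by linarith), max_eq_right (by linarith)]; ring
        · rw [abs_of_nonpos (by linarith), abs_of_nonpos (by linarith),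
            max_eq_right (by linarith), max_eq_left (by linarith)]; ring
        · rw [abs_of_nonpos (by linarith), abs_of_nonneg (by linarith),
            max_eq_left (by linarith), max_eq_left (by linarith)]; ring
      have h' := congrArg (fun r : ℝ => (r : ℂ)) h
      push_cast at h' ⊢
      linear_combination (F (x - z) * F (z - y)) * h'
    · intro z hz
      have hz' : ω z < 0 := not_le.1 hz
      rw [max_eq_right (by linarith), max_eq_right (by linarith)]
      simp
  -- The reflection `z ↦ x + y - z` exchanges the factors of `Φ`. The two positive parts thereby
  -- become the positive and negative parts of the single function `ω z - ω y`.
  have key2 : ∫ z, ((max (ω z - ω x) 0 : ℝ) : ℂ) * Φ z ∂μ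
      = ∫ z, ((max (ω y - ω z) 0 : ℝ) : ℂ) * Φ z ∂μ := by
    rw [← integral_sub_left_eq_self _ μ (x + y)]
    congr 1
    ext z
    have e1 : x - (x + y - z) = z - y := by abel
    have e2 : x + y - z - y = x - z := by abel
    have e3 : ω (x + y - z) - ω x = ω y - ω z := by rw [hω.map_sub, hω.map_add]; ring
    simp only [hΦ, e1, e2, e3]
    ring
  have key3 : ∫ z, F (x - y - z) * (ω z * F z) ∂μ
      = ∫ z, ((ω z - ω y : ℝ) : ℂ) * Φ z ∂μ := by
    rw [← integral_sub_right_eq_self _ y]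
    congr 1
    ext z
    have e1 : x - y - (z - y) = x - z := by abel
    simp only [hΦ, e1, hω.map_sub]
    ring
  have key4 : ∫ z, ((ω z - ω y : ℝ) : ℂ) * Φ z ∂μ
      = (∫ z, ((max (ω z - ω y) 0 : ℝ) : ℂ) * Φ z ∂μ)
        - ∫ z, ((max (ω y - ω z) 0 : ℝ) : ℂ) * Φ z ∂μ := by
    rw [← integral_sub (i3 y (Or.inr rfl)) i4]
    congr 1
    ext z
    rw [← sub_mul, ← Complex.ofReal_sub]
    congr 2
    rcases le_total (ω z) (ω y) with h2 | h2
    · rw [max_eq_right (by linarith), max_eq_left (by linarith)]; ring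
    · rw [max_eq_left (by linarith), max_eq_right (by linarith)]; ring
  rw [key1, integral_sub ((i3 y (Or.inr rfl)).const_mul _) ((i3 x (Or.inl rfl)).const_mul _),
    integral_const_mul, integral_const_mul, key2, boRhs, key3, key4]
  simp only [absSymbol, hω.map_sub]
  push_cast
  ring

end Frequencies

/-! ### The conservation law as an identity between integrals -/

section Conservation

variable {G : Type*} [AddCommGroup G] [MeasurableSpace G] [MeasurableAdd₂ G] [MeasurableNeg G]
  {μ : Measure G} [SFinite μ] [μ.IsAddLeftInvariant] [μ.IsNegInvariant] {ω : G → ℝ}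
  {F : G → ℂ}

theorem inner_toLp {Y : Type*} [MeasurableSpace Y] {ν : Measure Y} {a b : Y → ℂ}
    (ha : MemLp a 2 ν) (hb : MemLp b 2 ν) :
    inner ℂ (ha.toLp a) (hb.toLp b) = ∫ x, (starRingEnd ℂ) (a x) * b x ∂ν := by
  rw [inner_eq_integral]
  refine integral_congr_ae ?_
  filter_upwards [ha.coeFn_toLp, hb.coeFn_toLp] with x h1 h2
  rw [h1, h2]

theorem integrable_conj_mul {Y : Type*} [MeasurableSpace Y] {ν : Measure Y} {a b : Y → ℂ}
    (ha : MemLp a 2 ν) (hb : MemLp b 2 ν) :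
    Integrable (fun x => (starRingEnd ℂ) (a x) * b x) ν :=
  ha.star.integrable_mul hb

theorem integral_combination_four {Y : Type*} [MeasurableSpace Y] {ν : Measure Y}
    {f₁ f₂ f₃ f₄ : Y → ℂ} (h₁ : Integrable f₁ ν) (h₂ : Integrable f₂ ν) (h₃ : Integrable f₃ ν)
    (h₄ : Integrable f₄ ν) :
    ∫ x, -f₁ x + f₂ x - f₃ x + f₄ x ∂ν
      = -(∫ x, f₁ x ∂ν) + (∫ x, f₂ x ∂ν) - (∫ x, f₃ x ∂ν) + ∫ x, f₄ x ∂ν := by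
  rw [integral_sub_add (f := fun x => -f₁ x + f₂ x) (h₁.neg.add h₂) h₃ h₄,
    integral_add (f := fun x => -f₁ x) h₁.neg h₂, integral_neg]

theorem integral_combination_six {Y : Type*} [MeasurableSpace Y] {ν : Measure Y}
    {f₁ f₂ f₃ f₄ f₅ f₆ : Y → ℂ} (h₁ : Integrable f₁ ν) (h₂ : Integrable f₂ ν)
    (h₃ : Integrable f₃ ν) (h₄ : Integrable f₄ ν) (h₅ : Integrable f₅ ν) (h₆ : Integrable f₆ ν) :
    ∫ x, -f₁ x + f₂ x + f₃ x - f₄ x - f₅ x + f₆ x ∂ν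
      = -(∫ x, f₁ x ∂ν) + (∫ x, f₂ x ∂ν) + (∫ x, f₃ x ∂ν) - (∫ x, f₄ x ∂ν) - (∫ x, f₅ x ∂ν)
        + ∫ x, f₆ x ∂ν := by
  rw [integral_sub_add (f := fun x => -f₁ x + f₂ x + f₃ x - f₄ x)
      (((h₁.neg.add h₂).add h₃).sub h₄) h₅ h₆,
    integral_sub (f := fun x => -f₁ x + f₂ x + f₃ x) ((h₁.neg.add h₂).add h₃) h₄,
    integral_add (f := fun x => -f₁ x + f₂ x) (h₁.neg.add h₂) h₃,
    integral_add (f := fun x => -f₁ x) h₁.neg h₂, integral_neg]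

/-- This is `boRhs_sub` in the column `y = 0`, where `|D|` acts as `D` on the nonnegative
frequencies. -/
theorem boRhs_eq (hω : IsFrequency μ ω) (hF : IsRegular μ ω F) {x : G} (hx : 0 ≤ ω x) :
    boRhs μ ω F x = Complex.I * (-(ω x * (ω x * F x)) + ω x * toeplitz μ ω F F x
      - toeplitz μ ω (absSymbol ω F) F x + toeplitz μ ω F (fun z => ω z * F z) x) := by
  have h := boRhs_sub hω hF (x := x) (y := 0) hx hω.map_zero.ge
  simp only [sub_zero, hω.map_zero, Complex.ofReal_zero] at h
  have e : ∫ z, F (x - z) * absSymbol ω F z ∂(posMeasure μ ω)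
      = toeplitz μ ω F (fun z => ω z * F z) x := by
    refine setIntegral_congr_fun hω.measurableSet fun z hz => ?_
    simp only [absSymbol]
    rw [abs_of_nonneg hz]
  rw [h, e]
  simp only [absSymbol, toeplitz]
  rw [abs_of_nonneg hx]
  ring

/-- `boRhs_sub` is integrated against `m`. The factors `ω y` of the commutators fall on `m`, whence
the hypothesis on `ω m`. -/
theorem toeplitz_boRhs (hω : IsFrequency μ ω) (hF : IsRegular μ ω F) {m : G → ℂ}
    (hm : MemLp m 2 (posMeasure μ ω)) (hm₁ : MemLp (fun x => ω x * m x) 2 (posMeasure μ ω))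
    {x : G} (hx : 0 ≤ ω x) :
    toeplitz μ ω (boRhs μ ω F) m x = Complex.I *
      (-(ω x * toeplitz μ ω (absSymbol ω F) m x)
        + toeplitz μ ω (absSymbol ω F) (fun z => ω z * m z) x
        + ω x * toeplitz μ ω F (toeplitz μ ω F m) x
        - toeplitz μ ω F (toeplitz μ ω F fun z => ω z * m z) x
        - toeplitz μ ω (absSymbol ω F) (toeplitz μ ω F m) x
        + toeplitz μ ω F (toeplitz μ ω (absSymbol ω F) m) x) := by
  have hA := hF.memLp_abs hω
  have hA' := hF.integrable_abs hω
  obtain ⟨j1, e1⟩ := toeplitz_toeplitz (ω := ω) hF.memLp hF.integrable hm x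
  obtain ⟨j2, e2⟩ := toeplitz_toeplitz (ω := ω) hF.memLp hF.integrable hm₁ x
  obtain ⟨j3, e3⟩ := toeplitz_toeplitz (ω := ω) hA hF.integrable hm x
  obtain ⟨j4, e4⟩ := toeplitz_toeplitz (ω := ω) hF.memLp hA' hm x
  have j5 := integrable_sub_mul hA hm x
  have j6 := integrable_sub_mul hA hm₁ x
  rw [← e1, ← e2, ← e3, ← e4]
  simp only [toeplitz]
  rw [← integral_const_mul (ω x : ℂ), ← integral_const_mul (ω x : ℂ),
    ← integral_combination_six (j5.const_mul (ω x : ℂ)) j6 (j1.const_mul (ω x : ℂ)) j2 j3 j4,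
    ← integral_const_mul]
  refine setIntegral_congr_fun hω.measurableSet fun y hy => ?_
  simp only [boRhs_sub hω hF hx hy]
  ring

/-- Here `m = (L + κ)⁻¹ q₊`, and the left side is the derivative of `⟨q₊, (L + κ)⁻¹ q₊⟩` along the
equation. The unbounded `D` enters only through the two vectors `ω m` and `ω F`, so
`im_lax_identity` applies with bounded `T` and `S`. The common factor `i` turns its imaginary parts
into real parts. -/
theorem conservation_identity (hω : IsFrequency μ ω) (hF : IsRegular μ ω F) {κ : ℝ} {m : G → ℂ}
    (hm : MemLp m 2 (posMeasure μ ω)) (hm₁ : MemLp (fun x => ω x * m x) 2 (posMeasure μ ω))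
    (heq : ∀ᵐ x ∂(posMeasure μ ω), (ω x + κ) * m x = F x + toeplitz μ ω F m x) :
    2 * (∫ x, (starRingEnd ℂ) (m x) * boRhs μ ω F x ∂(posMeasure μ ω)).re
      + (∫ x, (starRingEnd ℂ) (m x) * toeplitz μ ω (boRhs μ ω F) m x ∂(posMeasure μ ω)).re = 0 := by
  have hA := hF.memLp_abs hω
  have hA' := hF.integrable_abs hω
  have kT := isBddKernel_sub (ω := ω) hF.integrable
  have kS := isBddKernel_sub (ω := ω) hA'
  have hp : MemLp F 2 (posMeasure μ ω) := hF.memLp.restrict _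
  have hp₁ : MemLp (fun x => ω x * F x) 2 (posMeasure μ ω) := hF.memLp_one.restrict _
  have hsub : Measure.QuasiMeasurePreserving (fun z : G × G => z.1 - z.2)
      ((posMeasure μ ω).prod (posMeasure μ ω)) μ :=
    (quasiMeasurePreserving_sub_of_right_invariant μ μ).mono_left
      (Measure.restrict_le_self.absolutelyContinuous.prod
        Measure.restrict_le_self.absolutelyContinuous)
  have symT : ∀ᵐ z ∂((posMeasure μ ω).prod (posMeasure μ ω)),
      F (z.2 - z.1) = (starRingEnd ℂ) (F (z.1 - z.2)) := by
    filter_upwards [hsub.ae hF.symm] with z hz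
    rw [← hz, neg_sub]
  have symS : ∀ᵐ z ∂((posMeasure μ ω).prod (posMeasure μ ω)),
      absSymbol ω F (z.2 - z.1) = (starRingEnd ℂ) (absSymbol ω F (z.1 - z.2)) := by
    filter_upwards [symT] with z hz
    simp only [absSymbol, hz, hω.map_sub, map_mul, Complex.conj_ofReal]
    rw [abs_sub_comm]
  set T := kernelOp _ kT
  set S := kernelOp _ kS
  have hTa : ∀ {a : G → ℂ} (ha : MemLp a 2 (posMeasure μ ω)),
      T (ha.toLp a) = (memLp_toeplitz hF.integrable ha).toLp _ := fun {a} ha => by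
    ext1
    refine (kernelOp_coeFn kT _).trans (EventuallyEq.trans ?_ (MemLp.coeFn_toLp _).symm)
    exact (toeplitz_congr F ha.coeFn_toLp).eventuallyEq
  have hSa : ∀ {a : G → ℂ} (ha : MemLp a 2 (posMeasure μ ω)),
      S (ha.toLp a) = (memLp_toeplitz hA' ha).toLp _ := fun {a} ha => by
    ext1
    refine (kernelOp_coeFn kS _).trans (EventuallyEq.trans ?_ (MemLp.coeFn_toLp _).symm)
    exact (toeplitz_congr (absSymbol ω F) ha.coeFn_toLp).eventuallyEq
  have hTm := memLp_toeplitz hF.integrable hm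
  have hTm₁ := memLp_toeplitz hF.integrable hm₁
  have hTp := memLp_toeplitz hF.integrable hp
  have hTp₁ := memLp_toeplitz hF.integrable hp₁
  have hSm := memLp_toeplitz hA' hm
  have hSm₁ := memLp_toeplitz hA' hm₁
  have hSp := memLp_toeplitz hA' hp
  have hTTm := memLp_toeplitz hF.integrable hTm
  have hTTm₁ := memLp_toeplitz hF.integrable hTm₁
  have hSTm := memLp_toeplitz hA' hTm
  have hTSm := memLp_toeplitz hF.integrable hSm
  have key := im_lax_identity (T := T) (S := S) (kernelOp_symm kT symT) (kernelOp_symm kS symS)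
    (κ := κ) (m := hm.toLp m) (m₁ := hm₁.toLp _) (p := hp.toLp F) (p₁ := hp₁.toLp _)
    (by
      rw [hTa hm, ← MemLp.toLp_const_smul, ← MemLp.toLp_add, ← MemLp.toLp_add]
      refine MemLp.toLp_congr _ _ ?_
      filter_upwards [heq] with x hx
      simp only [Pi.add_apply, Pi.smul_apply, smul_eq_mul]
      rw [← hx]
      ring)
    (by
      rw [inner_toLp, inner_toLp]
      congr 1
      ext x
      rw [map_mul, Complex.conj_ofReal]
      ring)
    (by
      rw [inner_toLp, inner_toLp]
      congr 1
      ext x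
      rw [map_mul, Complex.conj_ofReal]
      ring)
    (by
      rw [inner_toLp, inner_toLp]
      congr 1
      ext x
      rw [map_mul, Complex.conj_ofReal]
      ring)
  rw [hTa hp, hSa hp, hTa hp₁, hSa hm, hSa hm₁, hTa hm, hTa hTm, hTa hm₁, hTa hTm₁, hSa hTm,
    hTa hSm] at key
  simp only [inner_toLp] at key
  have E1 : ∫ x, (starRingEnd ℂ) (m x) * boRhs μ ω F x ∂(posMeasure μ ω)
      = Complex.I * (-(∫ x, (starRingEnd ℂ) (ω x * m x) * (ω x * F x) ∂(posMeasure μ ω))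
        + (∫ x, (starRingEnd ℂ) (ω x * m x) * toeplitz μ ω F F x ∂(posMeasure μ ω))
        - (∫ x, (starRingEnd ℂ) (m x) * toeplitz μ ω (absSymbol ω F) F x ∂(posMeasure μ ω))
        + ∫ x, (starRingEnd ℂ) (m x) * toeplitz μ ω F (fun z => ω z * F z) x
          ∂(posMeasure μ ω)) := by
    have k1 := integrable_conj_mul hm₁ hp₁
    have k2 := integrable_conj_mul hm₁ hTp
    have k3 := integrable_conj_mul hm hSp
    have k4 := integrable_conj_mul hm hTp₁
    rw [← integral_combination_four k1 k2 k3 k4, ← integral_const_mul]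
    refine setIntegral_congr_fun hω.measurableSet fun x hx => ?_
    simp only [boRhs_eq hω hF hx, map_mul,
      Complex.conj_ofReal]
    ring
  have E2 : ∫ x, (starRingEnd ℂ) (m x) * toeplitz μ ω (boRhs μ ω F) m x ∂(posMeasure μ ω)
      = Complex.I * (
        -(∫ x, (starRingEnd ℂ) (ω x * m x) * toeplitz μ ω (absSymbol ω F) m x ∂(posMeasure μ ω))
        + (∫ x, (starRingEnd ℂ) (m x) * toeplitz μ ω (absSymbol ω F) (fun z => ω z * m z) x
          ∂(posMeasure μ ω))
        + (∫ x, (starRingEnd ℂ) (ω x * m x) * toeplitz μ ω F (toeplitz μ ω F m) x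
          ∂(posMeasure μ ω))
        - (∫ x, (starRingEnd ℂ) (m x) * toeplitz μ ω F (toeplitz μ ω F fun z => ω z * m z) x
          ∂(posMeasure μ ω))
        - (∫ x, (starRingEnd ℂ) (m x) * toeplitz μ ω (absSymbol ω F) (toeplitz μ ω F m) x
          ∂(posMeasure μ ω))
        + ∫ x, (starRingEnd ℂ) (m x) * toeplitz μ ω F (toeplitz μ ω (absSymbol ω F) m) x
          ∂(posMeasure μ ω)) := by
    have k1 := integrable_conj_mul hm₁ hSm
    have k2 := integrable_conj_mul hm hSm₁
    have k3 := integrable_conj_mul hm₁ hTTm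
    have k4 := integrable_conj_mul hm hTTm₁
    have k5 := integrable_conj_mul hm hSTm
    have k6 := integrable_conj_mul hm hTSm
    rw [← integral_combination_six k1 k2 k3 k4 k5 k6, ← integral_const_mul]
    refine setIntegral_congr_fun hω.measurableSet fun x hx => ?_
    simp only [toeplitz_boRhs hω hF hm hm₁ hx, map_mul,
      Complex.conj_ofReal]
    ring
  rw [E1, E2, Complex.I_mul_re, Complex.I_mul_re]
  linarith

end Conservation

/-! ### The quadratic form of the resolvent of a small operator -/

section Resolvent

variable {H : Type*} [NormedAddCommGroup H] [InnerProductSpace ℂ H] [CompleteSpace H]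

/-- `Re ⟨u, (1 - A)⁻¹ u⟩`. -/
def resolventForm (A : H →L[ℂ] H) (u : H) : ℝ :=
  (inner ℂ u (Ring.inverse (1 - A) u) : ℂ).re

theorem sub_apply_inverse {A : H →L[ℂ] H} (hA : ‖A‖ < 1) (u : H) :
    Ring.inverse (1 - A) u - A (Ring.inverse (1 - A) u) = u := by
  have h : (1 - A) * Ring.inverse (1 - A) = 1 :=
    Ring.mul_inverse_cancel _ (Units.oneSub A hA).isUnit
  have := congrArg (fun B : H →L[ℂ] H => B u) h
  simpa using this

theorem resolventForm_le {A : H →L[ℂ] H} (hA : ‖A‖ ≤ 1 / 2) (u : H) :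
    resolventForm A u ≤ 2 * ‖u‖ ^ 2 := by
  have h := sub_apply_inverse (hA.trans_lt (by norm_num)) u
  set g := Ring.inverse (1 - A) u with hg
  have h1 : ‖A g‖ ≤ 1 / 2 * ‖g‖ := (A.le_opNorm g).trans (by gcongr)
  have h2 : ‖g‖ ≤ ‖u‖ + ‖A g‖ := by
    conv_lhs => rw [show g = u + A g by rw [← h]; abel]
    exact norm_add_le _ _
  have h3 : resolventForm A u ≤ ‖u‖ * ‖g‖ :=
    (Complex.re_le_norm _).trans (norm_inner_le_norm u g)
  nlinarith [norm_nonneg u, norm_nonneg g]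

/-- With `u = g - A g` the form is `‖g‖² - Re ⟨A g, g⟩ ≥ ‖g‖² / 2`, while `‖u‖ ≤ (3/2) ‖g‖`; and
`9/2 = 2 (3/2)²`. -/
theorem le_resolventForm {A : H →L[ℂ] H} (hA : ‖A‖ ≤ 1 / 2) (u : H) :
    ‖u‖ ^ 2 ≤ 9 / 2 * resolventForm A u := by
  have h := sub_apply_inverse (hA.trans_lt (by norm_num)) u
  set g := Ring.inverse (1 - A) u with hg
  have h1 : ‖A g‖ ≤ 1 / 2 * ‖g‖ := (A.le_opNorm g).trans (by gcongr)
  have h2 : ‖u‖ ≤ ‖g‖ + ‖A g‖ := by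
    rw [← h]
    exact norm_sub_le _ _
  have h3 : resolventForm A u = ‖g‖ ^ 2 - (inner ℂ (A g) g : ℂ).re := by
    rw [resolventForm, ← hg]
    conv_lhs => rw [← h]
    rw [inner_sub_left, Complex.sub_re, ← inner_self_eq_norm_sq (𝕜 := ℂ)]
    rfl
  have h4 : (inner ℂ (A g) g : ℂ).re ≤ ‖A g‖ * ‖g‖ :=
    (Complex.re_le_norm _).trans (norm_inner_le_norm _ _)
  nlinarith [norm_nonneg u, norm_nonneg g]

/-- Symmetry of `A t` lets the resolvent move to the other slot. The two variations of `u` then have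
equal real parts, and the derivative of the inverse contributes `⟨g, A' g⟩`. -/
theorem hasDerivAt_resolventForm {A : ℝ → H →L[ℂ] H} {u : ℝ → H} {A' : H →L[ℂ] H} {u' : H} {t : ℝ}
    (hA : HasDerivAt A A' t) (hu : HasDerivAt u u' t) (hA1 : ‖A t‖ < 1)
    (hs : ∀ f g, inner ℂ (A t f) g = inner ℂ f (A t g)) {g : H}
    (hg : g = Ring.inverse (1 - A t) (u t)) :
    HasDerivAt (fun t => resolventForm (A t) (u t))
      (2 * (inner ℂ g u' : ℂ).re + (inner ℂ g (A' g) : ℂ).re) t := by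
  set U := Units.oneSub (A t) hA1 with hU
  have hUv : (U : H →L[ℂ] H) = 1 - A t := rfl
  have h1 : HasDerivAt (fun s => 1 - A s) (-A') t := hA.const_sub 1
  have h2 := (hasFDerivAt_ringInverse (𝕜 := ℝ) U).comp_hasDerivAt_of_eq t h1 hUv
  have hinv : Ring.inverse (1 - A t) = ↑U⁻¹ := by rw [← hUv, Ring.inverse_unit]
  have h3 : HasDerivAt (fun s => Ring.inverse (1 - A s)) (↑U⁻¹ * A' * ↑U⁻¹ : H →L[ℂ] H) t := by
    refine h2.congr_deriv ?_
    ext w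
    simp
  have h4 : HasDerivAt (fun s => Ring.inverse (1 - A s) (u s))
      ((↑U⁻¹ * A' * ↑U⁻¹ : H →L[ℂ] H) (u t) + Ring.inverse (1 - A t) u') t := by
    have h3' := (((ContinuousLinearMap.restrictScalarsL ℂ H H ℝ ℝ).hasFDerivAt).comp_hasDerivAt
      t h3)
    exact h3'.clm_apply hu
  have h5 := hu.inner ℂ h4
  have hR : ∀ w, inner ℂ (u t) (Ring.inverse (1 - A t) w) = inner ℂ g w := fun w => by
    have e1 := sub_apply_inverse hA1 (u t)
    have e2 := sub_apply_inverse hA1 w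
    rw [← hg] at e1
    set k := Ring.inverse (1 - A t) w
    rw [← e1, inner_sub_left, hs, ← inner_sub_right, e2]
  have h6 := (Complex.reCLM.hasFDerivAt.comp_hasDerivAt t h5)
  refine h6.congr_deriv ?_
  have e3 : (↑U⁻¹ * A' * ↑U⁻¹ : H →L[ℂ] H) (u t) = Ring.inverse (1 - A t) (A' g) := by
    rw [hinv, hg, hinv]
    rfl
  rw [e3, inner_add_right, hR, hR, ← hg]
  simp only [Complex.reCLM_apply, Complex.add_re]
  have e4 : (inner ℂ u' g : ℂ).re = (inner ℂ g u' : ℂ).re := by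
    rw [← inner_conj_symm, Complex.conj_re]
  rw [e4]
  ring

end Resolvent

/-- For `b ≤ a`, the bound `κ ≤ b` gives `a - b + κ ≤ a`: the power `1 - δ` of `1/a` pays for the
difference, and the rest is passed to `b`. The product becomes a function of `a - b` times functions
of one variable, ready for Tonelli. -/
theorem resolvent_kernel_le {κ a b δ : ℝ} (hκ : 0 < κ) (ha : κ ≤ a) (hb : κ ≤ b) (hδ : 0 < δ)
    (hδ' : δ < 1) :
    a⁻¹ * b⁻¹ ≤ (|a - b| + κ) ^ (-(1 - δ)) * (a ^ (-(1 + δ)) + b ^ (-(1 + δ))) := by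
  wlog h : b ≤ a generalizing a b
  · rw [mul_comm a⁻¹, abs_sub_comm, add_comm (a ^ _)]
    exact this hb ha (le_of_not_ge h)
  have ha0 : 0 < a := hκ.trans_le ha
  have hb0 : 0 < b := hκ.trans_le hb
  rw [abs_of_nonneg (by linarith)]
  have h1 : a⁻¹ = a ^ (-(1 - δ)) * a ^ (-δ) := by
    rw [← Real.rpow_add ha0, ← Real.rpow_neg_one]
    ring_nf
  have h2 : b ^ (-(1 + δ)) = b ^ (-δ) * b⁻¹ := by
    rw [← Real.rpow_neg_one b, ← Real.rpow_add hb0]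
    ring_nf
  have h3 : a ^ (-(1 - δ)) ≤ (a - b + κ) ^ (-(1 - δ)) :=
    Real.rpow_le_rpow_of_nonpos (by linarith) (by linarith) (by linarith)
  have h4 : a ^ (-δ) ≤ b ^ (-δ) := Real.rpow_le_rpow_of_nonpos hb0 h (by linarith)
  calc a⁻¹ * b⁻¹ = (a ^ (-(1 - δ)) * a ^ (-δ)) * b⁻¹ := by rw [h1]
    _ ≤ ((a - b + κ) ^ (-(1 - δ)) * b ^ (-δ)) * b⁻¹ := by gcongr
    _ = (a - b + κ) ^ (-(1 - δ)) * b ^ (-(1 + δ)) := by rw [h2]; ring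
    _ ≤ _ := by
        gcongr
        exact le_add_of_nonneg_left (Real.rpow_nonneg ha0.le _)

/-! ### The Hilbert–Schmidt norm of the weighted Toeplitz kernel -/

section WeightedOperators

variable {G : Type*} [AddCommGroup G] [MeasurableSpace G] [MeasurableAdd₂ G] [MeasurableNeg G]
  {μ : Measure G} [SFinite μ] [μ.IsAddLeftInvariant] [μ.IsNegInvariant] {ω : G → ℝ}

/-- The square root of the free resolvent. -/
def resWeight (ω : G → ℝ) (κ : ℝ) (x : G) : ℝ := (√(ω x + κ))⁻¹

/-- The kernel of `R₀^(1/2) T R₀^(1/2)`, where `T` is the Toeplitz operator with symbol `F`. -/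
def resKernel (ω : G → ℝ) (κ : ℝ) (F : G → ℂ) (x y : G) : ℂ :=
  resWeight ω κ x * (F (x - y) * resWeight ω κ y)

theorem measurable_resWeight (hω : IsFrequency μ ω) (κ : ℝ) : Measurable (resWeight ω κ) :=
  (hω.measurable.add_const κ).sqrt.inv

theorem sq_resWeight {κ : ℝ} {x : G} (hx : 0 ≤ ω x + κ) : resWeight ω κ x ^ 2 = (ω x + κ)⁻¹ := by
  rw [resWeight, inv_pow, Real.sq_sqrt hx]

theorem aesm_resKernel (hω : IsFrequency μ ω) (κ : ℝ) {F : G → ℂ} (hF : AEStronglyMeasurable F μ) :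
    AEStronglyMeasurable (Function.uncurry (resKernel ω κ F))
      ((posMeasure μ ω).prod (posMeasure μ ω)) := by
  have hr := Complex.measurable_ofReal.comp (measurable_resWeight hω κ)
  exact (hr.comp measurable_fst).aestronglyMeasurable.mul
    ((aestronglyMeasurable_sub hF).mul (hr.comp measurable_snd).aestronglyMeasurable)

/-- By `resolvent_kernel_le` the squared kernel is at most `Φ (x - y) (R x + R y)`. Translation
invariance integrates `Φ`, and `resolvent_bound` integrates `R`. -/
theorem lintegral_resKernel_le (hω : IsFrequency μ ω) {δ : ℝ} (hδ : 0 < δ) (hδ' : δ < 1) :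
    ∃ C : ℝ≥0, ∀ κ : ℝ, 1 ≤ κ → ∀ F : G → ℂ, AEStronglyMeasurable F μ →
      ∫⁻ x, ∫⁻ y, ‖resKernel ω κ F x y‖ₑ ^ 2 ∂(posMeasure μ ω) ∂(posMeasure μ ω)
        ≤ C * ENNReal.ofReal (κ ^ (-δ)) *
          ∫⁻ z, ‖F z‖ₑ ^ 2 * ENNReal.ofReal ((|ω z| + κ) ^ (-(1 - δ))) ∂μ := by
  obtain ⟨C, hC⟩ := hω.resolvent_bound δ hδ
  refine ⟨2 * C, fun κ hκ F hF => ?_⟩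
  set Φ : G → ℝ≥0∞ := fun z => ‖F z‖ₑ ^ 2 * ENNReal.ofReal ((|ω z| + κ) ^ (-(1 - δ)))
  set R : G → ℝ≥0∞ := fun x => ENNReal.ofReal ((ω x + κ) ^ (-(1 + δ)))
  have hΦ : AEMeasurable Φ μ := (hF.enorm.pow_const 2).mul
    ((hω.measurable.abs.add_const κ).pow_const _).ennreal_ofReal.aemeasurable
  have hR : Measurable R := ((hω.measurable.add_const κ).pow_const _).ennreal_ofReal
  have hsub : Measure.QuasiMeasurePreserving (fun z : G × G => z.1 - z.2)
      ((posMeasure μ ω).prod (posMeasure μ ω)) μ :=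
    (quasiMeasurePreserving_sub_of_right_invariant μ μ).mono_left
      (Measure.restrict_le_self.absolutelyContinuous.prod
        Measure.restrict_le_self.absolutelyContinuous)
  have hΦs : AEMeasurable (fun z : G × G => Φ (z.1 - z.2))
    ((posMeasure μ ω).prod (posMeasure μ ω)) := hΦ.comp_quasiMeasurePreserving hsub
  have hpt : ∀ x, 0 ≤ ω x → ∀ y, 0 ≤ ω y →
      ‖resKernel ω κ F x y‖ₑ ^ 2 ≤ Φ (x - y) * R x + Φ (x - y) * R y := by
    intro x hx y hy
    have h := resolvent_kernel_le (κ := κ) (a := ω x + κ) (b := ω y + κ) (by linarith)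
      (by linarith) (by linarith) hδ hδ'
    have e : ω x + κ - (ω y + κ) = ω (x - y) := by rw [hω.map_sub]; ring
    rw [e, ← sq_resWeight (by linarith), ← sq_resWeight (by linarith)] at h
    have h' := ENNReal.ofReal_le_ofReal h
    rw [ENNReal.ofReal_mul (by positivity), ENNReal.ofReal_mul (by positivity),
      ENNReal.ofReal_add (Real.rpow_nonneg (by linarith) _)
        (Real.rpow_nonneg (by linarith) _)] at h'
    have e2 : ∀ w : G, ‖((resWeight ω κ w : ℝ) : ℂ)‖ₑ ^ 2
        = ENNReal.ofReal (resWeight ω κ w ^ 2) := by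
      intro w
      rw [← ofReal_norm, Complex.norm_real, ← ENNReal.ofReal_pow (norm_nonneg _),
        Real.norm_eq_abs, sq_abs]
    calc ‖resKernel ω κ F x y‖ₑ ^ 2
        = ‖F (x - y)‖ₑ ^ 2 * (ENNReal.ofReal (resWeight ω κ x ^ 2)
            * ENNReal.ofReal (resWeight ω κ y ^ 2)) := by
          rw [resKernel, enorm_mul, enorm_mul, mul_pow, mul_pow, e2, e2]
          ring
      _ ≤ ‖F (x - y)‖ₑ ^ 2 * (ENNReal.ofReal ((|ω (x - y)| + κ) ^ (-(1 - δ))) *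
            (ENNReal.ofReal ((ω x + κ) ^ (-(1 + δ))) + ENNReal.ofReal ((ω y + κ) ^ (-(1 + δ))))) :=
          mul_le_mul' le_rfl h'
      _ = _ := by
          simp only [Φ, R]
          ring
  have hswap : ∀ f : G → ℝ≥0∞, Measurable f → AEMeasurable (Function.uncurry fun x y =>
      Φ (x - y) * f y) ((posMeasure μ ω).prod (posMeasure μ ω)) := fun f hf =>
    hΦs.mul (hf.comp measurable_snd).aemeasurable
  have hae : ∀ᵐ x ∂(posMeasure μ ω), 0 ≤ ω x := ae_restrict_mem hω.measurableSet
  have hΦx : ∀ x, AEMeasurable (fun y => Φ (x - y)) (posMeasure μ ω) := fun x =>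
    (hΦ.comp_quasiMeasurePreserving (quasiMeasurePreserving_sub_left μ x)).restrict
  calc ∫⁻ x, ∫⁻ y, ‖resKernel ω κ F x y‖ₑ ^ 2 ∂(posMeasure μ ω) ∂(posMeasure μ ω)
      ≤ ∫⁻ x, ∫⁻ y, (Φ (x - y) * R x + Φ (x - y) * R y) ∂(posMeasure μ ω) ∂(posMeasure μ ω) := by
        refine lintegral_mono_ae ?_
        filter_upwards [hae] with x hx
        refine lintegral_mono_ae ?_
        filter_upwards [hae] with y hy
        exact hpt x hx y hy
    _ = ∫⁻ x, ((∫⁻ y, Φ (x - y) * R x ∂(posMeasure μ ω))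
          + ∫⁻ y, Φ (x - y) * R y ∂(posMeasure μ ω)) ∂(posMeasure μ ω) := by
        refine lintegral_congr fun x => ?_
        rw [lintegral_add_left' ((hΦx x).mul_const _)]
    _ = (∫⁻ x, ∫⁻ y, Φ (x - y) * R x ∂(posMeasure μ ω) ∂(posMeasure μ ω))
          + ∫⁻ x, ∫⁻ y, Φ (x - y) * R y ∂(posMeasure μ ω) ∂(posMeasure μ ω) := by
        rw [lintegral_add_right']
        exact AEMeasurable.lintegral_prod_right' (hswap R hR)
    _ ≤ (∫⁻ x, (∫⁻ z, Φ z ∂μ) * R x ∂(posMeasure μ ω))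
          + ∫⁻ y, (∫⁻ z, Φ z ∂μ) * R y ∂(posMeasure μ ω) := by
        refine add_le_add (lintegral_mono fun x => ?_) ?_
        · rw [lintegral_mul_const'' _ (hΦx x)]
          refine mul_le_mul' ?_ le_rfl
          refine (setLIntegral_le_lintegral _ _).trans ?_
          rw [lintegral_sub_left_eq_self]
        · rw [lintegral_lintegral_swap (hswap R hR)]
          refine lintegral_mono fun y => ?_
          have : AEMeasurable (fun x => Φ (x - y)) (posMeasure μ ω) :=
            (hΦ.comp_quasiMeasurePreserving
              (measurePreserving_sub_right μ y).quasiMeasurePreserving).restrict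
          rw [lintegral_mul_const'' _ this]
          refine mul_le_mul' ?_ le_rfl
          refine (setLIntegral_le_lintegral _ _).trans ?_
          rw [lintegral_sub_right_eq_self]
    _ = 2 * (∫⁻ x, R x ∂(posMeasure μ ω)) * ∫⁻ z, Φ z ∂μ := by
        rw [lintegral_const_mul _ hR]
        ring
    _ ≤ 2 * (C * ENNReal.ofReal (κ ^ (-δ))) * ∫⁻ z, Φ z ∂μ := by
        gcongr
        exact hC κ hκ
    _ = _ := by
        push_cast
        ring

end WeightedOperators

/-! ### The generating function and its conservation -/

section GeneratingFunction

variable {G : Type*} [AddCommGroup G] [MeasurableSpace G] [MeasurableAdd₂ G] [MeasurableNeg G]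
  {μ : Measure G} [SFinite μ] [μ.IsAddLeftInvariant] [μ.IsNegInvariant] {ω : G → ℝ} {κ : ℝ}

theorem ae_posMeasure (hω : IsFrequency μ ω) : ∀ᵐ x ∂(posMeasure μ ω), 0 ≤ ω x :=
  ae_restrict_mem hω.measurableSet

theorem absolutelyContinuous_posMeasure : posMeasure μ ω ≪ μ :=
  Measure.restrict_le_self.absolutelyContinuous

theorem resWeight_nonneg (x : G) : 0 ≤ resWeight ω κ x :=
  inv_nonneg.2 (Real.sqrt_nonneg _)

theorem resWeight_le_one (hκ : 1 ≤ κ) {x : G} (hx : 0 ≤ ω x) : resWeight ω κ x ≤ 1 :=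
  inv_le_one_of_one_le₀ (Real.one_le_sqrt.2 (by linarith))

theorem memLp_resWeight_mul (hω : IsFrequency μ ω) (hκ : 1 ≤ κ) {F : G → ℂ}
    (hF : MemLp F 2 (posMeasure μ ω)) :
    MemLp (fun x => resWeight ω κ x * F x) 2 (posMeasure μ ω) := by
  refine hF.of_le ((Complex.measurable_ofReal.comp
    (measurable_resWeight hω κ)).aestronglyMeasurable.mul hF.1) ?_
  filter_upwards [ae_posMeasure hω] with x hx
  rw [norm_mul, Complex.norm_real, Real.norm_of_nonneg (resWeight_nonneg x)]
  exact mul_le_of_le_one_left (norm_nonneg _) (resWeight_le_one hκ hx)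

/-- The map `F ↦ R₀^(1/2) F` into `L²` of the nonnegative frequencies. -/
def weightOp (hω : IsFrequency μ ω) (hκ : 1 ≤ κ) : Lp ℂ 2 μ →L[ℂ] Lp ℂ 2 (posMeasure μ ω) :=
  LinearMap.mkContinuous
    { toFun := fun F => (memLp_resWeight_mul hω hκ ((Lp.memLp F).restrict _)).toLp _
      map_add' := fun F F' => by
        rw [← MemLp.toLp_add]
        refine MemLp.toLp_congr _ _ ?_
        filter_upwards [absolutelyContinuous_posMeasure.ae_le (Lp.coeFn_add F F')] with x hx
        rw [hx, Pi.add_apply, Pi.add_apply, mul_add]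
      map_smul' := fun c F => by
        rw [RingHom.id_apply, ← MemLp.toLp_const_smul]
        refine MemLp.toLp_congr _ _ ?_
        filter_upwards [absolutelyContinuous_posMeasure.ae_le (Lp.coeFn_smul c F)] with x hx
        rw [hx, Pi.smul_apply, Pi.smul_apply, smul_eq_mul, smul_eq_mul, mul_left_comm] }
    1 (fun F => by
      simp only [LinearMap.coe_mk, AddHom.coe_mk, one_mul]
      rw [Lp.norm_toLp, Lp.norm_def]
      refine ENNReal.toReal_mono (Lp.eLpNorm_ne_top F) ?_
      refine le_trans (eLpNorm_mono_ae ?_) (eLpNorm_mono_measure F Measure.restrict_le_self)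
      filter_upwards [ae_posMeasure hω] with x hx
      rw [norm_mul, Complex.norm_real, Real.norm_of_nonneg (resWeight_nonneg x)]
      exact mul_le_of_le_one_left (norm_nonneg _) (resWeight_le_one hκ hx))

theorem weightOp_coeFn (hω : IsFrequency μ ω) (hκ : 1 ≤ κ) (F : Lp ℂ 2 μ) :
    weightOp hω hκ F =ᵐ[posMeasure μ ω] fun x => resWeight ω κ x * F x :=
  MemLp.coeFn_toLp (memLp_resWeight_mul hω hκ ((Lp.memLp F).restrict _))

/-- A qualitative bound, for which any `δ` in `(0, 1)` would do. It makes the weighted operator a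
bounded linear function of its `L²` symbol, hence differentiable along the flow. -/
theorem exists_isBddKernel_resKernel (hω : IsFrequency μ ω) (hκ : 1 ≤ κ) :
    ∃ C : ℝ≥0, ∀ F : Lp ℂ 2 μ, IsBddKernel (posMeasure μ ω) (resKernel ω κ F) (C * ‖F‖₊) := by
  obtain ⟨C, hC⟩ := lintegral_resKernel_le hω (δ := 1 / 2) (by norm_num) (by norm_num)
  refine ⟨NNReal.sqrt C, fun F => ?_⟩
  refine IsBddKernel.of_hilbertSchmidt (aesm_resKernel hω κ (Lp.aestronglyMeasurable F)) ?_
  have h1 : ∀ {a b : ℝ}, 1 ≤ a → b ≤ 0 → ENNReal.ofReal (a ^ b) ≤ 1 := fun ha hb =>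
    ENNReal.ofReal_le_one.2 (Real.rpow_le_one_of_one_le_of_nonpos ha hb)
  have h2 : (‖F‖₊ : ℝ≥0∞) ^ 2 = ∫⁻ z, ‖F z‖ₑ ^ 2 ∂μ := by
    rw [← sq_eLpNorm_two, Lp.nnnorm_def, ENNReal.coe_toNNReal (Lp.eLpNorm_ne_top F)]
  calc _ ≤ _ := hC κ hκ F (Lp.aestronglyMeasurable F)
    _ ≤ C * 1 * ∫⁻ z, ‖F z‖ₑ ^ 2 * 1 ∂μ := by
        gcongr with z
        · exact h1 hκ (by norm_num)
        · exact h1 (le_add_of_nonneg_of_le (abs_nonneg _) hκ) (by norm_num)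
    _ = _ := by
        rw [ENNReal.coe_mul, mul_pow, h2, ← ENNReal.coe_pow, NNReal.sq_sqrt]
        simp

theorem isBddKernel_resKernel (hω : IsFrequency μ ω) (hκ : 1 ≤ κ) (F : Lp ℂ 2 μ) :
    IsBddKernel (posMeasure μ ω) (resKernel ω κ F)
      ((exists_isBddKernel_resKernel hω hκ).choose * ‖F‖₊) :=
  (exists_isBddKernel_resKernel hω hκ).choose_spec F

theorem resKernel_mul_congr {F F' : G → ℂ} (h : F =ᵐ[μ] F') (g : G → ℂ) (x : G) :
    ∫ y, resKernel ω κ F x y * g y ∂(posMeasure μ ω)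
      = ∫ y, resKernel ω κ F' x y * g y ∂(posMeasure μ ω) := by
  refine integral_congr_ae ?_
  filter_upwards [absolutelyContinuous_posMeasure.ae_le
    ((quasiMeasurePreserving_sub_left μ x).ae h)] with y hy
  simp only [resKernel, hy]

/-- The map that sends `F` to the operator `R₀^(1/2) T R₀^(1/2)`, where `T` is the Toeplitz operator
with symbol `F`. -/
def resOp (hω : IsFrequency μ ω) (hκ : 1 ≤ κ) :
    Lp ℂ 2 μ →L[ℂ] Lp ℂ 2 (posMeasure μ ω) →L[ℂ] Lp ℂ 2 (posMeasure μ ω) :=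
  LinearMap.mkContinuous
    { toFun := fun F => kernelOp (resKernel ω κ F) (isBddKernel_resKernel hω hκ F)
      map_add' := fun F F' => by
        ext g
        refine (kernelOp_coeFn _ g).trans (EventuallyEq.trans ?_ (Lp.coeFn_add _ _).symm)
        filter_upwards [kernelOp_coeFn (isBddKernel_resKernel hω hκ F) g,
          kernelOp_coeFn (isBddKernel_resKernel hω hκ F') g,
          (isBddKernel_resKernel hω hκ F).ae_integrable (Lp.memLp g),
          (isBddKernel_resKernel hω hκ F').ae_integrable (Lp.memLp g)] with x h1 h2 h3 h4
        rw [Pi.add_apply]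
        refine Eq.trans ?_ (congrArg₂ (· + ·) h1.symm h2.symm)
        rw [← integral_add h3 h4, resKernel_mul_congr (Lp.coeFn_add F F')]
        refine integral_congr_ae (Eventually.of_forall fun y => ?_)
        simp only [resKernel, Pi.add_apply]
        ring
      map_smul' := fun c F => by
        ext g
        refine (kernelOp_coeFn _ g).trans (EventuallyEq.trans ?_ (Lp.coeFn_smul _ _).symm)
        filter_upwards [kernelOp_coeFn (isBddKernel_resKernel hω hκ F) g] with x h1
        rw [RingHom.id_apply, Pi.smul_apply]
        refine Eq.trans ?_ (congrArg (c • ·) h1.symm)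
        rw [smul_eq_mul, ← integral_const_mul,
          resKernel_mul_congr (Lp.coeFn_smul c F)]
        refine integral_congr_ae (Eventually.of_forall fun y => ?_)
        simp only [resKernel, Pi.smul_apply, smul_eq_mul]
        ring }
    (exists_isBddKernel_resKernel hω hκ).choose
    (fun F => norm_kernelOp_le (isBddKernel_resKernel hω hκ F))

theorem resOp_coeFn (hω : IsFrequency μ ω) (hκ : 1 ≤ κ) (F : Lp ℂ 2 μ)
    (g : Lp ℂ 2 (posMeasure μ ω)) :
    resOp hω hκ F g =ᵐ[posMeasure μ ω]
      fun x => ∫ y, resKernel ω κ F x y * g y ∂(posMeasure μ ω) :=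
  kernelOp_coeFn (isBddKernel_resKernel hω hκ F) g

/-- The operator depends on the kernel alone, so the crude constant of its construction may be
replaced by the Hilbert–Schmidt norm. -/
theorem norm_resOp_le (hω : IsFrequency μ ω) (hκ : 1 ≤ κ) (F : Lp ℂ 2 μ) {M : ℝ≥0}
    (hM : ∫⁻ x, ∫⁻ y, ‖resKernel ω κ F x y‖ₑ ^ 2 ∂(posMeasure μ ω) ∂(posMeasure μ ω)
      ≤ (M : ℝ≥0∞) ^ 2) : ‖resOp hω hκ F‖ ≤ M := by
  have hK := IsBddKernel.of_hilbertSchmidt (aesm_resKernel hω κ (Lp.aestronglyMeasurable F)) hM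
  have : resOp hω hκ F = kernelOp (resKernel ω κ F) hK := by
    ext g
    exact (resOp_coeFn hω hκ F g).trans (kernelOp_coeFn hK g).symm
  rw [this]
  exact norm_kernelOp_le hK

theorem resOp_symm (hω : IsFrequency μ ω) (hκ : 1 ≤ κ) {F : Lp ℂ 2 μ}
    (hF : ∀ᵐ x ∂μ, F (-x) = (starRingEnd ℂ) (F x)) (f g : Lp ℂ 2 (posMeasure μ ω)) :
    inner ℂ (resOp hω hκ F f) g = inner ℂ f (resOp hω hκ F g) := by
  refine kernelOp_symm (isBddKernel_resKernel hω hκ F) ?_ f g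
  have hsub : Measure.QuasiMeasurePreserving (fun z : G × G => z.1 - z.2)
      ((posMeasure μ ω).prod (posMeasure μ ω)) μ :=
    (quasiMeasurePreserving_sub_of_right_invariant μ μ).mono_left
      (absolutelyContinuous_posMeasure.prod absolutelyContinuous_posMeasure)
  filter_upwards [hsub.ae hF] with z hz
  rw [neg_sub] at hz
  simp only [resKernel, hz, map_mul, Complex.conj_ofReal]
  ring

/-- The generating function `⟨q₊, (L + κ)⁻¹ q₊⟩` of the conservation laws. -/
def generatingFunction (hω : IsFrequency μ ω) (hκ : 1 ≤ κ) (F : Lp ℂ 2 μ) : ℝ :=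
  resolventForm (resOp hω hκ F) (weightOp hω hκ F)

/-- A solution of the Benjamin–Ono equation on the Fourier side. -/
structure IsFlow (μ : Measure G) (ω : G → ℝ) (F : ℝ → Lp ℂ 2 μ) : Prop where
  regular : ∀ t, IsRegular μ ω (F t)
  deriv : ∀ t, ∃ V : Lp ℂ 2 μ, HasDerivAt F V t ∧ V =ᵐ[μ] boRhs μ ω (F t)

theorem hasDerivAt_generatingFunction (hω : IsFrequency μ ω) (hκ : 1 ≤ κ) {F : ℝ → Lp ℂ 2 μ}
    (hF : IsFlow μ ω F) {t : ℝ} (ht : ‖resOp hω hκ (F t)‖ < 1) :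
    HasDerivAt (fun t => generatingFunction hω hκ (F t)) 0 t := by
  obtain ⟨V, hV, hVe⟩ := hF.deriv t
  have hR := hF.regular t
  have dA : HasDerivAt (fun s => resOp hω hκ (F s)) (resOp hω hκ V) t :=
    (((resOp hω hκ).restrictScalars ℝ).hasFDerivAt).comp_hasDerivAt t hV
  have du : HasDerivAt (fun s => weightOp hω hκ (F s)) (weightOp hω hκ V) t :=
    (((weightOp hω hκ).restrictScalars ℝ).hasFDerivAt).comp_hasDerivAt t hV
  have hg := sub_apply_inverse ht (weightOp hω hκ (F t))
  refine (hasDerivAt_resolventForm dA du ht (resOp_symm hω hκ hR.symm) rfl).congr_deriv ?_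
  set g := Ring.inverse (1 - resOp hω hκ (F t)) (weightOp hω hκ (F t))
  -- Undoing the symmetrisation: `m = R₀^(1/2) (1 - A)⁻¹ R₀^(1/2) q₊ = (L + κ)⁻¹ q₊`.
  set m : G → ℂ := fun x => resWeight ω κ x * g x with hm_def
  have hm : MemLp m 2 (posMeasure μ ω) := memLp_resWeight_mul hω hκ (Lp.memLp g)
  have hsq : ∀ x, 0 ≤ ω x →
      (ω x + κ : ℂ) * ((resWeight ω κ x : ℂ) * resWeight ω κ x) = 1 := fun x hx => by
    have h1 : 0 < ω x + κ := by linarith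
    have := sq_resWeight (ω := ω) (κ := κ) (x := x) h1.le
    rw [sq] at this
    rw [← Complex.ofReal_mul, this, ← Complex.ofReal_add, ← Complex.ofReal_mul,
      mul_inv_cancel₀ h1.ne', Complex.ofReal_one]
  have hker : ∀ (a : G → ℂ) (x : G), ∫ y, resKernel ω κ a x y * g y ∂(posMeasure μ ω)
      = resWeight ω κ x * toeplitz μ ω a m x := fun a x => by
    rw [toeplitz, ← integral_const_mul]
    refine integral_congr_ae (Eventually.of_forall fun y => ?_)
    simp only [resKernel, hm_def]
    ring
  have heq : ∀ᵐ x ∂(posMeasure μ ω), (ω x + κ) * m x = F t x + toeplitz μ ω (F t) m x := by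
    have hg' : ∀ᵐ x ∂(posMeasure μ ω), g x - resOp hω hκ (F t) g x = weightOp hω hκ (F t) x := by
      filter_upwards [Lp.coeFn_sub g (resOp hω hκ (F t) g)] with x hx
      rw [← hg, hx, Pi.sub_apply]
    filter_upwards [hg', weightOp_coeFn hω hκ (F t), resOp_coeFn hω hκ (F t) g,
      ae_posMeasure hω] with x h1 h2 h3 h4
    rw [h2, h3, hker] at h1
    have h5 : g x = resWeight ω κ x * (F t x + toeplitz μ ω (F t) m x) := by
      rw [mul_add, ← h1]; ring
    rw [hm_def]
    simp only
    rw [h5]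
    linear_combination (F t x + toeplitz μ ω (F t) m x) * hsq x h4
  -- The resolvent equation itself gives the regularity: `ω m = F + T m - κ m`.
  have hm₁ : MemLp (fun x => ω x * m x) 2 (posMeasure μ ω) := by
    have h := ((hR.memLp.restrict {x | 0 ≤ ω x}).add (memLp_toeplitz hR.integrable hm)).sub
      (hm.const_mul (κ : ℂ))
    refine h.ae_eq ?_
    filter_upwards [heq] with x hx
    simp only [Pi.sub_apply, Pi.add_apply]
    rw [← hx]
    ring
  have key := conservation_identity hω hR hm hm₁ heq
  have e1 : inner ℂ g (weightOp hω hκ V)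
      = ∫ x, (starRingEnd ℂ) (m x) * boRhs μ ω (F t) x ∂(posMeasure μ ω) := by
    rw [inner_eq_integral]
    refine integral_congr_ae ?_
    filter_upwards [weightOp_coeFn hω hκ V, absolutelyContinuous_posMeasure.ae_le hVe] with x h1 h2
    rw [h1, h2]
    simp only [hm_def, map_mul, Complex.conj_ofReal]
    ring
  have e2 : inner ℂ g (resOp hω hκ V g)
      = ∫ x, (starRingEnd ℂ) (m x) * toeplitz μ ω (boRhs μ ω (F t)) m x ∂(posMeasure μ ω) := by
    rw [inner_eq_integral]
    refine integral_congr_ae ?_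
    filter_upwards [resOp_coeFn hω hκ V g] with x h1
    rw [h1, resKernel_mul_congr hVe, hker]
    simp only [hm_def, map_mul, Complex.conj_ofReal]
    ring
  rw [e1, e2]
  exact key

end GeneratingFunction

theorem two_rpow_add (x y : ℝ) : (2 : ℝ≥0∞) ^ (x + y) = 2 ^ x * 2 ^ y :=
  ENNReal.rpow_add x y (by norm_num) (by norm_num)

theorem two_rpow_ne_top (x : ℝ) : (2 : ℝ≥0∞) ^ x ≠ ∞ :=
  ENNReal.rpow_ne_top_of_ne_zero (by norm_num) (by norm_num)

theorem two_rpow_neg_mul (x : ℝ) : (2 : ℝ≥0∞) ^ (-x) * 2 ^ x = 1 := by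
  rw [← two_rpow_add, neg_add_cancel, ENNReal.rpow_zero]

theorem ofReal_two_rpow (x : ℝ) : ENNReal.ofReal ((2 : ℝ) ^ x) = 2 ^ x := by
  rw [← ENNReal.ofReal_rpow_of_pos (by norm_num)]
  norm_num

theorem two_rpow_mono {x y : ℝ} (h : x ≤ y) : (2 : ℝ≥0∞) ^ x ≤ 2 ^ y :=
  ENNReal.rpow_le_rpow_of_exponent_le (by norm_num) h

theorem tsum_two_rpow_lt_top {δ : ℝ} (hδ : 0 < δ) : ∑' k : ℕ, (2 : ℝ≥0∞) ^ (-(δ * k)) < ∞ := by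
  have h : ∀ k : ℕ, (2 : ℝ≥0∞) ^ (-(δ * k)) = (2 ^ (-δ)) ^ k := fun k => by
    rw [← ENNReal.rpow_natCast, ← ENNReal.rpow_mul, neg_mul]
  simp only [h]
  rw [ENNReal.tsum_geometric, ENNReal.inv_lt_top]
  exact tsub_pos_of_lt (ENNReal.rpow_lt_one_of_one_lt_of_neg (by norm_num) (by linarith))

/-! ### Energies at dyadic spectral parameters -/

section Energy

variable {G : Type*} [MeasurableSpace G] {μ : Measure G} {ω : G → ℝ}

/-- `∫ |F|² / (|ξ| + 2^j)`. -/
def energy (μ : Measure G) (ω : G → ℝ) (j : ℕ) (F : G → ℂ) : ℝ≥0∞ :=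
  ∫⁻ x, ‖F x‖ₑ ^ 2 * ENNReal.ofReal ((|ω x| + 2 ^ j)⁻¹) ∂μ

/-- `sup_{j ≥ J} 2^(σ j) ∫ |F|² / (|ξ| + 2^j)`. -/
def supEnergy (μ : Measure G) (ω : G → ℝ) (σ : ℝ) (J : ℕ) (F : G → ℂ) : ℝ≥0∞ :=
  ⨆ j, ⨆ (_ : J ≤ j), 2 ^ (σ * j) * energy μ ω j F

theorem le_supEnergy {σ : ℝ} {J j : ℕ} (h : J ≤ j) (F : G → ℂ) :
    2 ^ (σ * j) * energy μ ω j F ≤ supEnergy μ ω σ J F :=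
  le_iSup₂ (f := fun (j : ℕ) (_ : J ≤ j) => (2 : ℝ≥0∞) ^ (σ * j) * energy μ ω j F) j h

theorem energy_congr {F F' : G → ℂ} (h : F =ᵐ[μ] F') (j : ℕ) :
    energy μ ω j F = energy μ ω j F' := by
  refine lintegral_congr_ae ?_
  filter_upwards [h] with x hx
  rw [hx]

theorem energy_le (j : ℕ) (F : G → ℂ) :
    energy μ ω j F ≤ 2 ^ (-(j : ℝ)) * ∫⁻ x, ‖F x‖ₑ ^ 2 ∂μ := by
  rw [← lintegral_const_mul' _ _ (two_rpow_ne_top _)]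
  refine lintegral_mono fun x => ?_
  rw [mul_comm]
  gcongr
  rw [← ofReal_two_rpow, Real.rpow_neg (by norm_num), Real.rpow_natCast]
  gcongr
  exact le_add_of_nonneg_left (abs_nonneg _)

theorem energy_add_le (hω : Measurable ω) (j : ℕ) {F F' : G → ℂ} (hF : AEStronglyMeasurable F μ) :
    energy μ ω j (F + F') ≤ 2 * energy μ ω j F + 2 * energy μ ω j F' := by
  have hw : Measurable fun x => ENNReal.ofReal ((|ω x| + 2 ^ j)⁻¹) :=
    ((hω.abs.add_const _).inv).ennreal_ofReal
  rw [energy, energy, energy, ← lintegral_const_mul' _ _ (by norm_num),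
    ← lintegral_const_mul' _ _ (by norm_num), ← lintegral_add_left'
      (f := fun x => 2 * (‖F x‖ₑ ^ 2 * ENNReal.ofReal ((|ω x| + 2 ^ j)⁻¹)))
      (((hF.enorm.pow_const 2).mul hw.aemeasurable).const_mul 2)]
  refine lintegral_mono fun x => ?_
  rw [← mul_assoc, ← mul_assoc, ← add_mul, ← mul_add]
  gcongr
  have h : ‖(F + F') x‖ₑ ≤ ‖F x‖ₑ + ‖F' x‖ₑ := enorm_add_le _ _
  refine (pow_le_pow_left' h 2).trans ?_
  have := ENNReal.rpow_add_le_mul_rpow_add_rpow ‖F x‖ₑ ‖F' x‖ₑ (p := 2) (by norm_num)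
  norm_num at this
  exact this

/-- The weight `2^(σ j)` is absorbed by `2^(-j)`. Continuity of the flow in `L²` therefore suffices
for the continuity argument. -/
theorem supEnergy_le {σ : ℝ} (hσ : σ ≤ 1) (J : ℕ) (F : G → ℂ) :
    supEnergy μ ω σ J F ≤ ∫⁻ x, ‖F x‖ₑ ^ 2 ∂μ := by
  refine iSup₂_le fun j _ => ?_
  calc 2 ^ (σ * j) * energy μ ω j F
      ≤ 2 ^ (σ * j) * (2 ^ (-(j : ℝ)) * ∫⁻ x, ‖F x‖ₑ ^ 2 ∂μ) := by gcongr; exact energy_le j F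
    _ = 2 ^ (σ * j + -(j : ℝ)) * ∫⁻ x, ‖F x‖ₑ ^ 2 ∂μ := by rw [two_rpow_add, mul_assoc]
    _ ≤ 2 ^ (0 : ℝ) * ∫⁻ x, ‖F x‖ₑ ^ 2 ∂μ := by
        gcongr
        · norm_num
        · nlinarith [Nat.cast_nonneg (α := ℝ) j]
    _ = _ := by simp

theorem supEnergy_add_le (hω : Measurable ω) {σ : ℝ} (J : ℕ) {F F' : G → ℂ}
    (hF : AEStronglyMeasurable F μ) :
    supEnergy μ ω σ J (F + F') ≤ 2 * supEnergy μ ω σ J F + 2 * supEnergy μ ω σ J F' := by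
  refine iSup₂_le fun j hj => ?_
  calc 2 ^ (σ * j) * energy μ ω j (F + F')
      ≤ 2 ^ (σ * j) * (2 * energy μ ω j F + 2 * energy μ ω j F') := by
        gcongr; exact energy_add_le hω j hF
    _ = 2 * (2 ^ (σ * j) * energy μ ω j F) + 2 * (2 ^ (σ * j) * energy μ ω j F') := by ring
    _ ≤ _ := by gcongr <;> exact le_supEnergy hj _

/-- A single term suffices, the one with `2^(j+k) ≤ w + 2^j < 2^(j+k+1)`. -/
theorem rpow_neg_le_tsum {δ : ℝ} (hδ : 0 < δ) (hδ' : δ < 1) (j : ℕ) {w : ℝ} (hw : 0 ≤ w) :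
    ENNReal.ofReal ((w + 2 ^ j) ^ (-(1 - δ)))
      ≤ 4 * ∑' k : ℕ, 2 ^ (δ * (j + k : ℕ)) * ENNReal.ofReal ((w + 2 ^ (j + k))⁻¹) := by
  set X : ℝ := w + 2 ^ j with hX
  have hj : (0 : ℝ) < 2 ^ j := by positivity
  have hX0 : 0 < X := by positivity
  obtain ⟨k, hk1, hk2⟩ := exists_nat_pow_near (x := X / 2 ^ j) (y := (2 : ℝ))
    ((one_le_div hj).2 (by linarith)) (by norm_num)
  have hk1' : (2 : ℝ) ^ (j + k) ≤ X := by
    rw [pow_add, mul_comm]; exact (le_div_iff₀ hj).1 hk1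
  have hk2' : X / 2 ≤ (2 : ℝ) ^ (j + k) := by
    rw [div_lt_iff₀ hj, pow_succ] at hk2
    rw [pow_add]; linarith
  have key : X ^ (-(1 - δ)) ≤ 4 * ((2 : ℝ) ^ (δ * (j + k : ℕ)) * (w + 2 ^ (j + k))⁻¹) := by
    have h1 : (X / 2) ^ δ ≤ (2 : ℝ) ^ (δ * (j + k : ℕ)) := by
      rw [mul_comm δ, Real.rpow_mul (by norm_num), Real.rpow_natCast]
      exact Real.rpow_le_rpow (by positivity) hk2' hδ.le
    have h2 : X ^ δ / 2 ≤ (X / 2) ^ δ := by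
      rw [Real.div_rpow hX0.le (by norm_num)]
      gcongr
      exact (Real.rpow_le_rpow_of_exponent_le (by norm_num) hδ'.le).trans (by norm_num)
    have h3 : (2 * X)⁻¹ ≤ (w + 2 ^ (j + k))⁻¹ := by
      gcongr
      linarith
    have h4 : X ^ (-(1 - δ)) = X ^ δ * X⁻¹ := by
      rw [← Real.rpow_neg_one X, ← Real.rpow_add hX0]; ring_nf
    calc X ^ (-(1 - δ)) = 4 * ((X ^ δ / 2) * (2 * X)⁻¹) := by rw [h4, mul_inv]; ring
      _ ≤ _ := by
        gcongr
        exact h2.trans h1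
  calc ENNReal.ofReal (X ^ (-(1 - δ)))
      ≤ ENNReal.ofReal (4 * ((2 : ℝ) ^ (δ * (j + k : ℕ)) * (w + 2 ^ (j + k))⁻¹)) :=
        ENNReal.ofReal_le_ofReal key
    _ = 4 * (2 ^ (δ * (j + k : ℕ)) * ENNReal.ofReal ((w + 2 ^ (j + k))⁻¹)) := by
        rw [ENNReal.ofReal_mul (by norm_num), ENNReal.ofReal_mul (by positivity), ofReal_two_rpow]
        norm_num
    _ ≤ _ := by
        gcongr
        exact ENNReal.le_tsum (f := fun k : ℕ =>
          (2 : ℝ≥0∞) ^ (δ * (j + k : ℕ)) * ENNReal.ofReal ((w + 2 ^ (j + k))⁻¹)) k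

/-- With `i = j + k`, split `2^(δ i) = 2^(-δ i) 2^(2 δ i)`. The second factor is absorbed by the
supremum; the first makes the series in `k` converge and gains `2^(-δ j)`. -/
theorem lintegral_rpow_le_supEnergy (hω : Measurable ω) {δ : ℝ} (hδ : 0 < δ) (hδ' : δ < 1) (j : ℕ)
    {F : G → ℂ} (hF : AEStronglyMeasurable F μ) :
    ∫⁻ x, ‖F x‖ₑ ^ 2 * ENNReal.ofReal ((|ω x| + 2 ^ j) ^ (-(1 - δ))) ∂μ
      ≤ 4 * (∑' k : ℕ, (2 : ℝ≥0∞) ^ (-(δ * k))) * (2 ^ (-(δ * j)) *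
        supEnergy μ ω (2 * δ) j F) := by
  have hw : ∀ j : ℕ, Measurable fun x => ENNReal.ofReal ((|ω x| + 2 ^ j)⁻¹) := fun j =>
    ((hω.abs.add_const _).inv).ennreal_ofReal
  calc ∫⁻ x, ‖F x‖ₑ ^ 2 * ENNReal.ofReal ((|ω x| + 2 ^ j) ^ (-(1 - δ))) ∂μ
      ≤ ∫⁻ x, ∑' k : ℕ, 4 * 2 ^ (δ * (j + k : ℕ)) *
          (‖F x‖ₑ ^ 2 * ENNReal.ofReal ((|ω x| + 2 ^ (j + k))⁻¹)) ∂μ := by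
        refine lintegral_mono fun x => ?_
        refine (mul_le_mul' le_rfl (rpow_neg_le_tsum hδ hδ' j (abs_nonneg (ω x)))).trans ?_
        rw [← ENNReal.tsum_mul_left, ← ENNReal.tsum_mul_left]
        refine (ENNReal.tsum_le_tsum fun k => le_of_eq ?_)
        ring
    _ = ∑' k : ℕ, 4 * 2 ^ (δ * (j + k : ℕ)) * energy μ ω (j + k) F := by
        rw [lintegral_tsum (f := fun (k : ℕ) x => 4 * 2 ^ (δ * (j + k : ℕ)) *
          (‖F x‖ₑ ^ 2 * ENNReal.ofReal ((|ω x| + 2 ^ (j + k))⁻¹)))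
          fun k => ((hF.enorm.pow_const 2).mul
          (hw (j + k)).aemeasurable).const_mul _]
        refine tsum_congr fun k => ?_
        rw [energy, lintegral_const_mul' _ _ (ENNReal.mul_ne_top (by norm_num) (two_rpow_ne_top _))]
    _ ≤ ∑' k : ℕ, 4 * (2 ^ (-(δ * k)) * (2 ^ (-(δ * j)) * supEnergy μ ω (2 * δ) j F)) := by
        refine ENNReal.tsum_le_tsum fun k => ?_
        rw [mul_assoc]
        refine mul_le_mul' le_rfl ?_
        calc (2 : ℝ≥0∞) ^ (δ * (j + k : ℕ)) * energy μ ω (j + k) F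
            = 2 ^ (-(δ * k)) * (2 ^ (-(δ * j)) *
                (2 ^ (2 * δ * (j + k : ℕ)) * energy μ ω (j + k) F)) := by
              rw [← mul_assoc, ← mul_assoc, ← two_rpow_add, ← two_rpow_add]
              congr 2
              push_cast
              ring
          _ ≤ _ := by
              gcongr
              exact le_supEnergy (Nat.le_add_right j k) F
    _ = _ := by
        rw [ENNReal.tsum_mul_left, ENNReal.tsum_mul_right]
        ring

end Energy

/-! ### Smallness of the weighted operator and the continuity argument -/

section Bootstrap

variable {G : Type*} [AddCommGroup G] [MeasurableSpace G] [MeasurableAdd₂ G] [MeasurableNeg G]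
  {μ : Measure G} [SFinite μ] [μ.IsAddLeftInvariant] [μ.IsNegInvariant] {ω : G → ℝ}

theorem one_le_two_pow' (j : ℕ) : (1 : ℝ) ≤ 2 ^ j := one_le_pow₀ (by norm_num)

/-- With `δ = σ/2` the gain `2^(-δ j)` occurs twice, in the kernel bound and in the dyadic sum;
together they cancel the `2^(σ J)` of the threshold for all `j ≥ J`. -/
theorem exists_norm_resOp_le (hω : IsFrequency μ ω) {σ : ℝ} (hσ : 0 < σ) (hσ' : σ < 1) :
    ∃ K : ℝ≥0, 0 < K ∧ ∀ (F : Lp ℂ 2 μ) (J j : ℕ), J ≤ j →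
      K * supEnergy μ ω σ J F ≤ 2 ^ (σ * J) → ‖resOp hω (one_le_two_pow' j) F‖ ≤ 1 / 2 := by
  obtain ⟨C, hC⟩ := lintegral_resKernel_le hω (δ := σ / 2) (by linarith) (by linarith)
  have hS := tsum_two_rpow_lt_top (δ := σ / 2) (by linarith)
  set S := ∑' k : ℕ, (2 : ℝ≥0∞) ^ (-(σ / 2 * k)) with hSdef
  -- One factor 4 comes from the dyadic sum, the other because the squared norm must be at most
  -- `1/4`. The summand 1 only makes the constant positive.
  refine ⟨16 * C * S.toNNReal + 1, by positivity, fun F J j hJ h => ?_⟩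
  have hSc : (S.toNNReal : ℝ≥0∞) = S := ENNReal.coe_toNNReal hS.ne
  have key : ∫⁻ x, ∫⁻ y, ‖resKernel ω (2 ^ j) F x y‖ₑ ^ 2 ∂(posMeasure μ ω) ∂(posMeasure μ ω)
      ≤ (((1 / 2 : ℝ≥0)) : ℝ≥0∞) ^ 2 := by
    refine (hC (2 ^ j) (one_le_two_pow' j) F (Lp.aestronglyMeasurable F)).trans ?_
    have h1 := lintegral_rpow_le_supEnergy (μ := μ) hω.measurable (δ := σ / 2) (by linarith)
      (by linarith) j (Lp.aestronglyMeasurable F)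
    have e1 : ENNReal.ofReal (((2 : ℝ) ^ j) ^ (-(σ / 2))) = 2 ^ (-(σ / 2 * j)) := by
      rw [← ofReal_two_rpow, ← Real.rpow_natCast, ← Real.rpow_mul (by norm_num)]
      ring_nf
    have h2 : supEnergy μ ω (2 * (σ / 2)) j F ≤ supEnergy μ ω σ J F := by
      rw [mul_div_cancel₀ σ two_ne_zero]
      exact iSup₂_le fun i hi => le_supEnergy (hJ.trans hi) _
    have h3 : (2 : ℝ≥0∞) ^ (-(σ * j)) * (16 * C * S * supEnergy μ ω σ J F) ≤ 1 := by
      rw [← two_rpow_neg_mul (σ * j)]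
      refine mul_le_mul' le_rfl (le_trans ?_ (h.trans (two_rpow_mono (by gcongr))))
      push_cast
      rw [hSc]
      gcongr
      exact le_self_add
    have e4 : (((1 / 2 : ℝ≥0)) : ℝ≥0∞) ^ 2 = 4⁻¹ := by
      rw [← ENNReal.coe_pow]
      rw [show ((1 / 2 : ℝ≥0)) ^ 2 = 4⁻¹ by norm_num, ENNReal.coe_inv (by norm_num)]
      norm_num
    rw [e1, e4]
    calc _ ≤ C * 2 ^ (-(σ / 2 * j)) * (4 * S * (2 ^ (-(σ / 2 * j)) * supEnergy μ ω σ J F)) := by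
          refine mul_le_mul' le_rfl (h1.trans ?_)
          gcongr
      _ = 4⁻¹ * (4 * 4) * C * S * (2 ^ (-(σ / 2 * j)) * 2 ^ (-(σ / 2 * j)))
            * supEnergy μ ω σ J F := by
          rw [← mul_assoc 4⁻¹, ENNReal.inv_mul_cancel (by norm_num) (by norm_num)]
          ring
      _ = 4⁻¹ * (2 ^ (-(σ * j)) * (16 * C * S * supEnergy μ ω σ J F)) := by
          rw [← two_rpow_add, show -(σ / 2 * j) + -(σ / 2 * j) = -(σ * j) by ring,
            show (4 : ℝ≥0∞) * 4 = 16 by norm_num]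
          ring
      _ ≤ 4⁻¹ * 1 := by gcongr
      _ = _ := mul_one _
  have := norm_resOp_le hω (one_le_two_pow' j) F key
  simpa using this

theorem enorm_sq_weightOp (hω : IsFrequency μ ω) (j : ℕ) (F : Lp ℂ 2 μ) :
    ENNReal.ofReal (‖weightOp hω (one_le_two_pow' j) F‖ ^ 2)
      = ∫⁻ x, ‖F x‖ₑ ^ 2 * ENNReal.ofReal ((|ω x| + 2 ^ j)⁻¹) ∂(posMeasure μ ω) := by
  rw [ENNReal.ofReal_pow (norm_nonneg _), Lp.norm_def, ENNReal.ofReal_toReal (Lp.eLpNorm_ne_top _),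
    sq_eLpNorm_two]
  refine lintegral_congr_ae ?_
  filter_upwards [weightOp_coeFn hω (one_le_two_pow' j) F, ae_posMeasure hω] with x h1 h2
  have h3 : 0 ≤ ω x + 2 ^ j := by positivity
  rw [h1, enorm_mul, mul_pow, mul_comm, abs_of_nonneg h2, ← sq_resWeight h3, ← ofReal_norm
    ((resWeight ω (2 ^ j) x : ℝ) : ℂ), Complex.norm_real, ← ENNReal.ofReal_pow (norm_nonneg _),
    Real.norm_eq_abs, sq_abs]

theorem enorm_sq_weightOp_le (hω : IsFrequency μ ω) (j : ℕ) (F : Lp ℂ 2 μ) :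
    ENNReal.ofReal (‖weightOp hω (one_le_two_pow' j) F‖ ^ 2) ≤ energy μ ω j F := by
  rw [enorm_sq_weightOp]
  exact setLIntegral_le_lintegral _ _

/-- Negation sends negative frequencies to positive ones. The frequency zero, which has mass on the
circle, is counted twice on the right. -/
theorem lintegral_le_two_mul_of_even (hω : IsFrequency μ ω) {f : G → ℝ≥0∞}
    (hf : ∀ᵐ x ∂μ, f (-x) = f x) : ∫⁻ x, f x ∂μ ≤ 2 * ∫⁻ x, f x ∂(posMeasure μ ω) := by
  have h1 : ∫⁻ x in {x | 0 ≤ ω x}ᶜ, f x ∂μ ≤ ∫⁻ x in {x | 0 ≤ ω x}, f x ∂μ := by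
    rw [← lintegral_indicator hω.measurableSet, ← lintegral_indicator hω.measurableSet.compl,
      ← lintegral_neg_eq_self]
    refine lintegral_mono_ae ?_
    filter_upwards [hf] with x hx
    by_cases h : 0 ≤ ω x
    · rw [Set.indicator_of_mem (show x ∈ {x | 0 ≤ ω x} from h), ← hx]
      exact Set.indicator_le_self _ _ _
    · rw [Set.indicator_of_notMem]
      · exact zero_le
      · simp only [Set.mem_compl_iff, Set.mem_ofPred_eq, hω.map_neg, not_not]
        linarith
  rw [← lintegral_add_compl f hω.measurableSet, two_mul]
  gcongr

theorem energy_le_enorm_sq_weightOp (hω : IsFrequency μ ω) (j : ℕ) {F : Lp ℂ 2 μ}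
    (hF : ∀ᵐ x ∂μ, F (-x) = (starRingEnd ℂ) (F x)) :
    energy μ ω j F ≤ 2 * ENNReal.ofReal (‖weightOp hω (one_le_two_pow' j) F‖ ^ 2) := by
  rw [enorm_sq_weightOp]
  refine lintegral_le_two_mul_of_even hω ?_
  filter_upwards [hF] with x hx
  simp only [hx, hω.map_neg, abs_neg, RCLike.enorm_conj]

/-- `18 = 2 · (9/2) · 2`: the two resolvent bounds contribute `9/2` and `2`, and the evenness of
`|F|` the other `2`. -/
theorem energy_le_of_generatingFunction_eq (hω : IsFrequency μ ω) (j : ℕ) {F F' : Lp ℂ 2 μ}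
    (hF : ∀ᵐ x ∂μ, F (-x) = (starRingEnd ℂ) (F x))
    (h : ‖resOp hω (one_le_two_pow' j) F‖ ≤ 1 / 2) (h' : ‖resOp hω (one_le_two_pow' j) F'‖ ≤ 1 / 2)
    (he : generatingFunction hω (one_le_two_pow' j) F
      = generatingFunction hω (one_le_two_pow' j) F') :
    energy μ ω j F ≤ 18 * energy μ ω j F' := by
  have h1 := le_resolventForm h (weightOp hω (one_le_two_pow' j) F)
  have h2 := resolventForm_le h' (weightOp hω (one_le_two_pow' j) F')
  rw [generatingFunction, generatingFunction] at he
  have h3 : ‖weightOp hω (one_le_two_pow' j) F‖ ^ 2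
      ≤ 9 * ‖weightOp hω (one_le_two_pow' j) F'‖ ^ 2 := by
    rw [← he] at h2
    linarith
  calc energy μ ω j F ≤ 2 * ENNReal.ofReal (‖weightOp hω (one_le_two_pow' j) F‖ ^ 2) :=
        energy_le_enorm_sq_weightOp hω j hF
    _ ≤ 2 * ENNReal.ofReal (9 * ‖weightOp hω (one_le_two_pow' j) F'‖ ^ 2) := by gcongr
    _ = 18 * ENNReal.ofReal (‖weightOp hω (one_le_two_pow' j) F'‖ ^ 2) := by
        rw [ENNReal.ofReal_mul (by norm_num), ← mul_assoc]
        congr 1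
        rw [show ENNReal.ofReal 9 = 9 by norm_num]
        norm_num
    _ ≤ _ := by
        gcongr
        exact enorm_sq_weightOp_le hω j F'

/-- Consider the times at which the smallness threshold holds with a margin of 4 and all generating
functions have their initial values. Near such a time the threshold persists without margin, so the
generating functions stay constant and the energies are at most 18 times the initial ones. This
restores the margin, since `72 = 4 · 18`. -/
theorem exists_energy_le (hω : IsFrequency μ ω) {σ : ℝ} (hσ : 0 < σ) (hσ' : σ < 1) :
    ∃ K : ℝ≥0, 0 < K ∧ ∀ F : ℝ → Lp ℂ 2 μ, IsFlow μ ω F → ∀ J : ℕ,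
      K * supEnergy μ ω σ J (F 0) ≤ 2 ^ (σ * J) → ∀ (t : ℝ) (j : ℕ), J ≤ j →
        energy μ ω j (F t) ≤ 18 * energy μ ω j (F 0) ∧
        energy μ ω j (F 0) ≤ 18 * energy μ ω j (F t) := by
  obtain ⟨K, hK, hKA⟩ := exists_norm_resOp_le hω hσ hσ'
  refine ⟨72 * K, by positivity, fun F hF J h0 => ?_⟩
  have h0' : K * supEnergy μ ω σ J (F 0) ≤ 2 ^ (σ * J) := le_trans (by
    gcongr
    exact le_mul_of_one_le_left zero_le (by norm_num)) h0
  set S : Set ℝ := {t | 4 * (K * supEnergy μ ω σ J (F t)) ≤ 2 ^ (σ * J) ∧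
    ∀ j (_ : J ≤ j), generatingFunction hω (one_le_two_pow' j) (F t)
      = generatingFunction hω (one_le_two_pow' j) (F 0)} with hS
  have hS0 : (0 : ℝ) ∈ S := by
    refine ⟨le_trans ?_ h0, fun _ _ => rfl⟩
    rw [← mul_assoc]
    gcongr
    push_cast
    gcongr
    norm_num
  have hcont : Continuous F := continuous_iff_continuousAt.2 fun t => by
    obtain ⟨V, hV, -⟩ := hF.deriv t
    exact hV.continuousAt
  -- `τ` is the admissible `L²` oscillation: in the quasi-triangle inequality `2 · 1/4 + 2 · 1/4 =
  -- 1`.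
  have hτ : ∃ τ : ℝ, 0 < τ ∧ 4 * (K * ENNReal.ofReal (τ ^ 2)) ≤ 2 ^ (σ * J) := by
    have hp : 0 < (2 : ℝ) ^ (σ * J) / (4 * K) := by positivity
    refine ⟨√((2 : ℝ) ^ (σ * J) / (4 * K)), Real.sqrt_pos.2 hp, ?_⟩
    rw [Real.sq_sqrt hp.le, ← ofReal_two_rpow, ← mul_assoc]
    have : (4 * K : ℝ≥0∞) = ENNReal.ofReal (4 * K) := by
      rw [ENNReal.ofReal_mul (by norm_num)]
      norm_num
    rw [this, ← ENNReal.ofReal_mul (by positivity), mul_div_cancel₀]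
    positivity
  obtain ⟨τ, hτ0, hτ⟩ := hτ
  -- The ball is centred at an arbitrary time, so it lies inside `S` or misses it. Openness and
  -- closedness both follow.
  have hlocal : ∀ t₀, ∃ ε > 0, ∀ t ∈ Metric.ball t₀ ε, ∀ t' ∈ Metric.ball t₀ ε, t ∈ S → t' ∈ S := by
    intro t₀
    obtain ⟨ε, hε, hεF⟩ := Metric.continuousAt_iff.1 hcont.continuousAt (τ / 2) (by linarith)
    refine ⟨ε, hε, fun t ht t' ht' htS => ?_⟩
    have hsmall : ∀ r ∈ Metric.ball t₀ ε, K * supEnergy μ ω σ J (F r) ≤ 2 ^ (σ * J) := by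
      intro r hr
      have hd : ‖F r - F t‖ ≤ τ := by
        rw [← dist_eq_norm]
        linarith [dist_triangle_right (F r) (F t) (F t₀), hεF hr, hεF ht]
      have e1 : supEnergy μ ω σ J (F r) = supEnergy μ ω σ J (F t + (F r - F t) : Lp ℂ 2 μ) := by
        rw [add_sub_cancel]
      have e2 : supEnergy μ ω σ J (F t + (F r - F t) : Lp ℂ 2 μ)
          = supEnergy μ ω σ J (⇑(F t) + ⇑(F r - F t)) := by
        simp only [supEnergy, energy_congr (Lp.coeFn_add (F t) (F r - F t))]
      have h3 : supEnergy μ ω σ J (F r - F t : Lp ℂ 2 μ) ≤ ENNReal.ofReal (τ ^ 2) := by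
        refine (supEnergy_le hσ'.le J _).trans ?_
        rw [← sq_eLpNorm_two, ← ENNReal.ofReal_toReal (Lp.eLpNorm_ne_top (F r - F t)),
          ← Lp.norm_def, ← ENNReal.ofReal_pow (norm_nonneg _)]
        gcongr
      rw [e1, e2]
      have h4 := supEnergy_add_le (σ := σ) (F' := ⇑(F r - F t)) hω.measurable J
        (Lp.aestronglyMeasurable (F t))
      have h5 : ∀ {a b : ℝ≥0∞}, 4 * a ≤ b → 2 * a ≤ b / 2 := fun {a b} hab => by
        rw [ENNReal.le_div_iff_mul_le (by norm_num) (by norm_num)]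
        refine le_trans (le_of_eq ?_) hab
        ring
      calc _ ≤ K * (2 * supEnergy μ ω σ J (F t)
            + 2 * supEnergy μ ω σ J (F r - F t : Lp ℂ 2 μ)) := by gcongr
        _ ≤ K * (2 * supEnergy μ ω σ J (F t) + 2 * ENNReal.ofReal (τ ^ 2)) := by gcongr
        _ = 2 * (K * supEnergy μ ω σ J (F t)) + 2 * (K * ENNReal.ofReal (τ ^ 2)) := by ring
        _ ≤ 2 ^ (σ * J) / 2 + 2 ^ (σ * J) / 2 := add_le_add (h5 htS.1) (h5 hτ)
        _ = _ := ENNReal.add_halves _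
    have hβ : ∀ j (_ : J ≤ j), generatingFunction hω (one_le_two_pow' j) (F t')
        = generatingFunction hω (one_le_two_pow' j) (F 0) := by
      intro j hj
      rw [← htS.2 j hj]
      have hd : ∀ r ∈ Metric.ball t₀ ε,
          HasDerivAt (fun t => generatingFunction hω (one_le_two_pow' j) (F t)) 0 r := fun r hr =>
        hasDerivAt_generatingFunction hω _ hF
          ((hKA (F r) J j hj (hsmall r hr)).trans_lt (by norm_num))
      exact Metric.isOpen_ball.is_const_of_deriv_eq_zero (convex_ball t₀ ε).isPreconnected
        (fun r hr => (hd r hr).differentiableAt.differentiableWithinAt)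
        (fun r hr => (hd r hr).deriv) ht' ht
    refine ⟨?_, hβ⟩
    have h18 : supEnergy μ ω σ J (F t') ≤ 18 * supEnergy μ ω σ J (F 0) := by
      refine iSup₂_le fun j hj => ?_
      have := energy_le_of_generatingFunction_eq hω j (hF.regular t').symm
        (hKA (F t') J j hj (hsmall t' ht')) (hKA (F 0) J j hj h0') (hβ j hj)
      calc _ ≤ 2 ^ (σ * j) * (18 * energy μ ω j (F 0)) := by gcongr
        _ = 18 * (2 ^ (σ * j) * energy μ ω j (F 0)) := by ring
        _ ≤ _ := by gcongr; exact le_supEnergy hj _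
    calc _ ≤ 4 * (K * (18 * supEnergy μ ω σ J (F 0))) := by gcongr
      _ = (72 * K : ℝ≥0) * supEnergy μ ω σ J (F 0) := by
          push_cast
          rw [show (72 : ℝ≥0∞) = 4 * 18 by norm_num]
          ring
      _ ≤ _ := h0
  have hclopen : IsClopen S := by
    refine ⟨⟨Metric.isOpen_iff.2 fun t₀ ht₀ => ?_⟩, Metric.isOpen_iff.2 fun t₀ ht₀ => ?_⟩
    · obtain ⟨ε, hε, h⟩ := hlocal t₀
      exact ⟨ε, hε, fun t ht htS => ht₀ (h t ht t₀ (Metric.mem_ball_self hε) htS)⟩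
    · obtain ⟨ε, hε, h⟩ := hlocal t₀
      exact ⟨ε, hε, fun t ht => h t₀ (Metric.mem_ball_self hε) t ht ht₀⟩
  have huniv : S = Set.univ := hclopen.eq_univ ⟨0, hS0⟩
  intro t j hj
  have ht : t ∈ S := huniv ▸ Set.mem_univ t
  have hA := hKA (F t) J j hj (le_trans (le_mul_of_one_le_left zero_le (by norm_num)) ht.1)
  have hA0 := hKA (F 0) J j hj h0'
  exact ⟨energy_le_of_generatingFunction_eq hω j (hF.regular t).symm hA hA0 (ht.2 j hj),
    energy_le_of_generatingFunction_eq hω j (hF.regular 0).symm hA0 hA (ht.2 j hj).symm⟩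

end Bootstrap

/-! ### Norms of sequences and Schur's test -/

section SequenceNorms

/-- The `ℓ^r` norm of a sequence of extended nonnegative numbers. -/
def lrNorm (r : ℝ≥0∞) (x : ℕ → ℝ≥0∞) : ℝ≥0∞ :=
  if r = ∞ then ⨆ n, x n else (∑' n, x n ^ r.toReal) ^ (1 / r.toReal)

theorem toReal_pos_of_one_le {r : ℝ≥0∞} (hr : 1 ≤ r) (h : r ≠ ∞) : 1 ≤ r.toReal := by
  simpa using ENNReal.toReal_mono h hr

theorem le_lrNorm {r : ℝ≥0∞} (hr : 1 ≤ r) (x : ℕ → ℝ≥0∞) (n : ℕ) : x n ≤ lrNorm r x := by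
  unfold lrNorm
  split_ifs with h
  · exact le_iSup x n
  · have h1 := toReal_pos_of_one_le hr h
    calc x n = (x n ^ r.toReal) ^ (1 / r.toReal) := by
          rw [← ENNReal.rpow_mul, mul_one_div_cancel (by positivity), ENNReal.rpow_one]
      _ ≤ _ := ENNReal.rpow_le_rpow (ENNReal.le_tsum n) (by positivity)

theorem tsum_mul_rpow_le {p : ℝ} (hp : 1 ≤ p) (w x : ℕ → ℝ≥0∞) :
    (∑' n, w n * x n) ^ p ≤ (∑' n, w n) ^ (p - 1) * ∑' n, w n * x n ^ p := by
  have hp0 : 0 < p := by linarith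
  have h : ∑' n, w n * x n ≤ (∑' n, w n) ^ (1 - p⁻¹) * (∑' n, w n * x n ^ p) ^ p⁻¹ := by
    rw [ENNReal.tsum_eq_iSup_sum]
    refine iSup_le fun s => (ENNReal.inner_le_weight_mul_Lp_of_nonneg s hp w x).trans ?_
    have : 0 ≤ 1 - p⁻¹ := sub_nonneg.2 (inv_le_one_of_one_le₀ hp)
    gcongr <;> exact ENNReal.sum_le_tsum s
  calc _ ≤ ((∑' n, w n) ^ (1 - p⁻¹) * (∑' n, w n * x n ^ p) ^ p⁻¹) ^ p :=
        ENNReal.rpow_le_rpow h hp0.le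
    _ = _ := by
        rw [ENNReal.mul_rpow_of_nonneg _ _ hp0.le, ← ENNReal.rpow_mul, ← ENNReal.rpow_mul,
          inv_mul_cancel₀ hp0.ne', ENNReal.rpow_one, sub_mul, one_mul, inv_mul_cancel₀ hp0.ne']

/-- Schur's test on `ℓ^r`. -/
theorem lrNorm_le_of_schur {r : ℝ≥0∞} (hr : 1 ≤ r) {w : ℕ → ℕ → ℝ≥0∞} {A : ℝ≥0∞}
    (h1 : ∀ j, ∑' n, w j n ≤ A) (h2 : ∀ n, ∑' j, w j n ≤ A) {x y : ℕ → ℝ≥0∞}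
    (hy : ∀ j, y j ≤ ∑' n, w j n * x n) : lrNorm r y ≤ A * lrNorm r x := by
  unfold lrNorm
  split_ifs with h
  · refine iSup_le fun j => (hy j).trans ?_
    calc ∑' n, w j n * x n ≤ ∑' n, w j n * ⨆ n, x n :=
          ENNReal.tsum_le_tsum fun n => by gcongr; exact le_iSup x n
      _ ≤ _ := by rw [ENNReal.tsum_mul_right]; gcongr; exact h1 j
  · set p := r.toReal
    have hp : 1 ≤ p := toReal_pos_of_one_le hr h
    have hp0 : 0 < p := by linarith
    have key : ∑' j, y j ^ p ≤ A ^ p * ∑' n, x n ^ p := by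
      calc ∑' j, y j ^ p ≤ ∑' j, A ^ (p - 1) * ∑' n, w j n * x n ^ p := by
            refine ENNReal.tsum_le_tsum fun j => ?_
            refine (ENNReal.rpow_le_rpow (hy j) hp0.le).trans ((tsum_mul_rpow_le hp _ _).trans ?_)
            have : 0 ≤ p - 1 := by linarith
            gcongr
            exact h1 j
        _ = A ^ (p - 1) * ∑' n, ∑' j, w j n * x n ^ p := by
            rw [ENNReal.tsum_mul_left, ENNReal.tsum_comm]
        _ ≤ A ^ (p - 1) * ∑' n, A * x n ^ p := by
            gcongr with n
            rw [ENNReal.tsum_mul_right]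
            gcongr
            exact h2 n
        _ = A ^ p * ∑' n, x n ^ p := by
            rw [ENNReal.tsum_mul_left, ← mul_assoc]
            congr 1
            nth_rewrite 2 [← ENNReal.rpow_one A]
            rw [← ENNReal.rpow_add_of_nonneg _ _ (by linarith) (by norm_num)]
            ring_nf
    calc (∑' j, y j ^ p) ^ (1 / p) ≤ (A ^ p * ∑' n, x n ^ p) ^ (1 / p) :=
          ENNReal.rpow_le_rpow key (by positivity)
      _ = _ := by
          rw [ENNReal.mul_rpow_of_nonneg _ _ (by positivity), ← ENNReal.rpow_mul,
            mul_one_div_cancel hp0.ne', ENNReal.rpow_one]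

theorem lrNorm_le_mul {r : ℝ≥0∞} (hr : 1 ≤ r) {c : ℝ≥0∞} {x y : ℕ → ℝ≥0∞}
    (h : ∀ j, y j ≤ c * x j) : lrNorm r y ≤ c * lrNorm r x := by
  refine lrNorm_le_of_schur hr (w := fun j n => if n = j then c else 0) (fun j => ?_) (fun n => ?_)
    fun j => ?_
  · rw [tsum_ite_eq]
  · simp_rw [eq_comm (a := n)]
    rw [tsum_ite_eq]
  · refine (h j).trans ?_
    refine le_trans (le_of_eq ?_) (ENNReal.le_tsum j)
    simp

theorem lrNorm_geometric_lt_top {r : ℝ≥0∞} (hr : 1 ≤ r) {δ : ℝ} (hδ : 0 < δ) :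
    lrNorm r (fun n => 2 ^ (-(δ * n))) < ∞ := by
  unfold lrNorm
  split_ifs with h
  · refine lt_of_le_of_lt (iSup_le fun n => ?_) ENNReal.one_lt_top
    calc (2 : ℝ≥0∞) ^ (-(δ * n)) ≤ 2 ^ (0 : ℝ) := two_rpow_mono (by
          have : 0 ≤ δ * n := by positivity
          linarith)
      _ = 1 := ENNReal.rpow_zero
  · have hp := toReal_pos_of_one_le hr h
    refine ENNReal.rpow_lt_top_of_nonneg (by positivity) ?_
    have := tsum_two_rpow_lt_top (δ := δ * r.toReal) (by positivity)
    refine (lt_of_eq_of_lt (tsum_congr fun n => ?_) this).ne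
    rw [← ENNReal.rpow_mul]
    congr 1
    ring

/-- Split at `n = j`: each side is part of one geometric series. -/
theorem tsum_geometric_dist_le {γ : ℝ} (j : ℕ) :
    ∑' n : ℕ, (2 : ℝ≥0∞) ^ (-(γ * |(j : ℝ) - n|)) ≤ 2 * ∑' k : ℕ, 2 ^ (-(γ * k)) := by
  rw [← ENNReal.summable.sum_add_tsum_nat_add' (k := j), two_mul]
  refine add_le_add ?_ (ENNReal.tsum_le_tsum fun n => le_of_eq ?_)
  · rw [← Finset.sum_range_reflect]
    refine le_trans (Finset.sum_le_sum (g := fun i : ℕ => (2 : ℝ≥0∞) ^ (-(γ * (i + 1 : ℕ))))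
      fun i hi => le_of_eq ?_) ((ENNReal.sum_le_tsum _).trans ?_)
    · have hi' : i < j := Finset.mem_range.1 hi
      have : ((j - 1 - i : ℕ) : ℝ) = j - 1 - i := by
        rw [Nat.sub_sub, Nat.cast_sub (by omega)]
        push_cast
        ring
      rw [this, show (j : ℝ) - (j - 1 - i) = ((i + 1 : ℕ) : ℝ) by push_cast; ring, Nat.abs_cast]
    · exact ENNReal.tsum_comp_le_tsum_of_injective (add_left_injective 1)
        (fun k : ℕ => (2 : ℝ≥0∞) ^ (-(γ * k)))
  · push_cast
    rw [show (j : ℝ) - (n + j) = -n by ring, abs_neg, Nat.abs_cast]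

theorem tsum_sq_le_sq_tsum (z : ℕ → ℝ≥0∞) : ∑' k, z k ^ 2 ≤ (∑' k, z k) ^ 2 := by
  rw [sq (∑' k, z k), ← ENNReal.tsum_mul_right]
  refine ENNReal.tsum_le_tsum fun k => ?_
  rw [sq]
  gcongr
  exact ENNReal.le_tsum k

end SequenceNorms

/-! ### Besov norms expressed through energies -/

section Besov

variable {G : Type*} [MeasurableSpace G] {μ : Measure G} {ω : G → ℝ}

/-- The low frequencies for `k = 0`, and the dyadic shell `2^(k-1) ≤ |ξ| < 2^k` for `k ≥ 1`. -/
def dyadicSet (ω : G → ℝ) : ℕ → Set G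
  | 0 => {x | |ω x| ≤ 1}
  | n + 1 => {x | 2 ^ n ≤ |ω x| ∧ |ω x| < 2 ^ (n + 1)}

/-- The sequence whose `ℓ^r` norm is the Besov norm. -/
def besovSeq (μ : Measure G) (ω : G → ℝ) (s : ℝ) (F : G → ℂ) : ℕ → ℝ≥0∞
  | 0 => lowPart μ ω F
  | n + 1 => 2 ^ (s * n) * shellPart μ ω F n

theorem ofReal_pow_rpow (s : ℝ) (n : ℕ) : ENNReal.ofReal (((2 : ℝ) ^ n) ^ s) = 2 ^ (s * n) := by
  rw [← ofReal_two_rpow, ← Real.rpow_natCast, ← Real.rpow_mul (by norm_num), mul_comm]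

theorem besovNorm_eq_lrNorm {s : ℝ} {r : ℝ≥0∞} (F : G → ℂ) :
    besovNorm μ ω s r F = lrNorm r (besovSeq μ ω s F) := by
  unfold besovNorm lrNorm
  split_ifs with h
  · rw [← sup_iSup_nat_succ (besovSeq μ ω s F)]
    simp only [besovSeq, ofReal_pow_rpow]
  · rw [tsum_eq_zero_add' (f := fun n => besovSeq μ ω s F n ^ r.toReal) ENNReal.summable]
    simp only [besovSeq, ofReal_pow_rpow]

theorem measurableSet_dyadicSet (hω : Measurable ω) (k : ℕ) : MeasurableSet (dyadicSet ω k) := by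
  cases k with
  | zero => exact measurableSet_le hω.abs measurable_const
  | succ n =>
    exact (measurableSet_le measurable_const hω.abs).inter
      (measurableSet_lt hω.abs measurable_const)

theorem iUnion_dyadicSet (ω : G → ℝ) : ⋃ k, dyadicSet ω k = Set.univ := by
  refine Set.eq_univ_of_forall fun x => Set.mem_iUnion.2 ?_
  by_cases h : |ω x| ≤ 1
  · exact ⟨0, h⟩
  · obtain ⟨n, hn⟩ := exists_nat_pow_near (x := |ω x|) (y := (2 : ℝ)) (not_le.1 h).le (by norm_num)
    exact ⟨n + 1, hn⟩

theorem lintegral_le_tsum_dyadicSet (f : G → ℝ≥0∞) :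
    ∫⁻ x, f x ∂μ ≤ ∑' k, ∫⁻ x in dyadicSet ω k, f x ∂μ := by
  rw [← setLIntegral_univ, ← iUnion_dyadicSet ω]
  exact lintegral_iUnion_le _ _

/-- `∫ |F|²` over a dyadic piece. -/
def dyadicMass (μ : Measure G) (ω : G → ℝ) (F : G → ℂ) (k : ℕ) : ℝ≥0∞ :=
  ∫⁻ x in dyadicSet ω k, ‖F x‖ₑ ^ 2 ∂μ

/-- The weight of the sequence `besovSeq`. -/
def dyadicWeight (s : ℝ) : ℕ → ℝ≥0∞
  | 0 => 1
  | n + 1 => 2 ^ (s * n)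

theorem sq_besovSeq (s : ℝ) (F : G → ℂ) (k : ℕ) :
    besovSeq μ ω s F k ^ 2 = dyadicWeight s k ^ 2 * dyadicMass μ ω F k := by
  cases k with
  | zero =>
    rw [besovSeq, lowPart, sq_eLpNorm_two, dyadicWeight, one_pow, one_mul]
    rfl
  | succ n =>
    rw [besovSeq, mul_pow, shellPart, sq_eLpNorm_two]
    rfl

theorem sq_two_rpow (x : ℝ) : ((2 : ℝ≥0∞) ^ x) ^ 2 = 2 ^ (2 * x) := by
  rw [sq, ← two_rpow_add, two_mul]

theorem sq_rpow_half (a : ℝ≥0∞) : (a ^ (1 / 2 : ℝ)) ^ 2 = a := by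
  rw [← ENNReal.rpow_natCast, ← ENNReal.rpow_mul]
  norm_num

theorem le_of_sq_le_sq {a b : ℝ≥0∞} (h : a ^ 2 ≤ b ^ 2) : a ≤ b :=
  (ENNReal.pow_le_pow_left_iff two_ne_zero).1 h

theorem dyadicWeight_mul_neg (s : ℝ) (k : ℕ) : dyadicWeight (-s) k * dyadicWeight s k = 1 := by
  cases k with
  | zero => simp [dyadicWeight]
  | succ n => rw [dyadicWeight, dyadicWeight, neg_mul, two_rpow_neg_mul]

theorem dyadicMass_eq (s : ℝ) (F : G → ℂ) (k : ℕ) :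
    dyadicMass μ ω F k = (dyadicWeight (-s) k * besovSeq μ ω s F k) ^ 2 := by
  rw [mul_pow, sq_besovSeq, ← mul_assoc, ← mul_pow, dyadicWeight_mul_neg, one_pow, one_mul]

theorem inv_le_of_mem_dyadicSet {k : ℕ} (j : ℕ) {x : G} (hx : x ∈ dyadicSet ω k) :
    ENNReal.ofReal ((|ω x| + 2 ^ j)⁻¹) ≤ 2 ^ (1 - max (k : ℝ) j) := by
  rw [← ofReal_two_rpow]
  refine ENNReal.ofReal_le_ofReal ?_
  rw [← neg_sub, Real.rpow_neg (by norm_num)]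
  refine inv_anti₀ (by positivity) ?_
  rw [Real.rpow_sub (by norm_num), Real.rpow_one, div_le_iff₀ (by norm_num)]
  have h0 := abs_nonneg (ω x)
  rcases le_total (k : ℝ) j with h | h
  · rw [max_eq_right h, Real.rpow_natCast]
    have : (0 : ℝ) < 2 ^ j := by positivity
    linarith
  · rw [max_eq_left h, Real.rpow_natCast]
    have : (0 : ℝ) < 2 ^ j := by positivity
    cases k with
    | zero =>
      have : j = 0 := by simpa using h
      subst this
      norm_num
      linarith
    | succ n =>
      rw [pow_succ]
      have := hx.1
      linarith

theorem le_inv_of_mem_dyadicSet {k j : ℕ} (hkj : k ≤ j + 1) {x : G} (hx : x ∈ dyadicSet ω k) :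
    1 ≤ 4 * (2 ^ (j : ℝ) * ENNReal.ofReal ((|ω x| + 2 ^ j)⁻¹)) := by
  have h1 : |ω x| ≤ 2 * 2 ^ j := by
    cases k with
    | zero =>
      have h := hx
      have : (1 : ℝ) ≤ 2 ^ j := one_le_pow₀ (by norm_num)
      simp only [dyadicSet, Set.mem_ofPred_eq] at h
      linarith
    | succ n =>
      have h := hx.2
      have : (2 : ℝ) ^ (n + 1) ≤ 2 ^ (j + 1) := pow_le_pow_right₀ (by norm_num) hkj
      rw [pow_succ 2 j] at this
      linarith
  have hj : (0 : ℝ) < 2 ^ j := by positivity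
  have h2 : (1 : ℝ) ≤ 4 * ((2 : ℝ) ^ (j : ℝ) * (|ω x| + 2 ^ j)⁻¹) := by
    rw [Real.rpow_natCast, ← mul_assoc, ← div_eq_mul_inv,
      one_le_div (by positivity)]
    linarith
  have := ENNReal.ofReal_le_ofReal h2
  rw [ENNReal.ofReal_one, ENNReal.ofReal_mul (by norm_num), ENNReal.ofReal_mul (by positivity),
    ofReal_two_rpow] at this
  simpa using this

/-- The numbers `2^((s+1/2) j) (∫ |F|² / (|ξ| + 2^j))^(1/2)` for `j ≥ J`. -/
def energySeq (μ : Measure G) (ω : G → ℝ) (s : ℝ) (J : ℕ) (F : G → ℂ) (j : ℕ) : ℝ≥0∞ :=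
  if J ≤ j then 2 ^ ((s + 1 / 2) * j) * energy μ ω j F ^ (1 / 2 : ℝ) else 0

theorem sq_energySeq (s : ℝ) {J j : ℕ} (h : J ≤ j) (F : G → ℂ) :
    energySeq μ ω s J F j ^ 2 = 2 ^ ((1 + 2 * s) * j) * energy μ ω j F := by
  rw [energySeq, if_pos h, mul_pow, sq_two_rpow, sq_rpow_half]
  congr 2
  ring

theorem energy_le_tsum (hω : Measurable ω) (j : ℕ) (F : G → ℂ) :
    energy μ ω j F ≤ ∑' k : ℕ, 2 ^ (1 - max (k : ℝ) j) * dyadicMass μ ω F k := by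
  refine (lintegral_le_tsum_dyadicSet (ω := ω) _).trans (ENNReal.tsum_le_tsum fun k => ?_)
  rw [dyadicMass, ← lintegral_const_mul' _ _ (two_rpow_ne_top _)]
  refine setLIntegral_mono' (measurableSet_dyadicSet hω k) fun x hx => ?_
  rw [mul_comm]
  gcongr
  exact inv_le_of_mem_dyadicSet j hx

/-- On the `k`-th piece the energy weight is of size `2^(-max(k, j))`. After both normalisations the
factor decays like `2^(s (j - k))` for `k ≤ j` and like `2^(-(s + 1/2)(k - j))` for `k ≥ j`. The
estimate is one of squares, and `ℓ¹ ⊆ ℓ²` makes it linear. -/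
theorem energySeq_le (hω : Measurable ω) {s γ : ℝ} (hγ : γ ≤ -s) (hγ' : γ ≤ s + 1 / 2)
    (hs : s < 0) (J j : ℕ) (F : G → ℂ) :
    energySeq μ ω s J F j
      ≤ ∑' k : ℕ, 2 * 2 ^ (-(γ * |(j : ℝ) - k|)) * besovSeq μ ω s F k := by
  by_cases hJ : J ≤ j
  swap
  · rw [energySeq, if_neg hJ]
    exact zero_le
  refine le_of_sq_le_sq ?_
  refine le_trans ?_ (tsum_sq_le_sq_tsum _)
  rw [sq_energySeq s hJ]
  refine (mul_le_mul' le_rfl (energy_le_tsum hω j F)).trans ?_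
  rw [← ENNReal.tsum_mul_left]
  refine ENNReal.tsum_le_tsum fun k => ?_
  rw [dyadicMass_eq s, mul_pow (dyadicWeight (-s) k), mul_pow _ (besovSeq μ ω s F k), ← mul_assoc,
    ← mul_assoc]
  gcongr
  have h1 : dyadicWeight (-s) k ≤ 2 ^ (-s * k) := by
    cases k with
    | zero => simp [dyadicWeight]
    | succ n =>
      refine two_rpow_mono ?_
      push_cast
      nlinarith
  calc (2 : ℝ≥0∞) ^ ((1 + 2 * s) * j) * 2 ^ (1 - max (k : ℝ) j) * dyadicWeight (-s) k ^ 2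
      ≤ 2 ^ ((1 + 2 * s) * j) * 2 ^ (1 - max (k : ℝ) j) * (2 ^ (-s * k)) ^ 2 := by gcongr
    _ = 2 ^ ((1 + 2 * s) * j + (1 - max (k : ℝ) j) + 2 * (-s * k)) := by
        rw [sq_two_rpow, ← two_rpow_add, ← two_rpow_add]
    _ ≤ 2 ^ (2 * (1 + -(γ * |(j : ℝ) - k|))) := by
        refine two_rpow_mono ?_
        rcases le_total (k : ℝ) j with h | h
        · rw [max_eq_right h, abs_of_nonneg (by linarith)]
          nlinarith
        · rw [max_eq_left h, abs_of_nonpos (by linarith)]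
          nlinarith
    _ = (2 * 2 ^ (-(γ * |(j : ℝ) - k|))) ^ 2 := by
        rw [← sq_two_rpow, two_rpow_add, ENNReal.rpow_one]

theorem exists_lrNorm_energySeq_le (hω : Measurable ω) {s : ℝ} (hs : -(1 / 2) < s) (hs' : s < 0) :
    ∃ A : ℝ≥0, ∀ (r : ℝ≥0∞), 1 ≤ r → ∀ (J : ℕ) (F : G → ℂ),
      lrNorm r (energySeq μ ω s J F) ≤ A * lrNorm r (besovSeq μ ω s F) := by
  -- Both ends of the range of `s` are needed for a positive rate.
  obtain ⟨γ, hγ0, hγ, hγ'⟩ : ∃ γ : ℝ, 0 < γ ∧ γ ≤ -s ∧ γ ≤ s + 1 / 2 :=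
    ⟨min (-s) (s + 1 / 2), lt_min (by linarith) (by linarith), min_le_left _ _, min_le_right _ _⟩
  have hS := tsum_two_rpow_lt_top hγ0
  have hA : 2 * (2 * ∑' k : ℕ, (2 : ℝ≥0∞) ^ (-(γ * k))) ≠ ∞ :=
    ENNReal.mul_ne_top (by norm_num) (ENNReal.mul_ne_top (by norm_num) hS.ne)
  refine ⟨(2 * (2 * ∑' k : ℕ, (2 : ℝ≥0∞) ^ (-(γ * k)))).toNNReal, fun r hr J F => ?_⟩
  rw [ENNReal.coe_toNNReal hA]
  refine lrNorm_le_of_schur hr (w := fun j k => 2 * 2 ^ (-(γ * |(j : ℝ) - k|)))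
    (fun j => ?_) (fun k => ?_) (fun j => energySeq_le hω hγ hγ' hs' J j F)
  · rw [ENNReal.tsum_mul_left]
    gcongr
    exact tsum_geometric_dist_le j
  · rw [ENNReal.tsum_mul_left]
    gcongr
    simp_rw [abs_sub_comm _ (k : ℝ)]
    exact tsum_geometric_dist_le k

theorem dyadicMass_le (hω : Measurable ω) {k j : ℕ} (hkj : k ≤ j + 1) (F : G → ℂ) :
    dyadicMass μ ω F k ≤ 4 * 2 ^ (j : ℝ) * energy μ ω j F := by
  calc dyadicMass μ ω F k
      ≤ ∫⁻ x in dyadicSet ω k, 4 * 2 ^ (j : ℝ) *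
          (‖F x‖ₑ ^ 2 * ENNReal.ofReal ((|ω x| + 2 ^ j)⁻¹)) ∂μ := by
        refine setLIntegral_mono' (measurableSet_dyadicSet hω k) fun x hx => ?_
        calc ‖F x‖ₑ ^ 2 = ‖F x‖ₑ ^ 2 * 1 := (mul_one _).symm
          _ ≤ ‖F x‖ₑ ^ 2 * (4 * (2 ^ (j : ℝ) * ENNReal.ofReal ((|ω x| + 2 ^ j)⁻¹))) :=
              mul_le_mul' le_rfl (le_inv_of_mem_dyadicSet hkj hx)
          _ = _ := by ring
    _ ≤ _ := by
        rw [lintegral_const_mul' _ _ (ENNReal.mul_ne_top (by norm_num) (two_rpow_ne_top _))]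
        gcongr
        exact setLIntegral_le_lintegral _ _

/-- The `k`-th piece is visible in the energy at every scale `j ≥ k - 1`. For `k > J` the scale `k -
1 ≥ J` costs only a constant; for `k ≤ J` the scale `J` is used, at the price `2^(-sJ) 2^(sk)`. -/
theorem besovSeq_le (hω : Measurable ω) {s : ℝ} (hs' : s < 0) (J k : ℕ) (F : G → ℂ) :
    besovSeq μ ω s F k ≤ (if k ≤ J then 2 * 2 ^ (-s) * 2 ^ (-s * J) * 2 ^ (s * k)
        * energySeq μ ω s J F J else 2 * energySeq μ ω s J F (k - 1)) := by
  refine le_of_sq_le_sq ?_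
  rw [sq_besovSeq]
  have h4 : (2 : ℝ≥0∞) ^ 2 = 4 := by norm_num
  split_ifs with h
  · refine (mul_le_mul' le_rfl (dyadicMass_le hω (h.trans (Nat.le_succ J)) F)).trans ?_
    rw [mul_pow, sq_energySeq s le_rfl, ← mul_assoc, ← mul_assoc, mul_pow, mul_pow, mul_pow, h4,
      sq_two_rpow, sq_two_rpow, sq_two_rpow]
    rw [← mul_assoc _ ((2 : ℝ≥0∞) ^ ((1 + 2 * s) * J))]
    refine mul_le_mul' ?_ le_rfl
    -- The `k`-th piece has weight `2^(s (k - 1))` for `k ≥ 1`; for `k = 0` the weight is `1 ≤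
    -- 2^(-s)`.
    have h1 : dyadicWeight s k ≤ 2 ^ (s * k - s) := by
      cases k with
      | zero =>
        rw [dyadicWeight, ← ENNReal.rpow_zero (x := 2)]
        refine two_rpow_mono ?_
        push_cast
        linarith
      | succ n =>
        refine two_rpow_mono ?_
        push_cast
        linarith
    calc dyadicWeight s k ^ 2 * 4 * 2 ^ (J : ℝ) ≤ (2 ^ (s * k - s)) ^ 2 * 4 * 2 ^ (J : ℝ) := by
          gcongr
      _ = 4 * 2 ^ (2 * (s * k - s) + J) := by
          rw [sq_two_rpow, two_rpow_add]
          ring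
      _ = 4 * 2 ^ (2 * -s + 2 * (-s * J) + 2 * (s * k) + (1 + 2 * s) * J) := by
          congr 2
          ring
      _ = _ := by
          rw [two_rpow_add, two_rpow_add, two_rpow_add]
          ring
      _ ≤ _ := le_rfl
  · obtain ⟨n, rfl⟩ : ∃ n, k = n + 1 := ⟨k - 1, by omega⟩
    refine (mul_le_mul' le_rfl (dyadicMass_le hω (le_refl (n + 1)) F)).trans ?_
    rw [Nat.add_sub_cancel, mul_pow, sq_energySeq s (by omega), h4, dyadicWeight, sq_two_rpow]
    refine le_of_eq ?_
    rw [show (1 + 2 * s) * (n : ℝ) = 2 * (s * n) + n by ring, two_rpow_add]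
    ring

/-- Schur's test for a shifted diagonal plus the single column `j = J`, whose entries are geometric
in `k` because `s < 0`. The diagonal is absorbed since `2^(-sJ) ≥ 1`. -/
theorem exists_lrNorm_besovSeq_le (hω : Measurable ω) {s : ℝ} (hs' : s < 0) :
    ∃ A : ℝ≥0, ∀ (r : ℝ≥0∞), 1 ≤ r → ∀ (J : ℕ) (F : G → ℂ),
      lrNorm r (besovSeq μ ω s F) ≤ A * 2 ^ (-s * J) * lrNorm r (energySeq μ ω s J F) := by
  have hS := tsum_two_rpow_lt_top (δ := -s) (by linarith)
  set S := ∑' k : ℕ, (2 : ℝ≥0∞) ^ (-(-s * k)) with hSdef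
  have hA : 2 + 2 * 2 ^ (-s) * S ≠ ∞ := ENNReal.add_ne_top.2 ⟨by norm_num,
    ENNReal.mul_ne_top (ENNReal.mul_ne_top (by norm_num) (two_rpow_ne_top _)) hS.ne⟩
  have h1S : ∀ k : ℕ, (2 : ℝ≥0∞) ^ (s * k) ≤ S := fun k => by
    refine le_trans (le_of_eq ?_) (ENNReal.le_tsum k)
    congr 1
    ring
  refine ⟨(2 + 2 * 2 ^ (-s) * S).toNNReal, fun r hr J F => ?_⟩
  rw [ENNReal.coe_toNNReal hA]
  have hJ : (1 : ℝ≥0∞) ≤ 2 ^ (-s * J) := by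
    rw [← ENNReal.rpow_zero (x := 2)]
    refine two_rpow_mono ?_
    have : (0 : ℝ) ≤ J := Nat.cast_nonneg J
    nlinarith
  have hexp : (2 + 2 * 2 ^ (-s) * S) * 2 ^ (-s * J)
      = 2 * 2 ^ (-s * J) + 2 * 2 ^ (-s) * 2 ^ (-s * J) * S := by ring
  refine lrNorm_le_of_schur hr (w := fun k j => (if k = j + 1 then 2 else 0)
      + (if j = J then 2 * 2 ^ (-s) * 2 ^ (-s * J) * 2 ^ (s * k) else 0))
    (fun k => ?_) (fun j => ?_) (fun k => ?_)
  · rw [ENNReal.tsum_add, tsum_ite_eq, hexp]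
    refine add_le_add ?_ (by gcongr; exact h1S k)
    refine le_trans ?_ (le_mul_of_one_le_right zero_le hJ)
    cases k with
    | zero => simp
    | succ n =>
      simp only [add_left_inj, eq_comm (a := n)]
      rw [tsum_ite_eq]
  · rw [ENNReal.tsum_add, tsum_ite_eq, hexp]
    refine add_le_add (le_mul_of_one_le_right zero_le hJ) ?_
    split_ifs
    · rw [ENNReal.tsum_mul_left]
      refine le_of_eq ?_
      rw [hSdef]
      simp only [neg_mul, neg_neg]
    · simp
  · refine (besovSeq_le hω hs' J k F).trans ?_
    split_ifs with h
    · refine le_trans ?_ (ENNReal.le_tsum J)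
      gcongr
      simp
    · refine le_trans ?_ (ENNReal.le_tsum (k - 1))
      gcongr
      rw [if_pos (by omega)]
      exact le_self_add

/-- At `J = 0` the energy sequence of an `L²` function is at most `2^(s j) ‖F‖`, which lies in every
`ℓ^r`. -/
theorem besovNorm_lt_top (hω : Measurable ω) {s : ℝ} (hs' : s < 0)
    {r : ℝ≥0∞} (hr : 1 ≤ r) {F : G → ℂ} (hF : MemLp F 2 μ) : besovNorm μ ω s r F < ∞ := by
  obtain ⟨A, hA⟩ := exists_lrNorm_besovSeq_le (μ := μ) hω hs'
  rw [besovNorm_eq_lrNorm]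
  refine (hA r hr 0 F).trans_lt (ENNReal.mul_lt_top (ENNReal.mul_lt_top (by simp)
    (two_rpow_ne_top _).lt_top) ?_)
  refine (lrNorm_le_mul hr (c := eLpNorm F 2 μ) (x := fun n => 2 ^ (-(-s * n)))
    fun j => ?_).trans_lt (ENNReal.mul_lt_top hF.2 (lrNorm_geometric_lt_top hr (by linarith)))
  refine le_of_sq_le_sq ?_
  rw [sq_energySeq s (Nat.zero_le j), mul_pow, sq_eLpNorm_two, sq_two_rpow]
  refine (mul_le_mul' le_rfl (energy_le j F)).trans (le_of_eq ?_)
  rw [← mul_assoc, ← two_rpow_add, mul_comm]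
  congr 2
  ring

theorem sobolevNorm_sq (s : ℝ) (F : G → ℂ) : sobolevNorm μ ω s F ^ 2
    = ∫⁻ x, ENNReal.ofReal ((1 + ω x ^ 2) ^ s) * ‖F x‖ₑ ^ 2 ∂μ := by
  rw [sobolevNorm, sq_rpow_half]

theorem besovNorm_two_sq (s : ℝ) (F : G → ℂ) :
    besovNorm μ ω s 2 F ^ 2 = ∑' k, dyadicWeight s k ^ 2 * dyadicMass μ ω F k := by
  rw [besovNorm_eq_lrNorm, lrNorm, if_neg (by norm_num)]
  simp only [ENNReal.toReal_ofNat, ENNReal.rpow_ofNat, sq_rpow_half, sq_besovSeq]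

/-- On the shell, `4^n ≤ 1 + ξ² ≤ 8 · 4^n`, and `8 = 2³` accounts for `2^(-3s)`. -/
theorem rpow_bounds_of_mem_dyadicSet {s : ℝ} (hs' : s < 0) {k : ℕ} {x : G}
    (hx : x ∈ dyadicSet ω k) :
    ENNReal.ofReal ((1 + ω x ^ 2) ^ s) ≤ dyadicWeight s k ^ 2 ∧
    dyadicWeight s k ^ 2 ≤ 2 ^ (-(3 * s)) * ENNReal.ofReal ((1 + ω x ^ 2) ^ s) := by
  have hsq := sq_abs (ω x)
  have h0 := abs_nonneg (ω x)
  cases k with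
  | zero =>
    have h1 : |ω x| ≤ 1 := hx
    have h2 : ω x ^ 2 ≤ 1 := by nlinarith
    rw [dyadicWeight, one_pow]
    refine ⟨?_, ?_⟩
    · rw [ENNReal.ofReal_le_one]
      exact Real.rpow_le_one_of_one_le_of_nonpos (by nlinarith) hs'.le
    · calc (1 : ℝ≥0∞) ≤ 2 ^ (-(3 * s)) * 2 ^ s := by
            rw [← two_rpow_add, ← ENNReal.rpow_zero (x := 2)]
            exact two_rpow_mono (by linarith)
        _ ≤ _ := by
            rw [← ofReal_two_rpow s]
            refine mul_le_mul' le_rfl (ENNReal.ofReal_le_ofReal ?_)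
            exact Real.rpow_le_rpow_of_nonpos (by positivity) (by linarith) hs'.le
  | succ n =>
    have h1 : 2 ^ n ≤ |ω x| := hx.1
    have h2 : |ω x| < 2 ^ (n + 1) := hx.2
    have hp : (0 : ℝ) < 2 ^ n := by positivity
    have hp1 : (1 : ℝ) ≤ 2 ^ n := one_le_pow₀ (by norm_num)
    rw [pow_succ] at h2
    have e1 : (2 : ℝ) ^ (2 * (s * n)) = ((2 ^ n) ^ 2) ^ s := by
      rw [← Real.rpow_natCast 2 n, ← Real.rpow_natCast, ← Real.rpow_mul (by norm_num),
        ← Real.rpow_mul (by norm_num)]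
      congr 1
      push_cast
      ring
    have e2 : (2 : ℝ) ^ (-(3 * s)) * (8 * (2 ^ n) ^ 2) ^ s = (2 : ℝ) ^ (2 * (s * n)) := by
      rw [Real.mul_rpow (by norm_num) (by positivity), ← e1, show (8 : ℝ) = 2 ^ (3 : ℝ) by norm_num,
        ← Real.rpow_mul (by norm_num), ← mul_assoc, ← Real.rpow_add (by norm_num)]
      simp
    rw [dyadicWeight, sq_two_rpow]
    refine ⟨?_, ?_⟩
    · rw [← ofReal_two_rpow, e1]
      refine ENNReal.ofReal_le_ofReal ?_
      exact Real.rpow_le_rpow_of_nonpos (by positivity) (by nlinarith) hs'.le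
    · rw [← ofReal_two_rpow, ← ofReal_two_rpow, ← e2, ENNReal.ofReal_mul (by positivity)]
      refine mul_le_mul' le_rfl (ENNReal.ofReal_le_ofReal ?_)
      exact Real.rpow_le_rpow_of_nonpos (by positivity) (by nlinarith) hs'.le

theorem sobolevNorm_le_besovNorm (hω : Measurable ω) {s : ℝ} (hs' : s < 0) (F : G → ℂ) :
    sobolevNorm μ ω s F ≤ besovNorm μ ω s 2 F := by
  refine le_of_sq_le_sq ?_
  rw [sobolevNorm_sq, besovNorm_two_sq]
  refine (lintegral_le_tsum_dyadicSet (ω := ω) _).trans (ENNReal.tsum_le_tsum fun k => ?_)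
  have hne : dyadicWeight s k ^ 2 ≠ ∞ := by
    cases k with
    | zero => simp [dyadicWeight]
    | succ n => rw [dyadicWeight, sq_two_rpow]; exact two_rpow_ne_top _
  rw [dyadicMass, ← lintegral_const_mul' _ _ hne]
  refine setLIntegral_mono' (measurableSet_dyadicSet hω k) fun x hx => ?_
  gcongr
  exact (rpow_bounds_of_mem_dyadicSet hs' hx).1

theorem pairwise_disjoint_dyadicSet_succ (ω : G → ℝ) :
    Pairwise (Function.onFun Disjoint fun n => dyadicSet ω (n + 1)) := by
  have h : ∀ m n : ℕ, m < n → Disjoint (dyadicSet ω (m + 1)) (dyadicSet ω (n + 1)) := by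
    intro m n hmn
    refine Set.disjoint_left.2 fun x hx hx' => ?_
    have h1 := hx.2
    have h2 := hx'.1
    have h3 : (2 : ℝ) ^ (m + 1) ≤ 2 ^ n := pow_le_pow_right₀ (by norm_num) hmn
    linarith
  intro m n hmn
  rcases lt_or_gt_of_ne hmn with h' | h'
  · exact h m n h'
  · exact (h n m h').symm

/-- The shells are disjoint, but `|ξ| = 1` belongs to the low part as well as to the first shell.
The low part is therefore estimated separately, which doubles the integral. -/
theorem besovNorm_le_sobolevNorm (hω : Measurable ω) {s : ℝ} (hs' : s < 0) (F : G → ℂ) :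
    besovNorm μ ω s 2 F ≤ 2 * 2 ^ (-(3 * s) / 2) * sobolevNorm μ ω s F := by
  refine le_of_sq_le_sq ?_
  set f : G → ℝ≥0∞ := fun x => ENNReal.ofReal ((1 + ω x ^ 2) ^ s) * ‖F x‖ₑ ^ 2
  have h1 : ∀ k, dyadicWeight s k ^ 2 * dyadicMass μ ω F k
      ≤ 2 ^ (-(3 * s)) * ∫⁻ x in dyadicSet ω k, f x ∂μ := fun k => by
    have hne : dyadicWeight s k ^ 2 ≠ ∞ := by
      cases k with
      | zero => simp [dyadicWeight]
      | succ n => rw [dyadicWeight, sq_two_rpow]; exact two_rpow_ne_top _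
    rw [dyadicMass, ← lintegral_const_mul' _ _ hne, ← lintegral_const_mul' _ _ (two_rpow_ne_top _)]
    refine setLIntegral_mono' (measurableSet_dyadicSet hω k) fun x hx => ?_
    rw [← mul_assoc]
    gcongr
    exact (rpow_bounds_of_mem_dyadicSet hs' hx).2
  rw [besovNorm_two_sq, mul_pow, sobolevNorm_sq, mul_pow, sq_two_rpow,
    show 2 * (-(3 * s) / 2) = -(3 * s) by ring]
  refine (ENNReal.tsum_le_tsum h1).trans ?_
  rw [ENNReal.tsum_mul_left, tsum_eq_zero_add' ENNReal.summable,
    ← lintegral_iUnion (fun n => measurableSet_dyadicSet hω (n + 1))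
      (pairwise_disjoint_dyadicSet_succ ω)]
  calc _ ≤ 2 ^ (-(3 * s)) * ((∫⁻ x, f x ∂μ) + ∫⁻ x, f x ∂μ) := by
        exact mul_le_mul' le_rfl (add_le_add (setLIntegral_le_lintegral _ _)
          (setLIntegral_le_lintegral _ _))
    _ = 2 * 2 ^ (-(3 * s)) * ∫⁻ x, f x ∂μ := by ring
    _ ≤ _ := by
        gcongr
        norm_num

end Besov

/-! ### From a free scale to the two-sided bound -/

/-- The a priori bound in terms of a free dyadic scale `2^J`, large compared with the data. -/
def ScaleBound (s : ℝ) (K C : ℝ≥0) (n : ℝ → ℝ≥0∞) : Prop :=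
  ∀ J : ℕ, K * n 0 ^ 2 ≤ 2 ^ ((1 + 2 * s) * J) → ∀ t,
    n t ≤ C * 2 ^ (-s * J) * n 0 ∧ n 0 ≤ C * 2 ^ (-s * J) * n t

theorem ScaleBound.of_equiv {s : ℝ} {K C D : ℝ≥0} {m n : ℝ → ℝ≥0∞} (h : ScaleBound s K C m)
    (h1 : ∀ t, n t ≤ D * m t) (h2 : ∀ t, m t ≤ D * n t) :
    ScaleBound s (K * D ^ 2) (D * C * D) n := by
  intro J hJ t
  have hm : K * m 0 ^ 2 ≤ 2 ^ ((1 + 2 * s) * J) := by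
    refine le_trans ?_ hJ
    calc K * m 0 ^ 2 ≤ K * (D * n 0) ^ 2 := by gcongr; exact h2 0
      _ = _ := by push_cast; ring
  obtain ⟨h3, h4⟩ := h J hm t
  constructor
  · calc n t ≤ D * (C * 2 ^ (-s * J) * (D * n 0)) := by
          refine (h1 t).trans ?_
          gcongr
          refine h3.trans ?_
          gcongr
          exact h2 0
      _ = _ := by push_cast; ring
  · calc n 0 ≤ D * (C * 2 ^ (-s * J) * (D * n t)) := by
          refine (h1 0).trans ?_
          gcongr
          refine h4.trans ?_
          gcongr
          exact h2 t
      _ = _ := by push_cast; ring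

/-- The condition on `J` reads `2^J ≥ z` with `z = K^(1/σ) y^(2/σ)`. The first power of two above
`max 1 z` is at most `2 (1 + z)`. -/
theorem exists_scale {s : ℝ} (hs : -(1 / 2) < s) (hs' : s < 0) (K : ℝ≥0) :
    ∃ D : ℝ≥0, ∀ y : ℝ≥0∞, y ≠ ∞ → ∃ J : ℕ, K * y ^ 2 ≤ 2 ^ ((1 + 2 * s) * J) ∧
      (2 : ℝ≥0∞) ^ (-s * J) ≤ D * (1 + y ^ (2 / (1 + 2 * s))) ^ (-s) := by
  have hσ : 0 < 1 + 2 * s := by linarith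
  set σ := 1 + 2 * s with hσdef
  set K' : ℝ≥0 := K ^ (1 / σ)
  refine ⟨(2 * (1 + K')) ^ (-s), fun y hy => ?_⟩
  set z : ℝ≥0∞ := K' * y ^ (2 / σ) with hz
  have hz_top : z ≠ ∞ := ENNReal.mul_ne_top (by simp)
    (ENNReal.rpow_ne_top_of_nonneg (by positivity) hy)
  obtain ⟨k, hk1, hk2⟩ := exists_nat_pow_near (x := max 1 z.toReal) (y := (2 : ℝ))
    (le_max_left _ _) (by norm_num)
  have hz2 : z ≤ 2 ^ ((k + 1 : ℕ) : ℝ) := by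
    rw [← ofReal_two_rpow, Real.rpow_natCast, ← ENNReal.ofReal_toReal hz_top]
    exact ENNReal.ofReal_le_ofReal ((le_max_right _ _).trans hk2.le)
  refine ⟨k + 1, ?_, ?_⟩
  · have e1 : K * y ^ 2 = z ^ σ := by
      rw [hz, ENNReal.mul_rpow_of_nonneg _ _ hσ.le, ← ENNReal.rpow_mul, div_mul_cancel₀ _ hσ.ne',
        ENNReal.coe_rpow_of_nonneg _ (by positivity), ← ENNReal.rpow_mul,
        div_mul_cancel₀ _ hσ.ne', ENNReal.rpow_one, ENNReal.rpow_ofNat]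
    rw [e1, mul_comm σ, ENNReal.rpow_mul]
    exact ENNReal.rpow_le_rpow hz2 hσ.le
  · have h1 : (2 : ℝ≥0∞) ^ (k : ℝ) ≤ 1 + z := by
      rw [← ofReal_two_rpow, Real.rpow_natCast]
      refine (ENNReal.ofReal_le_ofReal hk1).trans ?_
      rcases le_total 1 z.toReal with h | h
      · rw [max_eq_right h, ENNReal.ofReal_toReal hz_top]
        exact le_add_self
      · rw [max_eq_left h, ENNReal.ofReal_one]
        exact le_self_add
    have h2 : (2 : ℝ≥0∞) ^ ((k + 1 : ℕ) : ℝ) ≤ (2 * (1 + K') : ℝ≥0) * (1 + y ^ (2 / σ)) := by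
      push_cast
      rw [two_rpow_add, ENNReal.rpow_one, mul_comm, mul_assoc]
      gcongr 2 * ?_
      refine h1.trans ?_
      rw [hz, add_mul, one_mul, mul_add, mul_one]
      exact add_le_add le_self_add le_add_self
    calc (2 : ℝ≥0∞) ^ (-s * (k + 1 : ℕ)) = (2 ^ ((k + 1 : ℕ) : ℝ)) ^ (-s) := by
          rw [← ENNReal.rpow_mul, mul_comm]
      _ ≤ ((2 * (1 + K') : ℝ≥0) * (1 + y ^ (2 / σ))) ^ (-s) :=
          ENNReal.rpow_le_rpow h2 (by linarith)
      _ = _ := by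
          rw [ENNReal.mul_rpow_of_nonneg _ _ (by linarith),
            ENNReal.coe_rpow_of_nonneg _ (by linarith)]

/-- Since `Y ≥ 1`, the factor `Y^(-s)` may be enlarged to `Y^b`; one constant serves all `b ≥ -s`.
-/
theorem exists_twoSidedBound {s : ℝ} (hs : -(1 / 2) < s) (hs' : s < 0) (K C : ℝ≥0) :
    ∃ C' : ℝ≥0, ∀ n : ℝ → ℝ≥0∞, (∀ t, n t < ∞) → ScaleBound s K C n → ∀ b, -s ≤ b →
      TwoSidedBound C' (2 / (1 + 2 * s)) b n := by
  obtain ⟨D, hD⟩ := exists_scale hs hs' K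
  refine ⟨C * D, fun n hn h b hb => ⟨hn, ?_⟩⟩
  obtain ⟨J, hJ1, hJ2⟩ := hD (n 0) (hn 0).ne
  set Y : ℝ≥0∞ := 1 + n 0 ^ (2 / (1 + 2 * s)) with hY
  have hY1 : 1 ≤ Y := le_self_add
  have hY_top : Y ≠ ∞ := ENNReal.add_ne_top.2 ⟨by simp,
    ENNReal.rpow_ne_top_of_nonneg (div_nonneg (by norm_num) (by linarith)) (hn 0).ne⟩
  have hY0 : Y ≠ 0 := (zero_lt_one.trans_le hY1).ne'
  have hYb : Y ^ (-s) ≤ Y ^ b := ENNReal.rpow_le_rpow_of_exponent_le hY1 hb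
  have hYb0 : Y ^ b ≠ 0 := (ENNReal.rpow_pos (zero_lt_one.trans_le hY1) hY_top).ne'
  have hYb_top : Y ^ b ≠ ∞ := ENNReal.rpow_ne_top_of_ne_zero hY0 hY_top
  have hfac : (C : ℝ≥0∞) * 2 ^ (-s * J) ≤ (C * D : ℝ≥0) * Y ^ b := by
    push_cast
    rw [mul_assoc]
    gcongr
    exact hJ2.trans (by gcongr)
  constructor
  · rw [ENNReal.mul_iSup]
    refine iSup_le fun t => ?_
    calc Y ^ (-b) * n t ≤ Y ^ (-b) * ((C * D : ℝ≥0) * Y ^ b * n 0) := by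
          gcongr
          refine (h J hJ1 t).1.trans ?_
          gcongr
      _ = Y ^ (-b) * Y ^ b * ((C * D : ℝ≥0) * n 0) := by ring
      _ = _ := by rw [← ENNReal.rpow_add _ _ hY0 hY_top, neg_add_cancel, ENNReal.rpow_zero, one_mul]
  · rw [ENNReal.mul_iInf_of_ne hYb0 hYb_top,
      ENNReal.mul_iInf fun h0 => absurd h0 ENNReal.coe_ne_top]
    refine le_iInf fun t => (h J hJ1 t).2.trans ?_
    rw [← mul_assoc]
    gcongr

/-! ### The Besov bound along the flow at a fixed scale -/

section FlowBound

variable {G : Type*} [AddCommGroup G] [MeasurableSpace G] [MeasurableAdd₂ G] [MeasurableNeg G]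
  {μ : Measure G} [SFinite μ] [μ.IsAddLeftInvariant] [μ.IsNegInvariant] {ω : G → ℝ}

theorem exists_scaleBound_besovNorm (hω : IsFrequency μ ω) {s : ℝ} (hs : -(1 / 2) < s)
    (hs' : s < 0) : ∃ K C : ℝ≥0, ∀ r : ℝ≥0∞, 1 ≤ r → ∀ F : ℝ → Lp ℂ 2 μ, IsFlow μ ω F →
      ScaleBound s K C (fun t => besovNorm μ ω s r (F t)) := by
  obtain ⟨K, hK, hflow⟩ := exists_energy_le hω (σ := 1 + 2 * s) (by linarith) (by linarith)
  obtain ⟨A, hA⟩ := exists_lrNorm_energySeq_le (μ := μ) hω.measurable hs hs'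
  obtain ⟨B, hB⟩ := exists_lrNorm_besovSeq_le (μ := μ) hω.measurable hs'
  refine ⟨K * A ^ 2, B * 5 * A, fun r hr F hF J hJ t => ?_⟩
  simp only [besovNorm_eq_lrNorm] at hJ ⊢
  -- The supremum of the energies is an `ℓ^∞` norm, dominated by the `ℓ^r` norm for every `r`; hence
  -- constants independent of `r`.
  have hsmall : K * supEnergy μ ω (1 + 2 * s) J (F 0) ≤ 2 ^ ((1 + 2 * s) * J) := by
    refine le_trans ?_ hJ
    push_cast
    rw [mul_assoc, ← mul_pow]
    gcongr
    refine iSup₂_le fun j hj => ?_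
    rw [← sq_energySeq s hj]
    gcongr
    exact (le_lrNorm hr _ j).trans (hA r hr J (F 0))
  have hE := hflow F hF J hsmall t
  have hcomp : ∀ {F F' : G → ℂ}, (∀ j, J ≤ j → energy μ ω j F ≤ 18 * energy μ ω j F') →
      lrNorm r (besovSeq μ ω s F)
        ≤ (B * 5 * A : ℝ≥0) * 2 ^ (-s * J) * lrNorm r (besovSeq μ ω s F') := by
    intro F F' hFF'
    -- `18 ≤ 5²`.
    have h1 : lrNorm r (energySeq μ ω s J F) ≤ 5 * lrNorm r (energySeq μ ω s J F') := by
      refine lrNorm_le_mul hr fun j => ?_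
      by_cases hj : J ≤ j
      · refine le_of_sq_le_sq ?_
        rw [mul_pow, sq_energySeq s hj, sq_energySeq s hj]
        calc _ ≤ 2 ^ ((1 + 2 * s) * j) * (18 * energy μ ω j F') := by gcongr; exact hFF' j hj
          _ = 18 * (2 ^ ((1 + 2 * s) * j) * energy μ ω j F') := by ring
          _ ≤ _ := by
            gcongr
            norm_num
      · rw [energySeq, if_neg hj]
        exact zero_le
    calc _ ≤ B * 2 ^ (-s * J) * lrNorm r (energySeq μ ω s J F) := hB r hr J F
      _ ≤ B * 2 ^ (-s * J) * (5 * (A * lrNorm r (besovSeq μ ω s F'))) := by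
          gcongr
          refine h1.trans ?_
          gcongr
          exact hA r hr J F'
      _ = _ := by
          push_cast
          ring
  exact ⟨hcomp fun j hj => (hE j hj).1, hcomp fun j hj => (hE j hj).2⟩

end FlowBound

theorem TwoSidedBound.mono {C C' : ℝ≥0} (hC : C ≤ C') {a b : ℝ} {n : ℝ → ℝ≥0∞}
    (h : TwoSidedBound C a b n) : TwoSidedBound C' a b n :=
  ⟨h.1, h.2.1.trans (mul_le_mul' (ENNReal.coe_le_coe.2 hC) le_rfl),
    h.2.2.trans (mul_le_mul' (ENNReal.coe_le_coe.2 hC) le_rfl)⟩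

/-! ### From classical solutions to flows on the Fourier side -/

section Reduction

variable {G : Type*} [AddCommGroup G] [MeasurableSpace G] [MeasurableAdd₂ G] [MeasurableNeg G]
  {μ : Measure G} [SFinite μ] [μ.IsAddLeftInvariant] [μ.IsNegInvariant] {ω : G → ℝ}
  {X : Type*} [MeasurableSpace X] {ρ : Measure X}

/-- The properties of a Fourier transform on real-valued functions that the argument uses. -/
structure IsFourier (μ : Measure G) (hat : Lp ℝ 2 ρ → G → ℂ) (c : ℝ) : Prop where
  pos : 0 < c
  memLp : ∀ f, MemLp (hat f) 2 μ
  sub : ∀ f g, hat (f - g) =ᵐ[μ] hat f - hat g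
  smul : ∀ (a : ℝ) f, hat (a • f) =ᵐ[μ] (a : ℂ) • hat f
  symm : ∀ f, ∀ᵐ x ∂μ, hat f (-x) = (starRingEnd ℂ) (hat f x)
  mul : ∀ f g h : Lp ℝ 2 ρ, (∀ᵐ x ∂ρ, h x = f x * g x) →
    ∀ᵐ x ∂μ, hat h x = c * ∫ y, hat f (x - y) * hat g y ∂μ

variable {hat : Lp ℝ 2 ρ → G → ℂ} {c : ℝ}

/-- The normalised Fourier transform, for which products become convolutions. -/
def fourierLp (h : IsFourier μ hat c) (f : Lp ℝ 2 ρ) : Lp ℂ 2 μ :=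
  ((h.memLp f).const_smul (c : ℂ)).toLp _

theorem fourierLp_coeFn (h : IsFourier μ hat c) (f : Lp ℝ 2 ρ) :
    fourierLp h f =ᵐ[μ] fun x => c * hat f x :=
  MemLp.coeFn_toLp ((h.memLp f).const_smul (c : ℂ))

theorem fourierLp_sub (h : IsFourier μ hat c) (f g : Lp ℝ 2 ρ) :
    fourierLp h (f - g) = fourierLp h f - fourierLp h g := by
  ext1
  filter_upwards [fourierLp_coeFn h (f - g), fourierLp_coeFn h f, fourierLp_coeFn h g,
    Lp.coeFn_sub (fourierLp h f) (fourierLp h g), h.sub f g] with x h1 h2 h3 h4 h5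
  rw [h1, h4, Pi.sub_apply, h2, h3, h5, Pi.sub_apply, mul_sub]

theorem fourierLp_smul (h : IsFourier μ hat c) (a : ℝ) (f : Lp ℝ 2 ρ) :
    fourierLp h (a • f) = a • fourierLp h f := by
  ext1
  filter_upwards [fourierLp_coeFn h (a • f), fourierLp_coeFn h f,
    Lp.coeFn_smul a (fourierLp h f), h.smul a f] with x h1 h2 h3 h4
  rw [h1, h3, Pi.smul_apply, h2, h4, Pi.smul_apply, Complex.real_smul, smul_eq_mul, mul_left_comm]

theorem eLpNorm_le_sobolevNorm {s : ℝ} (hs : 0 ≤ s) (F : G → ℂ) :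
    eLpNorm F 2 μ ≤ sobolevNorm μ ω s F := by
  refine le_of_sq_le_sq ?_
  rw [sq_eLpNorm_two, sobolevNorm_sq]
  refine lintegral_mono fun x => le_mul_of_one_le_left zero_le ?_
  rw [ENNReal.one_le_ofReal]
  exact Real.one_le_rpow (by nlinarith [sq_nonneg (ω x)]) hs

theorem norm_fourierLp_le (h : IsFourier μ hat c) (f : Lp ℝ 2 ρ)
    (hf : sobolevNorm μ ω 1 (hat f) ≠ ∞) :
    ‖fourierLp h f‖ ≤ c * (sobolevNorm μ ω 1 (hat f)).toReal := by
  rw [fourierLp, Lp.norm_toLp, eLpNorm_const_smul, ENNReal.toReal_mul]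
  have : ‖(c : ℂ)‖ₑ.toReal = c := by
    rw [toReal_enorm, Complex.norm_real, Real.norm_of_nonneg h.pos.le]
  rw [this]
  exact mul_le_mul_of_nonneg_left
    (ENNReal.toReal_mono hf (eLpNorm_le_sobolevNorm zero_le_one _)) h.pos.le

theorem tendsto_fourierLp (h : IsFourier μ hat c) {ι : Type*} {l : Filter ι} {f : ι → Lp ℝ 2 ρ}
    (hf : Tendsto (fun i => sobolevNorm μ ω 1 (hat (f i))) l (𝓝 0)) :
    Tendsto (fun i => fourierLp h (f i)) l (𝓝 0) := by
  rw [tendsto_zero_iff_norm_tendsto_zero]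
  have h1 : Tendsto (fun i => c * (sobolevNorm μ ω 1 (hat (f i))).toReal) l (𝓝 0) := by
    have := ((ENNReal.tendsto_toReal ENNReal.zero_ne_top).comp hf).const_mul c
    simpa using this
  refine squeeze_zero' (Eventually.of_forall fun _ => norm_nonneg _) ?_ h1
  filter_upwards [hf.eventually (gt_mem_nhds ENNReal.zero_lt_top)] with i hi
  exact norm_fourierLp_le h (f i) hi.ne

/-- This is `resolvent_bound` with `δ = κ = 1`, as `(ω + 1)² ≤ 2 (1 + ω²)`. -/
theorem lintegral_japanese_lt_top (hω : IsFrequency μ ω) :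
    ∫⁻ x, ENNReal.ofReal ((1 + ω x ^ 2)⁻¹) ∂μ < ∞ := by
  obtain ⟨C, hC⟩ := hω.resolvent_bound 1 one_pos
  have h1 := hC 1 le_rfl
  refine (lintegral_le_two_mul_of_even hω (Eventually.of_forall fun x => ?_)).trans_lt
    (ENNReal.mul_lt_top (by norm_num) ?_)
  · simp only [hω.map_neg, neg_sq]
  calc ∫⁻ x, ENNReal.ofReal ((1 + ω x ^ 2)⁻¹) ∂(posMeasure μ ω)
      ≤ ∫⁻ x, 2 * ENNReal.ofReal ((ω x + 1) ^ (-(1 + 1 : ℝ))) ∂(posMeasure μ ω) := by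
        refine lintegral_mono_ae ?_
        filter_upwards [ae_posMeasure hω] with x hx
        rw [show (2 : ℝ≥0∞) = ENNReal.ofReal 2 by norm_num, ← ENNReal.ofReal_mul (by norm_num)]
        refine ENNReal.ofReal_le_ofReal ?_
        rw [Real.rpow_neg (by linarith), show (1 + 1 : ℝ) = ((2 : ℕ) : ℝ) by norm_num,
          Real.rpow_natCast, ← div_eq_mul_inv, le_div_iff₀ (by positivity), inv_mul_le_iff₀
          (by positivity)]
        nlinarith [sq_nonneg (ω x - 1)]
    _ < ∞ := by
        rw [lintegral_const_mul' _ _ (by norm_num)]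
        refine ENNReal.mul_lt_top (by norm_num) (h1.trans_lt ?_)
        exact ENNReal.mul_lt_top (by simp) (by simp)

theorem integrable_of_japanese (hω : IsFrequency μ ω) {F : G → ℂ} (hF : AEStronglyMeasurable F μ)
    (h : ∫⁻ x, ENNReal.ofReal (1 + ω x ^ 2) * ‖F x‖ₑ ^ 2 ∂μ < ∞) : Integrable F μ := by
  refine ⟨hF, ?_⟩
  set w : G → ℝ≥0∞ := fun x => ENNReal.ofReal (1 + ω x ^ 2) with hw
  have hwm : Measurable w := ((hω.measurable.pow_const 2).const_add 1).ennreal_ofReal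
  have hw0 : ∀ x, w x ≠ 0 := fun x => (ENNReal.ofReal_pos.2 (by positivity)).ne'
  have hwt : ∀ x, w x ≠ ∞ := fun x => ENNReal.ofReal_ne_top
  have h1 := sq_lintegral_mul_le (ν := μ) (f := fun x => (w x)⁻¹ ^ (1 / 2 : ℝ))
    (g := fun x => w x ^ (1 / 2 : ℝ) * ‖F x‖ₑ) (hwm.inv.pow_const _).aemeasurable
    ((hwm.pow_const _).aemeasurable.mul hF.enorm)
  simp only [mul_pow, sq_rpow_half, ← mul_assoc] at h1
  have h2 : ∀ x, (w x)⁻¹ ^ (1 / 2 : ℝ) * w x ^ (1 / 2 : ℝ) = 1 := fun x => by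
    rw [← ENNReal.mul_rpow_of_nonneg _ _ (by norm_num), ENNReal.inv_mul_cancel (hw0 x) (hwt x),
      ENNReal.one_rpow]
  have h3 : ∫⁻ x, (w x)⁻¹ ∂μ < ∞ := by
    refine lt_of_eq_of_lt (lintegral_congr fun x => ?_) (lintegral_japanese_lt_top hω)
    rw [ENNReal.ofReal_inv_of_pos (by positivity)]
  simp only [h2, one_mul] at h1
  have h4 := h1.trans_lt (ENNReal.mul_lt_top h3 h)
  by_contra hc
  simp only [HasFiniteIntegral, not_lt, top_le_iff] at hc
  simp [hc] at h4

/-- The weights needed are `1`, `ω²`, `1 + ω²` and `(1 + ω²) ω²`, all at most `(1 + ω²)³`. The last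
two give integrability by Cauchy–Schwarz. -/
theorem isRegular_of_sobolevNorm_lt_top (hω : IsFrequency μ ω) {F : G → ℂ}
    (hF : AEStronglyMeasurable F μ) (hsymm : ∀ᵐ x ∂μ, F (-x) = (starRingEnd ℂ) (F x))
    (h : sobolevNorm μ ω 3 F < ∞) : IsRegular μ ω F := by
  have h3 : ∫⁻ x, ENNReal.ofReal ((1 + ω x ^ 2) ^ 3) * ‖F x‖ₑ ^ 2 ∂μ < ∞ := by
    have := ENNReal.pow_lt_top (n := 2) h
    rw [sobolevNorm_sq] at this
    convert this using 5
    norm_cast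
  have hFω : AEStronglyMeasurable (fun x => ω x * F x) μ :=
    (Complex.measurable_ofReal.comp hω.measurable).aestronglyMeasurable.mul hF
  have hnorm : ∀ x, ‖(ω x : ℂ) * F x‖ₑ ^ 2 = ENNReal.ofReal (ω x ^ 2) * ‖F x‖ₑ ^ 2 := fun x => by
    rw [enorm_mul, mul_pow, ← ofReal_norm (ω x : ℂ), Complex.norm_real,
      ← ENNReal.ofReal_pow (norm_nonneg _), Real.norm_eq_abs, sq_abs]
  have hle : ∀ {a : G → ℝ}, (∀ x, a x ≤ (1 + ω x ^ 2) ^ 3) →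
      ∫⁻ x, ENNReal.ofReal (a x) * ‖F x‖ₑ ^ 2 ∂μ < ∞ := fun ha => by
    refine (lintegral_mono fun x => ?_).trans_lt h3
    gcongr
    exact ha x
  have hsq : ∀ x, 0 ≤ ω x ^ 2 := fun x => sq_nonneg _
  refine ⟨hsymm, memLp_two_iff.2 ⟨hF, ?_⟩, memLp_two_iff.2 ⟨hFω, ?_⟩,
    integrable_of_japanese hω hF ?_, integrable_of_japanese hω hFω ?_⟩
  · have := hle (a := fun _ => 1) fun x => one_le_pow₀ (by linarith [hsq x])
    simpa using this
  · simp only [hnorm]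
    exact hle fun x => by nlinarith [hsq x, pow_nonneg (hsq x) 2, pow_nonneg (hsq x) 3]
  · exact hle fun x => by nlinarith [hsq x, pow_nonneg (hsq x) 2, pow_nonneg (hsq x) 3]
  · simp only [hnorm, ← mul_assoc]
    simp only [← ENNReal.ofReal_mul (add_nonneg zero_le_one (hsq _))]
    exact hle fun x => by nlinarith [hsq x, pow_nonneg (hsq x) 2, pow_nonneg (hsq x) 3]

theorem isFlow_fourierLp (hω : IsFrequency μ ω) (h : IsFourier μ hat c) {q : ℝ → Lp ℝ 2 ρ}
    (hq : IsClassicalSolution μ ω hat q) : IsFlow μ ω (fun t => fourierLp h (q t)) := by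
  have hcoe := fun t => fourierLp_coeFn h (q t)
  refine ⟨fun t => ?_, fun t => ?_⟩
  · refine isRegular_of_sobolevNorm_lt_top hω (Lp.aestronglyMeasurable _) ?_ ?_
    · have hneg := (Measure.measurePreserving_neg μ).quasiMeasurePreserving.ae (hcoe t)
      filter_upwards [hcoe t, hneg, h.symm (q t)] with x h1 h2 h3
      rw [h1, h2, h3, map_mul, Complex.conj_ofReal]
    · have e : sobolevNorm μ ω 3 (fourierLp h (q t)) ^ 2
          = ‖(c : ℂ)‖ₑ ^ 2 * sobolevNorm μ ω 3 (hat (q t)) ^ 2 := by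
        rw [sobolevNorm_sq, sobolevNorm_sq, ← lintegral_const_mul' _ _ (by simp)]
        refine lintegral_congr_ae ?_
        filter_upwards [hcoe t] with x hx
        rw [hx, enorm_mul, mul_pow]
        ring
      have e2 : sobolevNorm μ ω 3 (fourierLp h (q t)) ^ 2 < ∞ := by
        rw [e]
        exact ENNReal.mul_lt_top (by simp) (ENNReal.pow_lt_top (hq.mem_H3 t))
      by_contra hc
      simp [not_lt_top_iff.1 hc] at e2
  · obtain ⟨v, -, -, hv, heq⟩ := hq.exists_deriv
    refine ⟨fourierLp h (v t), ?_, ?_⟩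
    · rw [hasDerivAt_iff_tendsto_slope_zero]
      have h1 := tendsto_fourierLp h (hv t)
      have h2 := h1.add_const (fourierLp h (v t))
      rw [zero_add] at h2
      refine h2.congr fun a => ?_
      rw [fourierLp_sub, fourierLp_smul, fourierLp_sub, sub_add_cancel]
    · obtain ⟨qx, qxx, Hqxx, hqx, hqxx, hH, hvt⟩ := heq t
      -- The convolution rule needs `q qₓ` as an element of `L²`; the equation supplies it.
      set p : Lp ℝ 2 ρ := (2⁻¹ : ℝ) • (v t + Hqxx) with hp
      have hpx : ∀ᵐ x ∂ρ, p x = q t x * qx x := by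
        filter_upwards [hvt, Lp.coeFn_smul (2⁻¹ : ℝ) (v t + Hqxx), Lp.coeFn_add (v t) Hqxx]
          with x h1 h2 h3
        rw [hp, h2, Pi.smul_apply, h3, Pi.add_apply, h1, smul_eq_mul]
        ring
      have hvp : v t = (2 : ℝ) • p - Hqxx := by
        rw [hp, smul_smul, mul_inv_cancel₀ two_ne_zero, one_smul, add_sub_cancel_right]
      have hF := hcoe t
      filter_upwards [fourierLp_coeFn h (v t), h.mul _ _ _ hpx, h.sub ((2 : ℝ) • p) Hqxx,
        h.smul 2 p, hqx, hqxx, hH, hF] with x h1 h2 h3 h4 h5 h6 h7 h8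
      have hint : ∫ z, fourierLp h (q t) (x - z) * (ω z * fourierLp h (q t) z) ∂μ
          = -Complex.I * c ^ 2 * ∫ y, hat (q t) (x - y) * hat qx y ∂μ := by
        rw [← integral_const_mul]
        refine integral_congr_ae ?_
        filter_upwards [(quasiMeasurePreserving_sub_left μ x).ae hF, hF, hqx] with y e1 e2 e3
        rw [e1, e2, e3]
        linear_combination (c ^ 2 * hat (q t) (x - y) * ω y * hat (q t) y) * Complex.I_mul_I
      have habs : (Real.sign (ω x) * ω x : ℝ) = |ω x| := by
        rcases lt_trichotomy (ω x) 0 with h0 | h0 | h0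
        · rw [Real.sign_of_neg h0, abs_of_neg h0]; ring
        · rw [h0]; simp
        · rw [Real.sign_of_pos h0, abs_of_pos h0]; ring
      have habs' := congrArg (fun r : ℝ => (r : ℂ)) habs
      push_cast at habs'
      rw [h1, boRhs, hint, h8, hvp, h3, Pi.sub_apply, h4, Pi.smul_apply, h2, h7, h6, h5, ← habs']
      push_cast
      rw [smul_eq_mul]
      linear_combination (-(c * (Real.sign (ω x)) * Complex.I * ω x * ω x * hat (q t) x)
        - 2 * c ^ 2 * ∫ y, hat (q t) (x - y) * hat qx y ∂μ) * (- Complex.I_mul_I)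

theorem besovNorm_const_mul_le {s : ℝ} {r : ℝ≥0∞} (hr : 1 ≤ r) {F F' : G → ℂ} {a : ℂ}
    (h : F' =ᵐ[μ] fun x => a * F x) :
    besovNorm μ ω s r F' ≤ ‖a‖ₑ * besovNorm μ ω s r F := by
  have he : ∀ A : Set G, eLpNorm F' 2 (μ.restrict A) = ‖a‖ₑ * eLpNorm F 2 (μ.restrict A) :=
    fun A => by
      rw [eLpNorm_congr_ae (Measure.absolutelyContinuous_of_le Measure.restrict_le_self |>.ae_le h)]
      exact eLpNorm_const_smul a F 2 _
  rw [besovNorm_eq_lrNorm, besovNorm_eq_lrNorm]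
  refine lrNorm_le_mul hr fun j => le_of_eq ?_
  cases j with
  | zero => exact he _
  | succ n =>
    simp only [besovSeq, shellPart, he]
    ring

theorem exists_scaleBound_of_isFourier (hω : IsFrequency μ ω) (h : IsFourier μ hat c) {s : ℝ}
    (hs : -(1 / 2) < s) (hs' : s < 0) : ∃ K C : ℝ≥0, ∀ r : ℝ≥0∞, 1 ≤ r → ∀ q : ℝ → Lp ℝ 2 ρ,
      IsClassicalSolution μ ω hat q →
      ScaleBound s K C (fun t => besovNorm μ ω s r (hat (q t))) := by
  obtain ⟨K, C, hKC⟩ := exists_scaleBound_besovNorm hω hs hs'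
  have hc : (c : ℂ) ≠ 0 := Complex.ofReal_ne_zero.2 h.pos.ne'
  set D : ℝ≥0 := ‖(c : ℂ)‖₊ + ‖(c : ℂ)⁻¹‖₊
  refine ⟨K * D ^ 2, D * C * D, fun r hr q hq => ?_⟩
  refine (hKC r hr _ (isFlow_fourierLp hω h hq)).of_equiv (fun t => ?_) fun t => ?_
  · refine (besovNorm_const_mul_le (a := (c : ℂ)⁻¹) (F := fourierLp h (q t)) hr ?_).trans ?_
    · filter_upwards [fourierLp_coeFn h (q t)] with x hx
      rw [hx, inv_mul_cancel_left₀ hc]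
    · gcongr
      exact ENNReal.coe_le_coe.2 le_add_self
  · refine (besovNorm_const_mul_le (a := (c : ℂ)) (F := hat (q t)) hr
      (fourierLp_coeFn h (q t))).trans ?_
    gcongr
    exact ENNReal.coe_le_coe.2 le_self_add

theorem exists_twoSidedBound_of_isFourier (hω : IsFrequency μ ω) (h : IsFourier μ hat c) {s : ℝ}
    (hs : -(1 / 2) < s) (hs' : s < 0) : ∃ C : ℝ≥0, ∀ q : ℝ → Lp ℝ 2 ρ,
      IsClassicalSolution μ ω hat q → ∀ b, -s ≤ b →
      (∀ r : ℝ≥0∞, 1 ≤ r →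
        TwoSidedBound C (2 / (1 + 2 * s)) b (fun t => besovNorm μ ω s r (hat (q t)))) ∧
      TwoSidedBound C (2 / (1 + 2 * s)) b (fun t => sobolevNorm μ ω s (hat (q t))) := by
  obtain ⟨K, C, hKC⟩ := exists_scaleBound_of_isFourier hω h hs hs'
  set D : ℝ≥0 := (2 * 2 ^ (-(3 * s) / 2)) with hD
  have hD1 : 1 ≤ D := by
    rw [hD]
    have : (1 : ℝ≥0) ≤ 2 ^ (-(3 * s) / 2) := NNReal.one_le_rpow (by norm_num) (by linarith)
    calc (1 : ℝ≥0) ≤ 2 * 1 := by norm_num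
      _ ≤ _ := by gcongr
  have hDc : (D : ℝ≥0∞) = 2 * 2 ^ (-(3 * s) / 2) := by
    rw [hD, ENNReal.coe_mul, ENNReal.coe_rpow_of_nonneg _ (by linarith)]
    norm_num
  obtain ⟨C₁, hC₁⟩ := exists_twoSidedBound hs hs' K C
  obtain ⟨C₂, hC₂⟩ := exists_twoSidedBound hs hs' (K * D ^ 2) (D * C * D)
  refine ⟨max C₁ C₂, fun q hq b hb => ⟨fun r hr => ?_, ?_⟩⟩
  · exact TwoSidedBound.mono (le_max_left _ _) (hC₁ _
      (fun t => besovNorm_lt_top hω.measurable hs' hr (h.memLp _)) (hKC r hr q hq) b hb)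
  · have hle : ∀ t, sobolevNorm μ ω s (hat (q t)) ≤ besovNorm μ ω s 2 (hat (q t)) := fun t =>
      sobolevNorm_le_besovNorm hω.measurable hs' _
    refine TwoSidedBound.mono (le_max_right _ _) (hC₂ _ (fun t => (hle t).trans_lt
      (besovNorm_lt_top hω.measurable hs' one_le_two (h.memLp _)))
      ((hKC 2 one_le_two q hq).of_equiv (fun t => ?_) fun t => ?_) b hb)
    · exact (hle t).trans (le_mul_of_one_le_left zero_le (ENNReal.one_le_coe_iff.2 hD1))
    · rw [hDc]
      exact besovNorm_le_sobolevNorm hω.measurable hs' _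

end Reduction

section Line

/-! ### The Fourier transform on the line -/

theorem isFrequency_id : IsFrequency (volume : Measure ℝ) (id : ℝ → ℝ) where
  measurable := measurable_id
  map_add _ _ := rfl
  resolvent_bound δ hδ := by
    refine ⟨(δ⁻¹).toNNReal, fun κ hκ => ?_⟩
    have hκ0 : 0 < κ := by linarith
    have h1 : ∫⁻ x, ENNReal.ofReal ((id x + κ) ^ (-(1 + δ))) ∂(posMeasure volume id)
        = ∫⁻ x in Set.Ici κ, ENNReal.ofReal (x ^ (-(1 + δ))) := by
      rw [← lintegral_indicator measurableSet_Ici,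
        ← lintegral_add_right_eq_self (μ := volume) (Set.indicator (Set.Ici κ) _) κ, posMeasure,
        ← lintegral_indicator (measurableSet_le measurable_const measurable_id)]
      refine lintegral_congr fun x => ?_
      by_cases hx : 0 ≤ x
      · rw [Set.indicator_of_mem (by exact hx), Set.indicator_of_mem (by simpa using hx), id]
      · rw [Set.indicator_of_notMem (by exact hx), Set.indicator_of_notMem (by simpa using hx)]
    have hi : IntegrableOn (fun x : ℝ => x ^ (-(1 + δ))) (Set.Ioi κ) :=
      integrableOn_Ioi_rpow_of_lt (by linarith) hκ0
    rw [h1, setLIntegral_congr Ioi_ae_eq_Ici.symm, ← ofReal_integral_eq_lintegral_ofReal hi,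
      integral_Ioi_rpow_of_lt (by linarith) hκ0, ← ENNReal.ofReal,
      ← ENNReal.ofReal_mul (inv_nonneg.2 hδ.le)]
    · refine le_of_eq (congrArg _ ?_)
      rw [show -(1 + δ) + 1 = -δ by ring]
      field_simp
    · filter_upwards [ae_restrict_mem measurableSet_Ioi] with x hx
      exact Real.rpow_nonneg (hκ0.le.trans (le_of_lt hx)) _

/-- On `L¹ ∩ L²` the two definitions of the Fourier transform agree. -/
theorem fourier_lp_ae_eq_fourier (h : Lp ℂ 2 (volume : Measure ℝ)) (hi : Integrable h) :
    (𝓕 h : Lp ℂ 2 (volume : Measure ℝ)) =ᵐ[volume] 𝓕 (h : ℝ → ℂ) := by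
  -- Both transforms are tested against smooth compactly supported functions: in each case the
  -- transform moves to the test function, by the distributional definition or by Fubini.
  refine ae_eq_of_integral_contDiff_smul_eq
    ((Lp.memLp (𝓕 h : Lp ℂ 2 (volume : Measure ℝ))).locallyIntegrable (by norm_num))
    (Continuous.locallyIntegrable ?_) fun g hg hg' => ?_
  · exact VectorFourier.fourierIntegral_continuous Real.continuous_fourierChar
      (by fun_prop) hi
  · have hc : HasCompactSupport fun x => (g x : ℂ) := hg'.comp_left Complex.ofReal_zero
    let φ : SchwartzMap ℝ ℂ := hc.toSchwartzMap (Complex.ofRealCLM.contDiff.comp hg)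
    have hφ : ∀ x, φ x = (g x : ℂ) := fun x => rfl
    have h1 := congrArg (fun T : TemperedDistribution ℝ ℂ => T φ)
      (Lp.fourier_toTemperedDistribution_eq h)
    simp only [TemperedDistribution.fourier_apply, Lp.toTemperedDistribution_apply] at h1
    have h2 := VectorFourier.integral_fourierIntegral_smul_eq_flip (μ := (volume : Measure ℝ))
      (ν := (volume : Measure ℝ)) (L := innerₗ ℝ) Real.continuous_fourierChar
      (by fun_prop) φ.integrable hi
    have h3 : (innerₗ ℝ).flip = innerₗ ℝ := by ext; simp
    rw [h3] at h2
    have h4 : ∀ x, (𝓕 φ) x = VectorFourier.fourierIntegral Real.fourierChar volume (innerₗ ℝ) φ x :=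
      fun x => rfl
    simp only [h4] at h1
    rw [h2] at h1
    simp only [hφ] at h1
    simp only [Complex.real_smul]
    exact h1.symm

theorem norm_fourierChar_mul_conj (x : ℝ) (z : ℂ) :
    ‖(Real.fourierChar x : ℂ) * (starRingEnd ℂ) z‖ = ‖z‖ := by
  rw [norm_mul, Circle.norm_coe, one_mul, RCLike.norm_conj]

theorem memLp_conj_modulate (ξ : ℝ) {f : ℝ → ℂ} (hf : MemLp f 2 volume) :
    MemLp (fun x => (Real.fourierChar (x * ξ) : ℂ) * (starRingEnd ℂ) (f x)) 2 volume := by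
  refine MemLp.of_le hf (AEStronglyMeasurable.mul ?_ hf.star.1) (ae_of_all _ fun x => ?_)
  · exact Continuous.aestronglyMeasurable (by fun_prop)
  · exact (norm_fourierChar_mul_conj _ _).le

theorem memLp_conj_reflect (ξ : ℝ) {f : ℝ → ℂ} (hf : MemLp f 2 volume) :
    MemLp (fun x => (starRingEnd ℂ) (f (ξ - x))) 2 volume :=
  (memLp_sub_left hf ξ).star

theorem dist_toLp_eq {f g : ℝ → ℂ} (hf : MemLp f 2 volume) (hg : MemLp g 2 volume)
    (F G : Lp ℂ 2 (volume : Measure ℝ))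
    (h : eLpNorm (f - g) 2 volume = eLpNorm (F - G : ℝ → ℂ) 2 volume) :
    dist (hf.toLp f) (hg.toLp g) = dist F G := by
  rw [Lp.dist_def, Lp.dist_def, ← h]
  exact congrArg _ (eLpNorm_congr_ae (hf.coeFn_toLp.sub hg.coeFn_toLp))

/-- Conjugation and modulation become conjugation and reflection under the Fourier transform. -/
theorem fourier_conj_modulate (ξ : ℝ) (f : Lp ℂ 2 (volume : Measure ℝ)) :
    𝓕 ((memLp_conj_modulate ξ (Lp.memLp f)).toLp _) =
      (memLp_conj_reflect ξ (Lp.memLp (𝓕 f : Lp ℂ 2 (volume : Measure ℝ)))).toLp _ := by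
  have hU : Isometry fun f : Lp ℂ 2 (volume : Measure ℝ) =>
      (memLp_conj_modulate ξ (Lp.memLp f)).toLp _ := Isometry.of_dist_eq fun f g => by
    refine dist_toLp_eq _ _ _ _ (eLpNorm_congr_norm_ae (ae_of_all _ fun x => ?_))
    simp only [Pi.sub_apply, ← mul_sub, ← map_sub]
    exact norm_fourierChar_mul_conj _ _
  have hW : Isometry fun f : Lp ℂ 2 (volume : Measure ℝ) =>
      (memLp_conj_reflect ξ (Lp.memLp f)).toLp _ := Isometry.of_dist_eq fun f g => by
    refine dist_toLp_eq _ _ _ _ ?_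
    rw [← eLpNorm_comp_measurePreserving (((Lp.memLp f).sub (Lp.memLp g)).1)
      (Measure.measurePreserving_sub_left volume ξ)]
    refine eLpNorm_congr_norm_ae (ae_of_all _ fun x => ?_)
    simp only [Pi.sub_apply, Function.comp, ← map_sub]
    exact RCLike.norm_conj _
  -- Both sides are continuous in `f`, being compositions of isometries, so Schwartz functions
  -- suffice; there the transforms are integrals.
  refine DenseRange.induction_on (p := fun f => 𝓕 ((memLp_conj_modulate ξ (Lp.memLp f)).toLp _) =
      (memLp_conj_reflect ξ (Lp.memLp (𝓕 f : Lp ℂ 2 (volume : Measure ℝ)))).toLp _)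
    (SchwartzMap.denseRange_toLpCLM (E := ℝ) (F := ℂ) (p := 2) (μ := volume) ENNReal.ofNat_ne_top)
    f (isClosed_eq ?_ ?_) fun φ => ?_
  · exact (Lp.fourierTransformₗᵢ ℝ ℂ).continuous.comp hU.continuous
  · exact hW.continuous.comp (Lp.fourierTransformₗᵢ ℝ ℂ).continuous
  · set F : Lp ℂ 2 (volume : Measure ℝ) := SchwartzMap.toLpCLM ℝ ℂ 2 volume φ with hF
    have hFφ : F =ᵐ[volume] φ := φ.coeFn_toLp 2 volume
    have hFi : Integrable F := φ.integrable.congr hFφ.symm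
    have hUc := (memLp_conj_modulate ξ (Lp.memLp F)).coeFn_toLp
    have hUi : Integrable ((memLp_conj_modulate ξ (Lp.memLp F)).toLp _) := by
      refine Integrable.congr (Integrable.mono hFi (memLp_conj_modulate ξ (Lp.memLp F)).1
        (ae_of_all _ fun x => (norm_fourierChar_mul_conj _ _).le)) hUc.symm
    ext1
    have hqm : Measure.QuasiMeasurePreserving (fun x : ℝ => ξ - x) volume volume :=
      quasiMeasurePreserving_sub_left volume ξ
    filter_upwards [fourier_lp_ae_eq_fourier _ hUi, hqm.ae (fourier_lp_ae_eq_fourier _ hFi),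
      (memLp_conj_reflect ξ (Lp.memLp (𝓕 F : Lp ℂ 2 (volume : Measure ℝ)))).coeFn_toLp]
      with η h1 h2 h3
    rw [h1, h3, h2, Real.fourier_congr_ae hUc, Real.fourier_real_eq, Real.fourier_real_eq,
      ← integral_conj]
    refine integral_congr_ae (ae_of_all _ fun x => ?_)
    simp only [Circle.smul_def, smul_eq_mul, map_mul, ← mul_assoc]
    congr 1
    rw [← Circle.coe_inv_eq_conj, ← Circle.coe_mul, ← AddChar.map_neg_eq_inv,
      ← AddChar.map_add_eq_mul]
    congr 2
    ring

/-- The Fourier transform turns products into convolutions. -/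
theorem fourier_mul_ae_eq (f g h : Lp ℂ 2 (volume : Measure ℝ))
    (hh : ∀ᵐ x, h x = f x * g x) :
    ∀ᵐ ξ, (𝓕 h : Lp ℂ 2 (volume : Measure ℝ)) ξ =
      ∫ η, (𝓕 f : Lp ℂ 2 (volume : Measure ℝ)) (ξ - η) * (𝓕 g : Lp ℂ 2 (volume : Measure ℝ)) η := by
  have hi : Integrable h :=
    ((Lp.memLp f).integrable_mul (Lp.memLp g)).congr (hh.mono fun x hx => hx.symm)
  filter_upwards [fourier_lp_ae_eq_fourier h hi] with ξ hξ
  -- Plancherel with `f` conjugated and modulated: one pairing is the convolution at `ξ`, the other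
  -- the Fourier integral of `f g`.
  have h1 := Lp.inner_fourier_eq ((memLp_conj_modulate ξ (Lp.memLp f)).toLp _) g
  rw [fourier_conj_modulate, inner_eq_integral, inner_eq_integral] at h1
  have h2 := (memLp_conj_reflect ξ (Lp.memLp (𝓕 f : Lp ℂ 2 (volume : Measure ℝ)))).coeFn_toLp
  have h3 := (memLp_conj_modulate ξ (Lp.memLp f)).coeFn_toLp
  rw [hξ, Real.fourier_real_eq]
  trans ∫ x, (starRingEnd ℂ) ((memLp_conj_modulate ξ (Lp.memLp f)).toLp _ x) * g x
  · refine integral_congr_ae ?_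
    filter_upwards [hh, h3] with x e1 e2
    rw [e1, e2, map_mul, Complex.conj_conj, ← Circle.coe_inv_eq_conj, ← AddChar.map_neg_eq_inv,
      Circle.smul_def, smul_eq_mul, mul_assoc]
  · rw [← h1]
    refine integral_congr_ae ?_
    filter_upwards [h2] with x e2
    rw [e2, Complex.conj_conj]

theorem complexify_coeFn {X : Type*} [MeasurableSpace X] {ρ : Measure X} (f : Lp ℝ 2 ρ) :
    complexify f =ᵐ[ρ] fun x => (f x : ℂ) :=
  ContinuousLinearMap.coeFn_compLp _ f

theorem complexify_sub {X : Type*} [MeasurableSpace X] {ρ : Measure X} (f g : Lp ℝ 2 ρ) :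
    complexify (f - g) = complexify f - complexify g :=
  (Complex.ofRealCLM.compLpₗ 2 ρ).map_sub f g

theorem complexify_smul {X : Type*} [MeasurableSpace X] {ρ : Measure X} (a : ℝ) (f : Lp ℝ 2 ρ) :
    complexify (a • f) = (a : ℂ) • complexify f :=
  ((Complex.ofRealCLM.compLpₗ 2 ρ).map_smul a f).trans (Complex.coe_smul a _).symm

theorem map_div_volume {a : ℝ} (ha : 0 < a) :
    Measure.map (fun x : ℝ => x / a) volume = ENNReal.ofReal a • volume := by
  simp only [div_eq_mul_inv]
  rw [Real.map_volume_mul_right (inv_ne_zero ha.ne'), inv_inv, abs_of_pos ha]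

theorem quasiMeasurePreserving_div {a : ℝ} (ha : 0 < a) :
    Measure.QuasiMeasurePreserving (fun x : ℝ => x / a) volume volume :=
  ⟨by fun_prop, by rw [map_div_volume ha]; exact Measure.smul_absolutelyContinuous⟩

theorem isFourier_lineHat :
    IsFourier (volume : Measure ℝ) lineHat (Real.sqrt (2 * Real.pi))⁻¹ := by
  have hpi : 0 < 2 * Real.pi := Real.two_pi_pos
  have hq := quasiMeasurePreserving_div hpi
  refine ⟨by positivity, fun f => ?_, fun f g => ?_, fun a f => ?_, fun f => ?_,
    fun f g h hh => ?_⟩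
  · refine MemLp.const_mul (MemLp.comp_of_map ?_ hq.1.aemeasurable) _
    rw [map_div_volume hpi]
    exact (Lp.memLp _).smul_measure ENNReal.ofReal_ne_top
  · have h1 : 𝓕 (complexify (f - g)) = 𝓕 (complexify f) - 𝓕 (complexify g) := by
      rw [complexify_sub]
      exact (Lp.fourierTransformₗᵢ ℝ ℂ).map_sub _ _
    filter_upwards [hq.ae (Lp.coeFn_sub (𝓕 (complexify f)) (𝓕 (complexify g)))] with x hx
    simp only [lineHat, h1, hx, Pi.sub_apply, mul_sub]
  · have h1 : 𝓕 (complexify (a • f)) = (a : ℂ) • 𝓕 (complexify f) := by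
      rw [complexify_smul]
      exact (Lp.fourierTransformₗᵢ ℝ ℂ).map_smul _ _
    filter_upwards [hq.ae (Lp.coeFn_smul (a : ℂ) (𝓕 (complexify f)))] with x hx
    simp only [lineHat, h1, hx, Pi.smul_apply, smul_eq_mul]
    ring
  -- A real function is fixed by conjugation, so `fourier_conj_modulate` at `ξ = 0` is the Hermitian
  -- symmetry.
  · have h1 : (memLp_conj_modulate 0 (Lp.memLp (complexify f))).toLp _ = complexify f := by
      ext1
      filter_upwards [(memLp_conj_modulate 0 (Lp.memLp (complexify f))).coeFn_toLp,
        complexify_coeFn f] with x h1 h2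
      rw [h1, h2]
      simp
    have h2 := fourier_conj_modulate 0 (complexify f)
    rw [h1] at h2
    have h3 := (memLp_conj_reflect 0
      (Lp.memLp (𝓕 (complexify f) : Lp ℂ 2 (volume : Measure ℝ)))).coeFn_toLp
    rw [← h2] at h3
    filter_upwards [hq.ae h3] with x hx
    simp only [lineHat, map_mul, Complex.conj_ofReal, hx, Complex.conj_conj]
    rw [zero_sub, neg_div]
  · have h1 : ∀ᵐ x, complexify h x = complexify f x * complexify g x := by
      filter_upwards [hh, complexify_coeFn f, complexify_coeFn g, complexify_coeFn h]
        with x h1 h2 h3 h4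
      rw [h4, h3, h2, h1, Complex.ofReal_mul]
    filter_upwards [hq.ae (fourier_mul_ae_eq _ _ _ h1)] with x hx
    have h2 := Measure.integral_comp_div (fun y =>
      (𝓕 (complexify f) : Lp ℂ 2 (volume : Measure ℝ)) (x / (2 * Real.pi) - y) *
        (𝓕 (complexify g) : Lp ℂ 2 (volume : Measure ℝ)) y) (2 * Real.pi)
    have h3 : ∀ y, lineHat f (x - y) * lineHat g y = (((2 * Real.pi)⁻¹ : ℝ) : ℂ) *
        ((𝓕 (complexify f) : Lp ℂ 2 (volume : Measure ℝ)) (x / (2 * Real.pi) - y / (2 * Real.pi)) *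
        (𝓕 (complexify g) : Lp ℂ 2 (volume : Measure ℝ)) (y / (2 * Real.pi))) := fun y => by
      have : ((2 * Real.pi)⁻¹ : ℝ) = (Real.sqrt (2 * Real.pi))⁻¹ * (Real.sqrt (2 * Real.pi))⁻¹ := by
        rw [← mul_inv, Real.mul_self_sqrt hpi.le]
      rw [this, Complex.ofReal_mul, lineHat, lineHat, sub_div]
      ring
    simp only [h3]
    rw [integral_const_mul, h2, lineHat, hx, abs_of_pos hpi, Complex.real_smul,
      ← mul_assoc _ _ (∫ _, _), ← Complex.ofReal_mul, inv_mul_cancel₀ hpi.ne', Complex.ofReal_one, one_mul]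

end Line

section Circle

/-! ### Fourier coefficients on the circle -/

instance isAddLeftInvariant_count_int : (Measure.count : Measure ℤ).IsAddLeftInvariant where
  map_add_left_eq_self n := by
    ext s hs
    rw [Measure.map_apply (measurable_of_countable _) hs]
    rw [← Measure.count_injective_image (s := (fun x => n + x) ⁻¹' s) (add_right_injective n),
      Set.image_preimage_eq _ (add_left_surjective n)]

instance isNegInvariant_count_int : (Measure.count : Measure ℤ).IsNegInvariant where
  neg_eq_self := by
    ext s hs
    rw [Measure.neg, Measure.map_apply (measurable_of_countable _) hs,
      ← Measure.count_injective_image (s := Neg.neg ⁻¹' s) neg_injective,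
      Set.image_preimage_eq _ neg_surjective]

theorem sum_rpow_le {δ κ : ℝ} (hδ : 0 < δ) (hκ : 1 ≤ κ) (N : ℕ) :
    ∑ i ∈ Finset.range N, ((i + 1 : ℕ) + κ) ^ (-(1 + δ)) ≤ κ ^ (-δ) * δ⁻¹ := by
  have hκ0 : 0 < κ := by linarith
  have ha : AntitoneOn (fun x : ℝ => (x + κ) ^ (-(1 + δ))) (Set.Icc (0 : ℝ) (0 + N)) :=
    fun x hx y hy hxy => Real.rpow_le_rpow_of_nonpos (by linarith [hx.1]) (by linarith)
      (by linarith)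
  have h1 := ha.sum_le_integral
  simp only [zero_add] at h1
  refine h1.trans ?_
  rw [intervalIntegral.integral_comp_add_right (fun x => x ^ (-(1 + δ))),
    integral_rpow (Or.inr ⟨by linarith, ?_⟩)]
  · have : 0 ≤ ((N : ℝ) + κ) ^ (-δ) := by positivity
    rw [show -(1 + δ) + 1 = -δ by ring, zero_add, div_neg, ← neg_div, neg_sub, div_eq_mul_inv]
    exact mul_le_mul_of_nonneg_right (by linarith) (inv_nonneg.2 hδ.le)
  · rw [zero_add, Set.uIcc_of_le (by simp)]
    exact fun h => absurd h.1 (by linarith)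

theorem isFrequency_circleFreq : IsFrequency (Measure.count : Measure ℤ) circleFreq where
  measurable := measurable_of_countable _
  map_add m n := by simp only [circleFreq]; push_cast; ring
  resolvent_bound δ hδ := by
    refine ⟨1 + (δ⁻¹).toNNReal, fun κ hκ => ?_⟩
    have hκ0 : 0 < κ := by linarith
    have hset : {x : ℤ | 0 ≤ circleFreq x} = Set.range (Nat.cast : ℕ → ℤ) := by
      ext n
      simp only [circleFreq, Set.mem_ofPred_eq, Set.mem_range]
      rw [mul_nonneg_iff_of_pos_left Real.two_pi_pos, Int.cast_nonneg_iff]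
      exact ⟨fun h => ⟨n.toNat, Int.toNat_of_nonneg h⟩,
        by rintro ⟨m, rfl⟩; exact Int.natCast_nonneg m⟩
    have hsum : ∫⁻ x, ENNReal.ofReal ((circleFreq x + κ) ^ (-(1 + δ)))
        ∂(posMeasure Measure.count circleFreq)
        = ∑' n : ℕ, ENNReal.ofReal ((circleFreq n + κ) ^ (-(1 + δ))) := by
      rw [posMeasure, hset, ← lintegral_indicator (MeasurableSet.of_discrete), lintegral_count,
        ← tsum_subtype,
        tsum_range (fun x : ℤ => ENNReal.ofReal ((circleFreq x + κ) ^ (-(1 + δ))))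
          Nat.cast_injective]
    -- The zero frequency contributes `κ^(-(1+δ))`, at most `κ^(-δ)` because `κ ≥ 1`. The other
    -- terms are compared with an integral.
    rw [hsum, tsum_eq_zero_add' ENNReal.summable, ENNReal.coe_add, add_mul, ENNReal.coe_one,
      one_mul]
    refine add_le_add (ENNReal.ofReal_le_ofReal ?_) ?_
    · simp only [circleFreq]
      rw [Nat.cast_zero, Int.cast_zero, mul_zero, zero_add]
      exact Real.rpow_le_rpow_of_exponent_le hκ (by linarith)
    · rw [ENNReal.tsum_eq_iSup_nat]
      refine iSup_le fun N => ?_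
      rw [← ENNReal.ofReal_sum_of_nonneg, ← ENNReal.ofReal,
        ← ENNReal.ofReal_mul (inv_nonneg.2 hδ.le)]
      · refine ENNReal.ofReal_le_ofReal ?_
        rw [mul_comm]
        refine le_trans (Finset.sum_le_sum fun i _ => ?_) (sum_rpow_le hδ hκ N)
        refine Real.rpow_le_rpow_of_nonpos (by positivity) ?_ (by linarith)
        simp only [circleFreq, Int.cast_natCast]
        have h0 : (0 : ℝ) ≤ ((i + 1 : ℕ) : ℝ) := by positivity
        nlinarith [Real.pi_gt_three]
      · intro i _
        refine Real.rpow_nonneg (add_nonneg (mul_nonneg Real.two_pi_pos.le ?_) hκ0.le) _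
        positivity

theorem fourierCoeff_eq_inner (f : Lp ℂ 2 (AddCircle.haarAddCircle : Measure UnitAddCircle))
    (n : ℤ) : fourierCoeff f n = inner ℂ (_root_.fourierLp (T := 1) 2 n) f := by
  rw [← fourierBasis_repr, ← coe_fourierBasis, HilbertBasis.repr_apply_apply]

theorem memLp_conj_fourier (n : ℤ) {f : UnitAddCircle → ℂ}
    (hf : MemLp f 2 AddCircle.haarAddCircle) :
    MemLp (fun x => fourier n x * (starRingEnd ℂ) (f x)) 2 AddCircle.haarAddCircle := by
  refine MemLp.of_le hf (AEStronglyMeasurable.mul (map_continuous _).aestronglyMeasurable hf.star.1)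
    (ae_of_all _ fun x => ?_)
  rw [norm_mul, fourier_apply, Circle.norm_coe, one_mul, RCLike.norm_conj]

theorem fourierCoeff_conj_mul (n k : ℤ) (f : UnitAddCircle → ℂ) :
    fourierCoeff (fun x => fourier n x * (starRingEnd ℂ) (f x)) k
      = (starRingEnd ℂ) (fourierCoeff f (n - k)) := by
  rw [fourierCoeff, fourierCoeff, ← integral_conj]
  refine integral_congr_ae (ae_of_all _ fun x => ?_)
  simp only [smul_eq_mul, map_mul]
  rw [← fourier_neg, neg_neg, ← mul_assoc, ← fourier_add, neg_add_eq_sub]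

/-- Fourier coefficients turn products into convolutions. -/
theorem hasSum_fourierCoeff_mul (f g : Lp ℂ 2 (AddCircle.haarAddCircle : Measure UnitAddCircle))
    (n : ℤ) : HasSum (fun k => fourierCoeff f (n - k) * fourierCoeff g k)
      (fourierCoeff (fun x => f x * g x) n) := by
  -- Parseval with `f` conjugated and modulated, as on the line.
  have h1 := fourierBasis.hasSum_inner_mul_inner ((memLp_conj_fourier n (Lp.memLp f)).toLp _) g
  have h3 := (memLp_conj_fourier n (Lp.memLp f)).coeFn_toLp
  have h2 : ∀ k, inner ℂ ((memLp_conj_fourier n (Lp.memLp f)).toLp _) (fourierBasis (T := 1) k)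
      = fourierCoeff f (n - k) := fun k => by
    rw [← inner_conj_symm, coe_fourierBasis, ← fourierCoeff_eq_inner, fourierCoeff_congr_ae h3,
      fourierCoeff_conj_mul, Complex.conj_conj]
  have h4 : inner ℂ ((memLp_conj_fourier n (Lp.memLp f)).toLp _) g
      = fourierCoeff (fun x => f x * g x) n := by
    rw [inner_eq_integral, fourierCoeff]
    refine integral_congr_ae ?_
    filter_upwards [h3] with x hx
    rw [hx, map_mul, Complex.conj_conj, ← fourier_neg, smul_eq_mul, mul_assoc]
  rw [h4] at h1
  refine h1.congr_fun fun k => ?_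
  rw [h2, coe_fourierBasis, ← fourierCoeff_eq_inner]

theorem isFourier_circleHat :
    IsFourier (Measure.count : Measure ℤ) circleHat 1 := by
  refine ⟨one_pos, fun f => ?_, fun f g => ae_of_all _ fun n => ?_,
    fun a f => ae_of_all _ fun n => ?_, fun f => ae_of_all _ fun n => ?_,
    fun f g h hh => ae_of_all _ fun n => ?_⟩
  · rw [memLp_two_iff_integrable_sq_norm (measurable_of_countable _).aestronglyMeasurable,
      integrable_count_iff]
    exact (hasSum_sq_fourierCoeff (complexify f)).summable.norm
  · simp only [circleHat, complexify_sub, Pi.sub_apply, fourierCoeff_eq_inner, inner_sub_right]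
  · simp only [circleHat, complexify_smul, Pi.smul_apply, fourierCoeff_eq_inner, inner_smul_right,
      smul_eq_mul]
  · have h1 := fourierCoeff_conj_mul 0 n (complexify f)
    rw [zero_sub] at h1
    rw [circleHat, circleHat, ← Complex.conj_conj (fourierCoeff _ (-n)), ← h1]
    refine congrArg _ (congrFun (fourierCoeff_congr_ae ?_) n)
    filter_upwards [complexify_coeFn f] with x hx
    rw [hx, fourier_zero, one_mul, Complex.conj_ofReal]
  · have h1 := hasSum_fourierCoeff_mul (complexify f) (complexify g) n
    have h2 : fourierCoeff (complexify h) n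
        = fourierCoeff (fun x => complexify f x * complexify g x) n := by
      refine congrFun (fourierCoeff_congr_ae ?_) n
      filter_upwards [hh, complexify_coeFn f, complexify_coeFn g, complexify_coeFn h]
        with x h1 h2 h3 h4
      rw [h4, h3, h2, h1, Complex.ofReal_mul]
    simp only [circleHat]
    rw [integral_countable (integrable_count_iff.2 h1.summable.norm), h2, ← h1.tsum_eq,
      Complex.ofReal_one, one_mul]
    simp

end Circle

end BenjaminOno

end

theorem mainTheorem1 (s : ℝ) (hs : -(1 / 2 : ℝ) < s) (hs' : s < 0) :
    -- Besov norms
    (∀ r : ℝ≥0∞, 1 ≤ r → ∃ C : ℝ≥0,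
      (∀ q : ℝ → Lp ℝ 2 (volume : Measure ℝ), BenjaminOno.IsClassicalSolutionLine q →
        BenjaminOno.TwoSidedBound C (2 / (1 + 2 * s)) (-s)
          (fun t => BenjaminOno.besovLine s r (q t))) ∧
      (∀ q : ℝ → Lp ℝ 2 (AddCircle.haarAddCircle : Measure UnitAddCircle),
        BenjaminOno.IsClassicalSolutionCircle q →
        BenjaminOno.TwoSidedBound C (2 / (1 + 2 * s)) (-s)
          (fun t => BenjaminOno.besovCircle s r (q t)))) ∧
    -- Sobolev norms
    (∀ ε : ℝ, 0 < ε → ∃ C : ℝ≥0,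
      (∀ q : ℝ → Lp ℝ 2 (volume : Measure ℝ), BenjaminOno.IsClassicalSolutionLine q →
        BenjaminOno.TwoSidedBound C (2 / (1 + 2 * s)) (-s + ε)
          (fun t => BenjaminOno.sobolevLine s (q t))) ∧
      (∀ q : ℝ → Lp ℝ 2 (AddCircle.haarAddCircle : Measure UnitAddCircle),
        BenjaminOno.IsClassicalSolutionCircle q →
        BenjaminOno.TwoSidedBound C (2 / (1 + 2 * s)) (-s + ε)
          (fun t => BenjaminOno.sobolevCircle s (q t)))) := by
  obtain ⟨C₁, h₁⟩ := BenjaminOno.exists_twoSidedBound_of_isFourier BenjaminOno.isFrequency_id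
    BenjaminOno.isFourier_lineHat hs hs'
  obtain ⟨C₂, h₂⟩ := BenjaminOno.exists_twoSidedBound_of_isFourier
    BenjaminOno.isFrequency_circleFreq BenjaminOno.isFourier_circleHat hs hs'
  refine ⟨fun r hr => ⟨max C₁ C₂, fun q hq => ?_, fun q hq => ?_⟩,
    fun ε hε => ⟨max C₁ C₂, fun q hq => ?_, fun q hq => ?_⟩⟩
  · exact ((h₁ q hq (-s) le_rfl).1 r hr).mono (le_max_left _ _)
  · exact ((h₂ q hq (-s) le_rfl).1 r hr).mono (le_max_right _ _)
  -- The exponent `-s` is already available for `H^s`; `ε` merely weakens it.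
  · exact (h₁ q hq (-s + ε) (by linarith)).2.mono (le_max_left _ _)
  · exact (h₂ q hq (-s + ε) (by linarith)).2.mono (le_max_right _ _)
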